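/- Let $\tfrac53<\sigma<2$ and, for $V>0$, let $$\mathcal K_\infty\varphi(V)=\int_0^\infty v^{-\sigma}\bigl(V^{1/3}+v^{1/3}\bigr)^2\,[\varphi(V+v)-\varphi(V)]\,dv .$$ Put $Q(w)=\frac{w^{\sigma-2}}{\sigma-1}-\int_0^w(z+1)^{-\sigma}(w-z)^{\sigma-2}\,dz$ for $w>0$, and $C_*=\bigl(\int_0^\infty Q(w)\,dw\bigr)^{-1}$. There is a function $G(V,V_0)$ such that for every $V_0>0$: $G(\cdot,V_0)$ is real analytic on $(0,V_0)$; $G(V,V_0)=0$ for $V>V_0$; $-\mathcal K_\infty G(\cdot,V_0)=0$ on $(0,V_0)$ (with absolutely convergent integral); $G(V,V_0)=C_*V_0^{-2/3}(V_0-V)^{\sigma-2}\,[1+O((V_0-V)^{1/3})]$ as $V\to V_0^-$; and $0<G(V,V_0)\le C_*V_0^{-2/3}(V_0-V)^{\sigma-2}$ for $0<V<V_0$. These properties determine $G(V,V_0)$ for $0<V<V_0$. For $\bar V>0$ and $\eta>\bar V$ put $$K(V,\eta;\bar V)=\int_0^{\bar V}G(V,V_0)\,(\eta-V_0)^{-\sigma}\bigl(V_0^{1/3}+(\eta-V_0)^{1/3}\bigr)^2\,dV_0\quad(0<V<\bar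 V).$$ Let $\bar V>0$, let $\Psi\in W^{1,\infty}[\bar V,\infty)$ (i.e. $\Psi$ is bounded and Lipschitz on $[\bar V,\infty)$), and let $g$ be bounded on $(0,\bar V)$ with $g\in\bigcap_{\delta>0}W^{1,\infty}[\delta,\bar V-\delta]$ (i.e. $g$ is Lipschitz on each $[\delta,\bar V-\delta]$). Then the boundary value problem $$-\mathcal K_\infty u(V)=g(V)\ \ (0<V<\bar V),\qquad u(V)=\Psi(V)\ \ (V>\bar V),$$ (the equation holding at every point of $(0,\bar V)$, with absolutely convergent integral) has a solution $u$ with $u\in\bigcap_{\delta>0}W^{1,\infty}[\delta,\bar V-\delta]$ and $$\sup_{0<V<\bar V}(\bar V-V)^{-(\sigma-1)}\,|u(V)-\Psi(\bar V)|<\infty ,$$ and $u$ is unique in this class, up to its value at the single point $\bar V$. Moreover, with absolutely convergent integrals, $$u(V)=\int_V^{\bar V}G(V,V_0)\,g(V_0)\,dV_0+\int_{\bar V}^\infty K(V,\eta;\bar V)\,\Psi(\eta)\,d\eta\qquad(0<V<\bar V).$$ -/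

import Mathlib

open Set MeasureTheory Filter Topology Asymptotics

noncomputable section

namespace Coagulation

/-- The integrand `v^{-σ} (V^{1/3} + v^{1/3})² (φ(V+v) - φ(V))` of the operator `𝒦_∞`. -/
def kInfIntegrand (σ : ℝ) (φ : ℝ → ℝ) (V v : ℝ) : ℝ :=
  v ^ (-σ) * (V ^ (1 / 3 : ℝ) + v ^ (1 / 3 : ℝ)) ^ 2 * (φ (V + v) - φ V)

/-- The nonlocal operator
`𝒦_∞ φ(V) = ∫_0^∞ v^{-σ} (V^{1/3} + v^{1/3})² (φ(V+v) - φ(V)) dv`. -/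
def kInf (σ : ℝ) (φ : ℝ → ℝ) (V : ℝ) : ℝ :=
  ∫ v in Ioi (0 : ℝ), kInfIntegrand σ φ V v

/-- The equation `-𝒦_∞ φ = g` on `(0, b)`, pointwise, the integral defining `𝒦_∞ φ(V)` being
absolutely convergent for every `V ∈ (0, b)`. -/
def SolvesOn (σ b : ℝ) (φ g : ℝ → ℝ) : Prop :=
  ∀ V ∈ Ioo (0 : ℝ) b,
    IntegrableOn (kInfIntegrand σ φ V) (Ioi (0 : ℝ)) ∧ -kInf σ φ V = g V

/-- `f ∈ ⋂_{δ > 0} W^{1,∞}[δ, b - δ]`, for the continuous representative `f`. -/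
def LocLip (b : ℝ) (f : ℝ → ℝ) : Prop :=
  ∀ δ > 0, ∃ L : NNReal, LipschitzOnWith L f (Icc δ (b - δ))

/-- `f ∈ W^{1,∞}[b, ∞)`, for the continuous representative `f`: bounded and Lipschitz. -/
def BddLip (b : ℝ) (f : ℝ → ℝ) : Prop :=
  (∃ M : ℝ, ∀ x ∈ Ici b, |f x| ≤ M) ∧ ∃ L : NNReal, LipschitzOnWith L f (Ici b)

/-- `Q(w) = w^{σ-2}/(σ-1) - ∫_0^w (z+1)^{-σ} (w-z)^{σ-2} dz`. -/
def auxQ (σ w : ℝ) : ℝ :=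
  w ^ (σ - 2) / (σ - 1) - ∫ z in Ioo (0 : ℝ) w, (z + 1) ^ (-σ) * (w - z) ^ (σ - 2)

/-- `C_* = (∫_0^∞ Q(w) dw)⁻¹`. -/
def cStar (σ : ℝ) : ℝ := (∫ w in Ioi (0 : ℝ), auxQ σ w)⁻¹

/-- `G` is a fundamental solution of `-𝒦_∞`. -/
structure IsFundamentalSolution (σ : ℝ) (G : ℝ → ℝ → ℝ) : Prop where
  analytic : ∀ V₀ > 0, AnalyticOnNhd ℝ (fun V => G V V₀) (Ioo 0 V₀)
  vanish : ∀ V₀ > 0, ∀ V > V₀, G V V₀ = 0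
  equation : ∀ V₀ > 0, SolvesOn σ V₀ (fun V => G V V₀) (fun _ => 0)
  asymptotics : ∀ V₀ > 0,
    (fun V => G V V₀ / (cStar σ * V₀ ^ (-(2 / 3) : ℝ) * (V₀ - V) ^ (σ - 2)) - 1)
      =O[𝓝[<] V₀] fun V => (V₀ - V) ^ (1 / 3 : ℝ)
  bounds : ∀ V₀ > 0, ∀ V ∈ Ioo 0 V₀,
    0 < G V V₀ ∧ G V V₀ ≤ cStar σ * V₀ ^ (-(2 / 3) : ℝ) * (V₀ - V) ^ (σ - 2)

/-- The integrand of `K(V, η; b)`, as a function of `V₀ ∈ (0, b)`. -/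
def poissonIntegrand (σ : ℝ) (G : ℝ → ℝ → ℝ) (V η V₀ : ℝ) : ℝ :=
  G V V₀ * ((η - V₀) ^ (-σ) * (V₀ ^ (1 / 3 : ℝ) + (η - V₀) ^ (1 / 3 : ℝ)) ^ 2)

open Classical in
/-- The fundamental solution `K(V, η; b)` of the Dirichlet problem on `(0, b)` for `η > b`:
`K(V, η; b) = ∫_0^b G(V, V₀) (η-V₀)^{-σ} (V₀^{1/3} + (η-V₀)^{1/3})² dV₀` if `V < b`,
and zero otherwise. -/
def poissonKernel (σ : ℝ) (G : ℝ → ℝ → ℝ) (b V η : ℝ) : ℝ :=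
  if V < b then ∫ V₀ in Ioo (0 : ℝ) b, poissonIntegrand σ G V η V₀ else 0

/-- `u` is a solution, in the class where uniqueness holds, of `-𝒦_∞ u = g` on `(0, b)`,
`u = Ψ` on `(b, ∞)`. -/
structure IsBVPSolution (σ b : ℝ) (g Ψ u : ℝ → ℝ) : Prop where
  locLip : LocLip b u
  equation : SolvesOn σ b u g
  boundary : ∀ V > b, u V = Ψ V
  decay : ∃ C : ℝ, ∀ V ∈ Ioo (0 : ℝ) b, (b - V) ^ (-(σ - 1)) * |u V - Ψ b| ≤ C

end Coagulation

end

/-!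
Why the theorem is true.

*The fundamental solution.* By scaling it suffices to place the pole at `V₀ = 1`. Near the pole one
looks for `G` as a series of the truncated powers `(1 - V)_+ ^ (σ - 2 + n / 3)`. On such powers
`-𝒦_∞` acts through explicit moments (`mom`, `integral_marchaud`), and it annihilates the leading
one at top order, since `mom_self` vanishes; the remaining coefficients solve a convergent Frobenius
recursion (`exists_frobenius`, `exists_series_solution`). The resulting function `profile σ F` is
analytic on `(0, 1)` because its power series in `(1 - V)^{1/3}` has radius of convergence at
least `1`. Its bounds `0 < F ≤ 1`, the upper one by comparison with the pure power, and uniqueness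
follow from a maximum principle (`nonneg_of_neg_kInf_nonneg`): as `𝒦_∞` only looks to larger values
of `V`, a supersolution which is nonnegative beyond the pole and in the limit at it cannot become
negative.

*Logarithmic coordinates.* With `V = b e^{-t}` the operator becomes, up to the weight `V^{5/3-σ}`,
the translation invariant operator
`logOp σ Φ t = ∫_0^∞ levy σ y (Φ t - Φ (t - y)) dy`, the generator of a subordinator
(`solvesOn_iff_log`). For functions supported in `[0, ∞)` it is the derivative of convolution with
the tail of `levy σ` (`Causal.integral_logOp`). The fundamental solution becomes the potential
density `U` of the subordinator. As `logOp σ U = 0` on `(0, ∞)`, the convolution of the Lévy tail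
with `U` is constant, and the behaviour at `0` shows that this constant is `1` exactly for the
normalization `C_*` (`IsProfile.hconv_levyTail_potential`, with `cStar_eq` evaluating `C_*` through
the Beta integral). Hence `logOp σ` inverts convolution with `U` on functions supported in `[0, ∞)`
(`Causal.logOp_hconv`).

*The boundary value problem.* Moving the exterior values to the right-hand side turns them into the
additional source `extSource`, and the solution is the convolution of `U` with the total source
(`bvpSolution`). Subtracting the constant `Ψ b`, whose extension is constant, leaves a bounded
source; since `U` behaves like `t^{σ-2}` at `0`, this gives the decay `(b - V)^{σ-1}` at the boundary
(`exists_decay_bvpSolution`). Uniqueness is the maximum principle once more, and Fubini turns the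
convolution with `extSource` into the integral against the kernel `K`
(`integral_poissonKernel_mul`).
-/

noncomputable section

namespace Coagulation

/-! ### Moments of truncated powers -/

/-- The truncated power `x_+^γ`, equal to `0` for `x ≤ 0` whatever the exponent. -/
def powPos (γ x : ℝ) : ℝ := if 0 < x then x ^ γ else 0

lemma powPos_of_pos {γ x : ℝ} (hx : 0 < x) : powPos γ x = x ^ γ := if_pos hx

lemma powPos_of_nonpos {γ x : ℝ} (hx : x ≤ 0) : powPos γ x = 0 := if_neg hx.not_gt

lemma powPos_nonneg (γ x : ℝ) : 0 ≤ powPos γ x := by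
  unfold powPos; split_ifs with h <;> positivity

lemma measurable_powPos (γ : ℝ) : Measurable (powPos γ) :=
  Measurable.ite measurableSet_Ioi (by fun_prop) measurable_const

lemma powPos_mul {γ x y : ℝ} (hx : 0 < x) : powPos γ (x * y) = x ^ γ * powPos γ y := by
  rcases lt_or_ge 0 y with hy | hy
  · rw [powPos_of_pos hy, powPos_of_pos (mul_pos hx hy), Real.mul_rpow hx.le hy.le]
  · rw [powPos_of_nonpos hy, powPos_of_nonpos (mul_nonpos_of_nonneg_of_nonpos hx.le hy), mul_zero]

/-- The symbol of the Marchaud derivative of order `α`: applied to `x_+^γ`, the operator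
`φ ↦ ∫_0^∞ v^{-1-α} (φ(x) - φ(x - v)) dv` gives `mom α γ * x^{γ-α}`. -/
def mom (α γ : ℝ) : ℝ := ∫ t in Ioi (0 : ℝ), t ^ (-1 - α) * (1 - powPos γ (1 - t))

lemma lipschitz_one_sub_rpow (γ : ℝ) :
    ∃ C : ℝ, 0 ≤ C ∧ ∀ t ∈ Icc (0 : ℝ) (1 / 2), |1 - (1 - t) ^ γ| ≤ C * t := by
  have hc : ContDiffOn ℝ 1 (fun t : ℝ => (1 - t) ^ γ) (Icc 0 (1 / 2)) := by
    refine ContDiffOn.rpow_const_of_ne (by fun_prop) ?_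
    intro x hx; have := hx.2; intro h; linarith
  obtain ⟨K, hK⟩ := hc.exists_lipschitzOnWith one_ne_zero (convex_Icc _ _) isCompact_Icc
  refine ⟨K, K.2, fun t ht => ?_⟩
  have := hK.dist_le_mul 0 ⟨le_rfl, by norm_num⟩ t ht
  simpa [Real.dist_eq, abs_of_nonneg ht.1] using this

lemma integrableOn_mom {α γ : ℝ} (hα₀ : 0 < α) (hα₁ : α < 1) (hγ : -1 < γ) :
    IntegrableOn (fun t : ℝ => t ^ (-1 - α) * (1 - powPos γ (1 - t))) (Ioi 0) := by
  have hmeas : Measurable (fun t : ℝ => t ^ (-1 - α) * (1 - powPos γ (1 - t))) :=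
    (by fun_prop : Measurable fun t : ℝ => t ^ (-1 - α)).mul
      (measurable_const.sub ((measurable_powPos γ).comp (by fun_prop)))
  have hun : Ioi (0 : ℝ) = Ioc 0 (1 / 2) ∪ Ioc (1 / 2) 1 ∪ Ioi 1 := by
    rw [Ioc_union_Ioc_eq_Ioc (by norm_num) (by norm_num), Ioc_union_Ioi_eq_Ioi (by norm_num)]
  rw [hun]
  refine IntegrableOn.union (IntegrableOn.union ?_ ?_) ?_
  · obtain ⟨C, hC0, hC⟩ := lipschitz_one_sub_rpow γ
    have h1 : IntegrableOn (fun t : ℝ => C * t ^ (-α)) (Ioc 0 (1 / 2)) := by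
      have := (intervalIntegral.intervalIntegrable_rpow' (a := 0) (b := 1 / 2)
        (r := -α) (by linarith)).1
      exact this.const_mul C
    refine h1.mono' hmeas.aestronglyMeasurable ?_
    refine (ae_restrict_mem measurableSet_Ioc).mono fun t ht => ?_
    rw [powPos_of_pos (by linarith [ht.2]), norm_mul, Real.norm_eq_abs, Real.norm_eq_abs,
      abs_of_nonneg (Real.rpow_nonneg ht.1.le _)]
    calc t ^ (-1 - α) * |1 - (1 - t) ^ γ| ≤ t ^ (-1 - α) * (C * t) := by
          gcongr
          · exact Real.rpow_nonneg ht.1.le _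
          · exact hC t ⟨ht.1.le, ht.2⟩
      _ = C * (t ^ (-1 - α) * t ^ (1 : ℝ)) := by rw [Real.rpow_one]; ring
      _ = C * t ^ (-α) := by rw [← Real.rpow_add ht.1]; congr 2; ring
  · have h1 : IntegrableOn (fun t : ℝ => (1 / 2 : ℝ) ^ (-1 - α) * (1 + (1 - t) ^ γ))
        (Ioc (1 / 2) 1) := by
      refine Integrable.const_mul (Integrable.add (by simp) ?_) _
      have := ((intervalIntegral.intervalIntegrable_rpow' (a := 1 / 2) (b := 0)
        (r := γ) hγ).comp_sub_left 1)
      norm_num at this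
      exact this.1
    refine h1.mono' hmeas.aestronglyMeasurable ?_
    rw [Measure.restrict_congr_set Ioo_ae_eq_Ioc.symm]
    refine (ae_restrict_mem measurableSet_Ioo).mono fun t ht => ?_
    have ht0 : 0 < t := by linarith [ht.1]
    rw [powPos_of_pos (by linarith [ht.2]), norm_mul, Real.norm_eq_abs, Real.norm_eq_abs,
      abs_of_nonneg (Real.rpow_nonneg ht0.le _)]
    have h2 : 0 ≤ (1 - t) ^ γ := Real.rpow_nonneg (by linarith [ht.2]) _
    have h3 : t ^ (-1 - α) ≤ (1 / 2 : ℝ) ^ (-1 - α) :=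
      Real.rpow_le_rpow_of_nonpos (by norm_num) ht.1.le (by linarith)
    gcongr
    exact abs_le.2 ⟨by linarith, by linarith⟩
  · refine (integrableOn_Ioi_rpow_of_lt (a := -1 - α) (by linarith) one_pos).congr_fun ?_
      measurableSet_Ioi
    intro t ht
    have : (1 : ℝ) - t ≤ 0 := by have : 1 < t := ht; linarith
    simp [powPos_of_nonpos this]

lemma marchaud_eq {α γ x v : ℝ} (hx : 0 < x) (hv : 0 < v) :
    (x * v) ^ (-1 - α) * (powPos γ x - powPos γ (x - x * v)) =
      x ^ (γ - α - 1) * (v ^ (-1 - α) * (1 - powPos γ (1 - v))) := by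
  have h1 : x - x * v = x * (1 - v) := by ring
  rw [h1, powPos_mul hx, powPos_of_pos hx, Real.mul_rpow hx.le hv.le]
  have : x ^ (γ - α - 1) = x ^ (-1 - α) * x ^ γ := by rw [← Real.rpow_add hx]; congr 1; ring
  rw [this]; ring

lemma integrableOn_marchaud {α γ x : ℝ} (hα₀ : 0 < α) (hα₁ : α < 1) (hγ : -1 < γ) (hx : 0 < x) :
    IntegrableOn (fun v : ℝ => v ^ (-1 - α) * (powPos γ x - powPos γ (x - v))) (Ioi 0) := by
  have := integrableOn_Ioi_comp_mul_left_iff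
    (fun v : ℝ => v ^ (-1 - α) * (powPos γ x - powPos γ (x - v))) 0 hx
  rw [mul_zero] at this
  rw [← this]
  exact IntegrableOn.congr_fun ((integrableOn_mom hα₀ hα₁ hγ).const_mul (x ^ (γ - α - 1)))
    (fun v hv => (marchaud_eq hx hv).symm) measurableSet_Ioi

lemma integral_marchaud {α γ x : ℝ} (hx : 0 < x) :
    ∫ v in Ioi (0 : ℝ), v ^ (-1 - α) * (powPos γ x - powPos γ (x - v)) =
      x ^ (γ - α) * mom α γ := by
  have := integral_comp_mul_left_Ioi'
    (fun v : ℝ => v ^ (-1 - α) * (powPos γ x - powPos γ (x - v))) 0 hx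
  rw [mul_zero] at this
  rw [← this, setIntegral_congr_fun measurableSet_Ioi (fun v hv => marchaud_eq hx hv),
    integral_const_mul, smul_eq_mul, ← mul_assoc, mom]
  congr 1
  nth_rewrite 1 [← Real.rpow_one x]
  rw [← Real.rpow_add hx]; congr 1; ring

lemma integral_abs_marchaud {α γ x : ℝ} (hγ : 0 < γ) (hx : 0 < x) :
    ∫ v in Ioi (0 : ℝ), ‖v ^ (-1 - α) * (powPos γ x - powPos γ (x - v))‖ =
      x ^ (γ - α) * mom α γ := by
  rw [← integral_marchaud hx]
  refine setIntegral_congr_fun measurableSet_Ioi fun v hv => ?_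
  have hv : 0 < v := hv
  refine Real.norm_of_nonneg (mul_nonneg (Real.rpow_nonneg hv.le _) ?_)
  rw [powPos_of_pos hx]
  rcases lt_or_ge 0 (x - v) with h | h
  · rw [powPos_of_pos h]
    have := Real.rpow_le_rpow h.le (by linarith : x - v ≤ x) hγ.le
    linarith
  · rw [powPos_of_nonpos h]; have := Real.rpow_nonneg hx.le γ; linarith

/-- The function `x_+^{α-1}` is, up to a factor, the potential kernel of the Marchaud derivative
of order `α`, which therefore annihilates it. -/
lemma mom_self {α : ℝ} (hα₀ : 0 < α) (hα₁ : α < 1) : mom α (α - 1) = 0 := by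
  have hint := integrableOn_mom hα₀ hα₁ (γ := α - 1) (by linarith)
  have hun : Ioi (0 : ℝ) = Ioc 0 1 ∪ Ioi 1 := by rw [Ioc_union_Ioi_eq_Ioi (by norm_num)]
  have hd : Disjoint (Ioc (0 : ℝ) 1) (Ioi 1) := by
    rw [Set.disjoint_left]; intro x hx hx'; exact absurd hx' (not_lt.2 hx.2)
  unfold mom
  rw [hun] at hint ⊢
  rw [setIntegral_union hd measurableSet_Ioi hint.left_of_union hint.right_of_union]
  have hI2 : ∫ t in Ioi (1 : ℝ), t ^ (-1 - α) * (1 - powPos (α - 1) (1 - t)) = 1 / α := by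
    rw [setIntegral_congr_fun (g := fun t => t ^ (-1 - α)) measurableSet_Ioi]
    · rw [integral_Ioi_rpow_of_lt (by linarith) one_pos]
      rw [show (-1 - α + 1 : ℝ) = -α by ring, Real.one_rpow, neg_div_neg_eq]
    · intro t ht
      have : (1 : ℝ) - t ≤ 0 := by have : 1 < t := ht; linarith
      simp [powPos_of_nonpos this]
  -- An antiderivative on `(0, 1)` is `t^{-α} ((1 - t)^α - 1) / α`.
  have hI1 : ∫ t in Ioc (0 : ℝ) 1, t ^ (-1 - α) * (1 - powPos (α - 1) (1 - t)) = -(1 / α) := by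
    rw [← intervalIntegral.integral_of_le zero_le_one]
    have key := intervalIntegral.integral_eq_sub_of_hasDerivAt_of_le (a := 0) (b := 1)
      (f := fun t : ℝ => t ^ (-α) * ((1 - t) ^ α - 1) / α)
      (f' := fun t => t ^ (-1 - α) * (1 - powPos (α - 1) (1 - t))) zero_le_one ?_ ?_ ?_
    · rw [key]; simp [Real.zero_rpow hα₀.ne', neg_div]
    · intro t ht
      rcases eq_or_lt_of_le ht.1 with h0 | h0
      · subst h0
        obtain ⟨C, hC0, hC⟩ := lipschitz_one_sub_rpow α
        have hlim : Tendsto (fun t : ℝ => t ^ (-α) * ((1 - t) ^ α - 1) / α) (𝓝[>] 0) (𝓝 0) := by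
          have hz : Tendsto (fun t : ℝ => C * t ^ (1 - α) / α) (𝓝[>] 0) (𝓝 0) := by
            have : ContinuousAt (fun t : ℝ => C * t ^ (1 - α) / α) 0 := by
              have := Real.continuousAt_rpow_const 0 (1 - α) (Or.inr (by linarith))
              fun_prop
            have h := this.tendsto
            simp only [Real.zero_rpow (by linarith : (1 : ℝ) - α ≠ 0), mul_zero, zero_div] at h
            exact h.mono_left nhdsWithin_le_nhds
          refine squeeze_zero_norm' ?_ hz
          filter_upwards [Ioo_mem_nhdsGT (show (0 : ℝ) < 1 / 2 by norm_num)] with t ht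
          have h := hC t ⟨ht.1.le, ht.2.le⟩
          rw [norm_div, norm_mul, Real.norm_eq_abs, Real.norm_eq_abs, Real.norm_eq_abs,
            abs_of_pos hα₀, abs_of_nonneg (Real.rpow_nonneg ht.1.le _), abs_sub_comm]
          refine div_le_div_of_nonneg_right ?_ hα₀.le
          calc t ^ (-α) * |1 - (1 - t) ^ α| ≤ t ^ (-α) * (C * t) := by
                gcongr; exact Real.rpow_nonneg ht.1.le _
            _ = C * (t ^ (-α) * t ^ (1 : ℝ)) := by rw [Real.rpow_one]; ring
            _ = C * t ^ (1 - α) := by rw [← Real.rpow_add ht.1]; congr 2; ring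
        have h0 : (fun t : ℝ => t ^ (-α) * ((1 - t) ^ α - 1) / α) 0 = 0 := by simp
        have : ContinuousWithinAt (fun t : ℝ => t ^ (-α) * ((1 - t) ^ α - 1) / α) (Ioi 0) 0 := by
          unfold ContinuousWithinAt; rw [h0]; exact hlim
        exact (continuousWithinAt_Ioi_iff_Ici.1 this).mono Icc_subset_Ici_self
      · apply ContinuousAt.continuousWithinAt
        have h1 : ContinuousAt (fun t : ℝ => t ^ (-α)) t :=
          Real.continuousAt_rpow_const _ _ (Or.inl h0.ne')
        have h2 : ContinuousAt (fun t : ℝ => (1 - t) ^ α) t :=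
          ContinuousAt.rpow_const (by fun_prop) (Or.inr hα₀.le)
        fun_prop
    · intro t ht
      have ht1 : 0 < 1 - t := by linarith [ht.2]
      have h1 := (Real.hasDerivAt_rpow_const (x := t) (p := -α) (Or.inl ht.1.ne'))
      have h2 : HasDerivAt (fun t : ℝ => (1 - t) ^ α) (-1 * α * (1 - t) ^ (α - 1)) t :=
        ((hasDerivAt_id t).const_sub 1).rpow_const (Or.inl ht1.ne')
      have h3 := (h1.mul (h2.sub_const 1)).div_const α
      refine h3.congr_deriv ?_
      rw [powPos_of_pos ht1]
      have e1 : t ^ (-α) = t ^ (-1 - α) * t := by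
        nth_rewrite 3 [← Real.rpow_one t]
        rw [← Real.rpow_add ht.1]; congr 1; ring
      have e2 : (1 - t) ^ α = (1 - t) ^ (α - 1) * (1 - t) := by
        nth_rewrite 3 [← Real.rpow_one (1 - t)]
        rw [← Real.rpow_add ht1]; congr 1; ring
      have e3 : t ^ (-α - 1) = t ^ (-1 - α) := by congr 1; ring
      rw [e3, e1, e2]
      field_simp
      ring
    · rw [intervalIntegrable_iff_integrableOn_Ioc_of_le zero_le_one]
      exact hint.left_of_union
  rw [hI1, hI2]; ring

/-- Enlarging the weight of the jumps by `t^c` raises the moment of `x_+^{α-1}` above its value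
`0` for `c = 0`, as the integrand changes sign at `t = 1` only. -/
lemma mom_sub_self_nonneg {α c : ℝ} (hα₀ : 0 < α) (hα₁ : α < 1) (hc : 0 ≤ c) (hcα : c < α) :
    0 ≤ mom (α - c) (α - 1) := by
  rw [← mom_self hα₀ hα₁]
  refine setIntegral_mono_on (integrableOn_mom hα₀ hα₁ (by linarith))
    (integrableOn_mom (by linarith) (by linarith) (by linarith)) measurableSet_Ioi
    fun t (ht : 0 < t) => ?_
  have e : t ^ (-1 - (α - c)) = t ^ (-1 - α) * t ^ c := by
    rw [← Real.rpow_add ht]; congr 1; ring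
  rw [e]
  have h0 := Real.rpow_nonneg ht.le (-1 - α)
  have : 0 ≤ (t ^ c - 1) * (1 - powPos (α - 1) (1 - t)) := by
    rcases lt_or_ge t 1 with h | h
    · rw [powPos_of_pos (by linarith)]
      refine mul_nonneg_of_nonpos_of_nonpos ?_ ?_
      · have := Real.rpow_le_one ht.le h.le hc; linarith
      · have := Real.one_le_rpow_of_pos_of_le_one_of_nonpos (x := 1 - t) (z := α - 1)
          (by linarith) (by linarith) (by linarith)
        linarith
    · rw [powPos_of_nonpos (by linarith)]
      have := Real.one_le_rpow h hc
      simp; linarith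
  nlinarith [mul_nonneg h0 this]

lemma one_sub_powPos_mem {γ t : ℝ} (hγ : 0 < γ) (ht : 0 < t) :
    0 ≤ 1 - powPos γ (1 - t) ∧ 1 - powPos γ (1 - t) ≤ 1 := by
  refine ⟨?_, by linarith [powPos_nonneg γ (1 - t)]⟩
  rcases lt_or_ge 0 (1 - t) with h | h
  · rw [powPos_of_pos h]
    have := Real.rpow_le_one h.le (by linarith) hγ.le
    linarith
  · rw [powPos_of_nonpos h]; norm_num

lemma mom_nonneg {α γ : ℝ} (hγ : 0 < γ) : 0 ≤ mom α γ :=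
  setIntegral_nonneg measurableSet_Ioi fun _ ht =>
    mul_nonneg (Real.rpow_nonneg (le_of_lt ht) _) (one_sub_powPos_mem hγ ht).1

/-- Splitting the jumps at size `δ`. -/
lemma mom_sub_le {α c γ δ : ℝ} (hα₁ : α < 1) (hc : 0 ≤ c) (hcα : c < α) (hγ : 0 < γ)
    (hδ : 0 < δ) :
    mom (α - c) γ ≤ δ ^ c * mom α γ + δ ^ (-(α - c)) / (α - c) := by
  have hα₀ : 0 < α := by linarith
  have hi := integrableOn_mom hα₀ hα₁ (γ := γ) (by linarith)
  have hi' := integrableOn_mom (α := α - c) (by linarith) (by linarith) (γ := γ) (by linarith)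
  have hun : Ioi (0 : ℝ) = Ioc 0 δ ∪ Ioi δ := by rw [Ioc_union_Ioi_eq_Ioi hδ.le]
  have hd : Disjoint (Ioc (0 : ℝ) δ) (Ioi δ) := by
    rw [Set.disjoint_left]; intro x hx hx'; exact absurd hx' (not_lt.2 hx.2)
  have h1 : ∫ t in Ioc 0 δ, t ^ (-1 - (α - c)) * (1 - powPos γ (1 - t)) ≤ δ ^ c * mom α γ := by
    calc ∫ t in Ioc 0 δ, t ^ (-1 - (α - c)) * (1 - powPos γ (1 - t))
        ≤ ∫ t in Ioc 0 δ, δ ^ c * (t ^ (-1 - α) * (1 - powPos γ (1 - t))) := by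
          refine setIntegral_mono_on (hi'.mono_set Ioc_subset_Ioi_self)
            ((hi.mono_set Ioc_subset_Ioi_self).const_mul _) measurableSet_Ioc fun t ht => ?_
          have e : t ^ (-1 - (α - c)) = t ^ (-1 - α) * t ^ c := by
            rw [← Real.rpow_add ht.1]; congr 1; ring
          have h0 := Real.rpow_nonneg ht.1.le (-1 - α)
          have h1 := Real.rpow_le_rpow ht.1.le ht.2 hc
          have h2 := (one_sub_powPos_mem hγ ht.1).1
          rw [e]
          nlinarith [mul_nonneg (mul_nonneg h0 h2) (sub_nonneg.2 h1)]
      _ = δ ^ c * ∫ t in Ioc 0 δ, (t ^ (-1 - α) * (1 - powPos γ (1 - t))) := by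
          rw [integral_const_mul]
      _ ≤ δ ^ c * mom α γ := by
          gcongr
          refine setIntegral_mono_set hi ?_ (Ioc_subset_Ioi_self.eventuallyLE)
          refine (ae_restrict_mem measurableSet_Ioi).mono fun t ht => ?_
          exact mul_nonneg (Real.rpow_nonneg (le_of_lt ht) _) (one_sub_powPos_mem hγ ht).1
  have h2 : ∫ t in Ioi δ, t ^ (-1 - (α - c)) * (1 - powPos γ (1 - t)) ≤
      δ ^ (-(α - c)) / (α - c) := by
    calc ∫ t in Ioi δ, t ^ (-1 - (α - c)) * (1 - powPos γ (1 - t))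
        ≤ ∫ t in Ioi δ, t ^ (-1 - (α - c)) := by
          refine setIntegral_mono_on (hi'.mono_set (Ioi_subset_Ioi hδ.le))
            (integrableOn_Ioi_rpow_of_lt (by linarith) hδ) measurableSet_Ioi fun t ht => ?_
          have ht0 : 0 < t := hδ.trans ht
          exact mul_le_of_le_one_right (Real.rpow_nonneg ht0.le _) (one_sub_powPos_mem hγ ht0).2
      _ = δ ^ (-(α - c)) / (α - c) := by
          rw [integral_Ioi_rpow_of_lt (by linarith) hδ]
          have : (-1 - (α - c) + 1) = -(α - c) := by ring
          rw [this, neg_div_neg_eq]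
  rw [mom, hun, setIntegral_union hd measurableSet_Ioi (hi'.mono_set Ioc_subset_Ioi_self)
    (hi'.mono_set (Ioi_subset_Ioi hδ.le))]
  linarith

/-- Only the jumps larger than `1 / γ` are kept, for which `(1 - t)^γ ≤ e⁻¹`. -/
lemma le_mom {α γ : ℝ} (hα₀ : 0 < α) (hα₁ : α < 1) (hγ : 0 < γ) :
    γ ^ α / α * (1 - Real.exp (-1)) ≤ mom α γ := by
  have hi := integrableOn_mom hα₀ hα₁ (γ := γ) (by linarith)
  have hδ : 0 < γ⁻¹ := inv_pos.2 hγ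
  calc γ ^ α / α * (1 - Real.exp (-1))
      = ∫ t in Ioi γ⁻¹, t ^ (-1 - α) * (1 - Real.exp (-1)) := by
        rw [integral_mul_const, integral_Ioi_rpow_of_lt (by linarith) hδ]
        have : (-1 - α + 1) = -α := by ring
        rw [this, neg_div_neg_eq, Real.inv_rpow hγ.le, Real.rpow_neg hγ.le, inv_inv]
    _ ≤ ∫ t in Ioi γ⁻¹, t ^ (-1 - α) * (1 - powPos γ (1 - t)) := by
        refine setIntegral_mono_on
          ((integrableOn_Ioi_rpow_of_lt (by linarith) hδ).mul_const _)
          (hi.mono_set (Ioi_subset_Ioi hδ.le)) measurableSet_Ioi fun t ht => ?_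
        have ht0 : 0 < t := hδ.trans ht
        have h0 := Real.rpow_nonneg ht0.le (-1 - α)
        gcongr
        rcases lt_or_ge 0 (1 - t) with h | h
        · rw [powPos_of_pos h]
          calc (1 - t) ^ γ ≤ (Real.exp (-t)) ^ γ := by
                gcongr; linarith [Real.add_one_le_exp (-t)]
            _ = Real.exp (-(t * γ)) := by rw [← Real.exp_mul]; congr 1; ring
            _ ≤ Real.exp (-1) := by
                gcongr
                have : γ⁻¹ < t := ht
                rw [inv_lt_iff_one_lt_mul₀ hγ] at this
                linarith
        · rw [powPos_of_nonpos h]; positivity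
    _ ≤ mom α γ := by
        refine setIntegral_mono_set hi ?_ (Ioi_subset_Ioi hδ.le).eventuallyLE
        refine (ae_restrict_mem measurableSet_Ioi).mono fun t ht => ?_
        exact mul_nonneg (Real.rpow_nonneg (le_of_lt ht) _) (one_sub_powPos_mem hγ ht).1

lemma mom_pos {α γ : ℝ} (hα₀ : 0 < α) (hα₁ : α < 1) (hγ : 0 < γ) : 0 < mom α γ := by
  refine lt_of_lt_of_le ?_ (le_mom hα₀ hα₁ hγ)
  have : Real.exp (-1) < 1 := by simp
  have := Real.rpow_pos_of_pos hγ α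
  have h3 : 0 < 1 - Real.exp (-1) := by linarith
  positivity

lemma tendsto_mom {α : ℝ} (hα₀ : 0 < α) (hα₁ : α < 1) {γ : ℕ → ℝ}
    (hγ : Tendsto γ atTop atTop) : Tendsto (fun n => mom α (γ n)) atTop atTop := by
  have h1 : Tendsto (fun n => γ n ^ α / α * (1 - Real.exp (-1))) atTop atTop := by
    have h3 : 0 < 1 - Real.exp (-1) := by
      have : Real.exp (-1) < 1 := by simp
      linarith
    exact (((tendsto_rpow_atTop hα₀).comp hγ).atTop_div_const hα₀).atTop_mul_const h3
  refine tendsto_atTop_mono' _ ?_ h1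
  filter_upwards [hγ.eventually_gt_atTop 0] with n hn using le_mom hα₀ hα₁ hn

lemma tendsto_mom_div {α c : ℝ} (hα₁ : α < 1) (hc : 0 < c) (hcα : c < α) {γ : ℕ → ℝ}
    (hγ : Tendsto γ atTop atTop) :
    Tendsto (fun n => mom (α - c) (γ n) / mom α (γ n)) atTop (𝓝 0) := by
  have hα₀ : 0 < α := by linarith
  rw [Metric.tendsto_atTop]
  intro ε hε
  set δ : ℝ := (ε / 2) ^ (1 / c) with hδdef
  have hδ : 0 < δ := by positivity
  have hδc : δ ^ c = ε / 2 := by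
    rw [hδdef, ← Real.rpow_mul (by positivity), one_div_mul_cancel hc.ne', Real.rpow_one]
  have hev := (tendsto_mom hα₀ hα₁ hγ).eventually_gt_atTop (δ ^ (-(α - c)) / (α - c) / (ε / 2))
  obtain ⟨N, hN⟩ := eventually_atTop.1 (hev.and (hγ.eventually_gt_atTop 0))
  refine ⟨N, fun n hn => ?_⟩
  obtain ⟨h1, h2⟩ := hN n hn
  have hm := mom_pos hα₀ hα₁ h2
  have h3 := mom_sub_le hα₁ hc.le hcα h2 hδ
  have h4 : 0 ≤ mom (α - c) (γ n) := mom_nonneg h2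
  rw [Real.dist_eq, sub_zero, abs_of_nonneg (div_nonneg h4 hm.le), div_lt_iff₀ hm]
  rw [div_lt_iff₀ (by positivity)] at h1
  rw [hδc] at h3
  nlinarith

/-! ### Power series solving the equation near the pole -/

/-- The sequence with value `1` at `0` which solves
`m (n + 1) b (n + 1) + ∑_{k ≤ n} K n k b k = 0`. -/
def recSeq (m : ℕ → ℝ) (K : ℕ → ℕ → ℝ) : ℕ → ℝ
  | 0 => 1
  | n + 1 => -(∑ k : Fin (n + 1), K n k * recSeq m K k) / m (n + 1)
decreasing_by exact k.2

lemma recSeq_zero (m : ℕ → ℝ) (K : ℕ → ℕ → ℝ) : recSeq m K 0 = 1 := by rw [recSeq]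

lemma recSeq_succ (m : ℕ → ℝ) (K : ℕ → ℕ → ℝ) (n : ℕ) :
    recSeq m K (n + 1) = -(∑ k ∈ Finset.range (n + 1), K n k * recSeq m K k) / m (n + 1) := by
  rw [recSeq, Finset.sum_range]

/-- A discrete Gronwall inequality: in a renewal-type recursion whose coefficients `τ k` tend to
zero, the growth is not faster than that of the kernel `d`. -/
lemma exists_bound_of_renewal {p d τ : ℕ → ℝ} {r : ℝ} (hr₀ : 0 < r) (hr₁ : r < 1)
    (hp₀ : ∀ n, 0 ≤ p n) (hd₀ : ∀ n, 0 ≤ d n) (hτ₀ : ∀ n, 0 ≤ τ n)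
    (hτ : Tendsto τ atTop (𝓝 0)) (hd : Summable fun n => d n * r ^ n)
    (h₀ : p 0 ≤ 1) (hp : ∀ n, p (n + 1) ≤ ∑ k ∈ Finset.range (n + 1), d (n - k) * τ k * p k) :
    ∃ C, ∀ n, p n * r ^ n ≤ C := by
  set D := ∑' n, d n * r ^ n with hD
  have hdr : ∀ n, 0 ≤ d n * r ^ n := fun n => mul_nonneg (hd₀ n) (by positivity)
  have hD0 : 0 ≤ D := tsum_nonneg hdr
  have hdD : ∀ n, d n * r ^ n ≤ D := fun n => hd.le_tsum n fun m _ => hdr m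
  obtain ⟨N, hN⟩ := eventually_atTop.1
    (hτ.eventually (eventually_le_nhds (show (0 : ℝ) < 1 / (2 * (D + 1)) by positivity)))
  -- For `k ≥ N` the coefficients are so small that these terms reproduce at most half of the bound
  -- `2 * C`; the finitely many others are absorbed into `C`.
  set C := 1 + ∑ k ∈ Finset.range N, D * τ k * (p k * r ^ k) with hC
  have hterm : ∀ k, 0 ≤ D * τ k * (p k * r ^ k) := fun k =>
    mul_nonneg (mul_nonneg hD0 (hτ₀ k)) (mul_nonneg (hp₀ k) (by positivity))
  have hC1 : 1 ≤ C := by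
    have := Finset.sum_nonneg (fun k (_ : k ∈ Finset.range N) => hterm k)
    linarith
  refine ⟨2 * C, fun n => ?_⟩
  induction n using Nat.strong_induction_on with
  | _ n ih =>
  rcases n with _ | n
  · simp; linarith
  have key : ∀ k ∈ Finset.range (n + 1), d (n - k) * τ k * p k * r ^ n ≤
      (if k < N then D * τ k * (p k * r ^ k) else 0) +
        d (n - k) * r ^ (n - k) * (C / (D + 1)) := by
    intro k hk
    have hkn : k ≤ n := by simpa [Nat.lt_succ_iff] using hk
    have e : d (n - k) * τ k * p k * r ^ n =
        (d (n - k) * r ^ (n - k)) * τ k * (p k * r ^ k) := by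
      rw [show r ^ n = r ^ (n - k) * r ^ k by rw [← pow_add, Nat.sub_add_cancel hkn]]; ring
    have hpk : 0 ≤ p k * r ^ k := mul_nonneg (hp₀ k) (by positivity)
    rw [e]
    split_ifs with h
    · have h1 : d (n - k) * r ^ (n - k) * τ k * (p k * r ^ k) ≤ D * τ k * (p k * r ^ k) := by
        gcongr
        · exact hτ₀ k
        · exact hdD _
      have h2 : 0 ≤ d (n - k) * r ^ (n - k) * (C / (D + 1)) :=
        mul_nonneg (hdr _) (by positivity)
      linarith
    · have h1 := hN k (not_lt.1 h)
      have h2 := ih k (Nat.lt_succ_of_le hkn)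
      have h3 : τ k * (p k * r ^ k) ≤ 1 / (2 * (D + 1)) * (2 * C) :=
        mul_le_mul h1 h2 hpk (by positivity)
      have h4 : 1 / (2 * (D + 1)) * (2 * C) = C / (D + 1) := by field_simp
      rw [zero_add, mul_assoc, ← h4]
      exact mul_le_mul_of_nonneg_left h3 (hdr _)
  have hrn : r ^ (n + 1) ≤ r ^ n := pow_le_pow_of_le_one hr₀.le hr₁.le (Nat.le_succ n)
  calc p (n + 1) * r ^ (n + 1) ≤ p (n + 1) * r ^ n := by gcongr; exact hp₀ _
    _ ≤ (∑ k ∈ Finset.range (n + 1), d (n - k) * τ k * p k) * r ^ n := by gcongr; exact hp n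
    _ = ∑ k ∈ Finset.range (n + 1), d (n - k) * τ k * p k * r ^ n := by rw [Finset.sum_mul]
    _ ≤ _ := Finset.sum_le_sum key
    _ = (∑ k ∈ Finset.range (n + 1), if k < N then D * τ k * (p k * r ^ k) else 0) +
        (∑ k ∈ Finset.range (n + 1), d (n - k) * r ^ (n - k)) * (C / (D + 1)) := by
        rw [Finset.sum_add_distrib, Finset.sum_mul]
    _ ≤ (C - 1) + D * (C / (D + 1)) := by
        gcongr
        · rw [← Finset.sum_filter, hC, add_sub_cancel_left]
          refine Finset.sum_le_sum_of_subset_of_nonneg ?_ fun k _ _ => hterm k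
          intro k hk; simp at hk ⊢; exact hk.2
        · have := Finset.sum_range_reflect (fun j => d j * r ^ j) (n + 1)
          simp only [Nat.add_sub_cancel] at this
          rw [this]
          exact hd.sum_le_tsum _ fun m _ => hdr m
    _ ≤ 2 * C := by
        have : D * (C / (D + 1)) ≤ C := by
          rw [← mul_div_assoc, div_le_iff₀ (by positivity)]; nlinarith
        linarith

lemma summable_of_forall_bound {p : ℕ → ℝ} (hp₀ : ∀ n, 0 ≤ p n)
    (h : ∀ r : ℝ, 0 < r → r < 1 → ∃ C, ∀ n, p n * r ^ n ≤ C) {s : ℝ} (hs₀ : 0 ≤ s) (hs₁ : s < 1) :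
    Summable fun n => p n * s ^ n := by
  obtain ⟨r, hr1, hr2⟩ := exists_between hs₁
  have hr0 : 0 < r := hs₀.trans_lt hr1
  obtain ⟨C, hC⟩ := h r hr0 hr2
  have hg : Summable fun n : ℕ => C * (s / r) ^ n :=
    (summable_geometric_of_lt_one (by positivity) ((div_lt_one hr0).2 hr1)).mul_left C
  refine Summable.of_nonneg_of_le (fun n => mul_nonneg (hp₀ n) (by positivity)) (fun n => ?_) hg
  rw [div_pow, mul_div_assoc', le_div_iff₀ (by positivity)]
  have := mul_le_mul_of_nonneg_right (hC n) (pow_nonneg hs₀ n)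
  linarith

/-- The function `(1 - s³)^{-a}` has a power series of radius at least `1`. -/
lemma exists_series_one_sub_cube (a : ℝ) :
    ∃ e : ℕ → ℝ, ∀ s : ℝ, 0 ≤ s → s < 1 →
      HasSum (fun n => e n * s ^ n) (1 / (1 - s ^ 3) ^ a) := by
  set c : ℕ → ℝ := fun n => Ring.choose (a + n - 1) n with hc
  refine ⟨fun n => if 3 ∣ n then c (n / 3) else 0, fun s hs₀ hs₁ => ?_⟩
  have hs3 : s ^ 3 < 1 := pow_lt_one₀ hs₀ hs₁ (by norm_num)
  have hmem : s ^ 3 ∈ Metric.eball (0 : ℝ) 1 := by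
    rw [Metric.mem_eball, edist_dist, Real.dist_eq, sub_zero, abs_of_nonneg (by positivity)]
    rw [← ENNReal.ofReal_one]
    exact (ENNReal.ofReal_lt_ofReal_iff one_pos).2 hs3
  have h := (Real.one_div_one_sub_rpow_hasFPowerSeriesOnBall_zero a).hasSum hmem
  rw [zero_add] at h
  have hinj : Function.Injective (fun n : ℕ => 3 * n) := fun m n hmn => by simpa using hmn
  rw [← hinj.hasSum_iff]
  · refine h.congr_fun fun n => ?_
    simp only [FormalMultilinearSeries.ofScalars_apply_eq, hc, smul_eq_mul, Function.comp_apply,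
      dvd_mul_right, if_true, pow_mul]
    rw [Nat.mul_div_cancel_left n (by norm_num)]
  · intro n hn
    have : ¬ 3 ∣ n := fun ⟨k, hk⟩ => hn ⟨k, hk.symm⟩
    simp [this]

/-- The Cauchy product, shifted by one index. -/
lemma tsum_shift_cauchy {e q : ℕ → ℝ} {s : ℝ} (he : Summable fun n => ‖e n * s ^ n‖)
    (hq : Summable fun n => ‖q n * s ^ n‖) :
    HasSum (fun n => (∑ k ∈ Finset.range (n + 1), e (n - k) * q k) * s ^ n)
      ((∑' n, e n * s ^ n) * ∑' n, q n * s ^ n) := by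
  have h1 := summable_norm_sum_mul_range_of_summable_norm hq he
  have h2 := tsum_mul_tsum_eq_tsum_sum_range_of_summable_norm hq he
  have e1 : ∀ n, ∑ k ∈ Finset.range (n + 1), q k * s ^ k * (e (n - k) * s ^ (n - k)) =
      (∑ k ∈ Finset.range (n + 1), e (n - k) * q k) * s ^ n := by
    intro n
    rw [Finset.sum_mul]
    refine Finset.sum_congr rfl fun k hk => ?_
    have hkn : k ≤ n := by simpa [Nat.lt_succ_iff] using hk
    rw [show s ^ n = s ^ (n - k) * s ^ k by rw [← pow_add, Nat.sub_add_cancel hkn]]; ring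
  simp only [e1] at h1 h2
  rw [mul_comm, h2]
  exact h1.of_norm.hasSum

/-- A Frobenius-type existence result. If `m₀` dominates `m₁` and `m₂` at infinity, the equation
`(1-s³)^{2/3} ∑ bₙ m₀(n) sⁿ + 2 (1-s³)^{1/3} s ∑ bₙ m₁(n) sⁿ + s² ∑ bₙ m₂(n) sⁿ = 0` has a formal
solution with `b₀ = 1`, and it converges for `s < 1`. -/
lemma exists_frobenius {m₀ m₁ m₂ : ℕ → ℝ} (hm₀ : m₀ 0 = 0) (hpos : ∀ n, 0 < m₀ (n + 1))
    (hlim₀ : Tendsto m₀ atTop atTop)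
    (hlim₁ : Tendsto (fun n => m₁ n / m₀ n) atTop (𝓝 0))
    (hlim₂ : Tendsto (fun n => m₂ n / m₀ n) atTop (𝓝 0)) :
    ∃ b : ℕ → ℝ, b 0 = 1 ∧
      (∀ s : ℝ, 0 ≤ s → s < 1 → Summable (fun n => |b n| * s ^ n) ∧
        Summable (fun n => |b n * m₀ n| * s ^ n) ∧ Summable (fun n => |b n * m₁ n| * s ^ n) ∧
        Summable (fun n => |b n * m₂ n| * s ^ n)) ∧
      ∀ s : ℝ, 0 ≤ s → s < 1 →
        (1 - s ^ 3) ^ (2 / 3 : ℝ) * ∑' n, b n * m₀ n * s ^ n +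
          2 * (1 - s ^ 3) ^ (1 / 3 : ℝ) * (s * ∑' n, b n * m₁ n * s ^ n) +
          s ^ 2 * ∑' n, b n * m₂ n * s ^ n = 0 := by
  obtain ⟨e, he⟩ := exists_series_one_sub_cube (1 / 3)
  obtain ⟨f, hf⟩ := exists_series_one_sub_cube (2 / 3)
  set f' : ℕ → ℝ := fun n => if n = 0 then 0 else f (n - 1) with hf'
  have hf's : ∀ s : ℝ, 0 ≤ s → s < 1 →
      HasSum (fun n => f' n * s ^ n) (s * (1 / (1 - s ^ 3) ^ (2 / 3 : ℝ))) := by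
    intro s h0 h1
    rw [← hasSum_nat_add_iff' 1]
    simpa [hf', pow_succ, mul_comm, mul_left_comm] using (hf s h0 h1).mul_left s
  -- Dividing the equation by `(1 - s³)^{2/3}` gives a recursion for `b` with this kernel.
  set K : ℕ → ℕ → ℝ := fun n k => 2 * (e (n - k) * m₁ k) + f' (n - k) * m₂ k with hK
  set b := recSeq m₀ K with hb
  -- As `m₀ 0 = 0`, the weight `m₀` is changed at `0` in order to divide by it.
  set M : ℕ → ℝ := fun n => if n = 0 then 1 else m₀ n with hM
  have hMpos : ∀ n, 0 < M n := by
    intro n; rcases n with _ | n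
    · simp [hM]
    · simpa [hM] using hpos n
  have hMev : M =ᶠ[atTop] m₀ := by
    filter_upwards [eventually_ne_atTop 0] with n hn
    simp [hM, hn]
  set τ : ℕ → ℝ := fun n => (|m₁ n| + |m₂ n|) / M n with hτ
  have hτlim : Tendsto τ atTop (𝓝 0) := by
    have h := hlim₁.abs.add hlim₂.abs
    simp only [abs_zero, add_zero] at h
    refine h.congr' ?_
    filter_upwards [hMev, hlim₀.eventually_gt_atTop 0] with n hn hn'
    rw [hτ]; simp only [hn]
    rw [abs_div, abs_div, abs_of_pos hn', add_div]
  have hτ0 : ∀ n, 0 ≤ τ n := fun n => div_nonneg (by positivity) (hMpos n).le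
  set d : ℕ → ℝ := fun n => 2 * |e n| + |f' n| with hd
  -- The Gronwall inequality is applied to `m₀ |b|`, the quantity the recursion determines.
  set p : ℕ → ℝ := fun n => M n * |b n| with hp
  have hp0 : ∀ n, 0 ≤ p n := fun n => mul_nonneg (hMpos n).le (abs_nonneg _)
  have habs : ∀ {q : ℕ → ℝ} {s t : ℝ}, 0 ≤ s → HasSum (fun n => q n * s ^ n) t →
      Summable fun n => |q n| * s ^ n := by
    intro q s t hs h
    refine h.summable.abs.congr fun n => ?_
    rw [abs_mul, abs_of_nonneg (pow_nonneg hs n)]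
  have hbound : ∀ r : ℝ, 0 < r → r < 1 → ∃ C, ∀ n, p n * r ^ n ≤ C := by
    intro r hr0 hr1
    refine exists_bound_of_renewal (d := d) hr0 hr1 hp0 (fun n => by positivity) hτ0 hτlim ?_ ?_ ?_
    · refine (((habs hr0.le (he r hr0.le hr1)).mul_left 2).add
        (habs hr0.le (hf's r hr0.le hr1))).congr fun n => ?_
      simp only [hd]; ring
    · simp [hp, hM, hb, recSeq_zero]
    · intro n
      have hMn : M (n + 1) = m₀ (n + 1) := by simp [hM]
      simp only [hp]
      rw [hMn, hb, recSeq_succ, ← hb, abs_div, abs_neg, abs_of_pos (hpos n),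
        mul_div_cancel₀ _ (hpos n).ne']
      refine (Finset.abs_sum_le_sum_abs _ _).trans (Finset.sum_le_sum fun k _ => ?_)
      have e1 : d (n - k) * τ k * (M k * |b k|) = d (n - k) * (|m₁ k| + |m₂ k|) * |b k| := by
        simp only [hτ]; field_simp [(hMpos k).ne']
      rw [e1, abs_mul]
      gcongr
      simp only [hK, hd]
      calc |2 * (e (n - k) * m₁ k) + f' (n - k) * m₂ k|
          ≤ |2 * (e (n - k) * m₁ k)| + |f' (n - k) * m₂ k| := abs_add_le _ _
        _ = 2 * |e (n - k)| * |m₁ k| + |f' (n - k)| * |m₂ k| := by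
            rw [abs_mul, abs_mul, abs_mul, abs_two]; ring
        _ ≤ _ := by
            have h1 := mul_nonneg (abs_nonneg (e (n - k))) (abs_nonneg (m₂ k))
            have h2 := mul_nonneg (abs_nonneg (f' (n - k))) (abs_nonneg (m₁ k))
            nlinarith
  have hpsum : ∀ s : ℝ, 0 ≤ s → s < 1 → Summable fun n => p n * s ^ n := fun s h0 h1 =>
    summable_of_forall_bound hp0 hbound h0 h1
  have hdom : ∀ {q : ℕ → ℝ}, (∃ C, ∀ n, |q n| ≤ C * M n) → ∀ s : ℝ, 0 ≤ s → s < 1 →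
      Summable fun n => |b n * q n| * s ^ n := by
    rintro q ⟨C, hC⟩ s h0 h1
    refine Summable.of_nonneg_of_le (fun n => by positivity) (fun n => ?_)
      ((hpsum s h0 h1).mul_left C)
    rw [abs_mul]
    have := mul_le_mul_of_nonneg_left (hC n) (abs_nonneg (b n))
    have := mul_le_mul_of_nonneg_right this (pow_nonneg h0 n)
    simp only [hp]; linarith
  obtain ⟨T, hT⟩ : ∃ T, ∀ n, τ n ≤ T := by
    obtain ⟨T, hT⟩ := hτlim.bddAbove_range
    exact ⟨T, fun n => hT ⟨n, rfl⟩⟩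
  have hτM : ∀ n, |m₁ n| + |m₂ n| ≤ T * M n := fun n => by
    have := hT n
    simp only [hτ] at this
    rwa [div_le_iff₀ (hMpos n)] at this
  obtain ⟨T', hT'⟩ : ∃ T, ∀ n, 1 / M n ≤ T := by
    have : Tendsto (fun n => 1 / M n) atTop (𝓝 0) := by
      refine (hlim₀.inv_tendsto_atTop).congr' ?_
      filter_upwards [hMev] with n hn
      rw [hn]; simp
    obtain ⟨T, hT⟩ := this.bddAbove_range
    exact ⟨T, fun n => hT ⟨n, rfl⟩⟩
  have S0 := hdom (q := m₀) ⟨1, fun n => by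
    rcases n with _ | n
    · simp [hm₀, hM]
    · simp [hM, abs_of_pos (hpos n)]⟩
  have S1 := hdom (q := m₁) ⟨T, fun n => by linarith [hτM n, abs_nonneg (m₂ n)]⟩
  have S2 := hdom (q := m₂) ⟨T, fun n => by linarith [hτM n, abs_nonneg (m₁ n)]⟩
  have S3 := hdom (q := fun _ => 1) ⟨T', fun n => by
    have := hT' n
    rw [div_le_iff₀ (hMpos n)] at this
    simpa using this⟩
  refine ⟨b, recSeq_zero _ _, fun s h0 h1 => ⟨by simpa using S3 s h0 h1, S0 s h0 h1, S1 s h0 h1,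
    S2 s h0 h1⟩, fun s h0 h1 => ?_⟩
  have hn : ∀ {q : ℕ → ℝ}, Summable (fun n => |q n| * s ^ n) →
      Summable fun n => ‖q n * s ^ n‖ := by
    intro q hq
    refine hq.congr fun n => ?_
    rw [Real.norm_eq_abs, abs_mul, abs_of_nonneg (pow_nonneg h0 n)]
  have c1 := tsum_shift_cauchy (hn (habs h0 (he s h0 h1))) (hn (S1 s h0 h1))
  have c2 := tsum_shift_cauchy (hn (habs h0 (hf's s h0 h1))) (hn (S2 s h0 h1))
  have c0 : HasSum (fun n => b n * m₀ n * s ^ n)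
      (-(s * (2 * ((∑' n, e n * s ^ n) * ∑' n, b n * m₁ n * s ^ n) +
        (∑' n, f' n * s ^ n) * ∑' n, b n * m₂ n * s ^ n))) := by
    rw [← hasSum_nat_add_iff' 1]
    have := (((c1.mul_left 2).add c2).mul_left s).neg
    simp only [Finset.range_one, Finset.sum_singleton, hm₀, mul_zero, zero_mul, sub_zero]
    refine this.congr_fun fun n => ?_
    rw [hb, recSeq_succ, ← hb, div_mul_cancel₀ _ (hpos n).ne']
    have e1 : ∑ k ∈ Finset.range (n + 1), K n k * b k =
        2 * ∑ k ∈ Finset.range (n + 1), e (n - k) * (b k * m₁ k) +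
          ∑ k ∈ Finset.range (n + 1), f' (n - k) * (b k * m₂ k) := by
      rw [Finset.mul_sum, ← Finset.sum_add_distrib]
      exact Finset.sum_congr rfl fun k _ => by simp only [hK]; ring
    rw [e1, pow_succ]
    ring
  rw [c0.tsum_eq, (he s h0 h1).tsum_eq, (hf's s h0 h1).tsum_eq]
  have hpos3 : 0 < 1 - s ^ 3 := by
    have := pow_lt_one₀ h0 h1 (show 3 ≠ 0 by norm_num); linarith
  have h13 : (1 - s ^ 3) ^ (2 / 3 : ℝ) = (1 - s ^ 3) ^ (1 / 3 : ℝ) * (1 - s ^ 3) ^ (1 / 3 : ℝ) := by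
    rw [← Real.rpow_add hpos3]; norm_num
  have hy : 0 < (1 - s ^ 3) ^ (1 / 3 : ℝ) := Real.rpow_pos_of_pos hpos3 _
  rw [h13]
  set y := (1 - s ^ 3) ^ (1 / 3 : ℝ)
  field_simp
  ring

/-! ### The operator on series of truncated powers -/

lemma integrable_and_integral_of_hasSum {α : Type*} [MeasurableSpace α] {μ : Measure α}
    {F : ℕ → α → ℝ} {f : α → ℝ} (hF : ∀ n, Integrable (F n) μ)
    (hs : Summable fun n => ∫ a, ‖F n a‖ ∂μ) (hf : ∀ᵐ a ∂μ, HasSum (fun n => F n a) (f a)) :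
    Integrable f μ ∧ ∫ a, f a ∂μ = ∑' n, ∫ a, F n a ∂μ := by
  have hmeas : AEStronglyMeasurable f μ :=
    aestronglyMeasurable_of_tendsto_ae atTop
      (f := fun N a => ∑ n ∈ Finset.range N, F n a)
      (fun N => Finset.aestronglyMeasurable_fun_sum _ fun n _ => (hF n).1)
      (hf.mono fun a ha => ha.tendsto_sum_nat)
  have hlt : ∫⁻ a, ∑' n, ‖F n a‖ₑ ∂μ < ⊤ := by
    rw [lintegral_tsum fun n => (hF n).1.enorm]
    have e : ∀ n, ∫⁻ a, ‖F n a‖ₑ ∂μ = ENNReal.ofReal (∫ a, ‖F n a‖ ∂μ) := fun n => by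
      rw [ofReal_integral_norm_eq_lintegral_enorm (hF n)]
    simp only [e]
    rw [← ENNReal.ofReal_tsum_of_nonneg (fun n => integral_nonneg fun _ => norm_nonneg _) hs]
    exact ENNReal.ofReal_lt_top
  refine ⟨⟨hmeas, ?_⟩, ?_⟩
  · refine lt_of_le_of_lt (lintegral_mono_ae ?_) hlt
    filter_upwards [hf] with a ha
    rw [← ha.tsum_eq]
    exact enorm_tsum_le_tsum_enorm
  · rw [(hasSum_integral_of_summable_integral_norm hF hs).tsum_eq]
    exact integral_congr_ae (hf.mono fun a ha => ha.tsum_eq.symm)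

/-- The Marchaud derivative may be applied to a series of truncated powers term by term. -/
lemma marchaud_tsum {b γ : ℕ → ℝ} {α x : ℝ} (hα₀ : 0 < α) (hα₁ : α < 1) (hx : 0 < x)
    (hγ₀ : -1 < γ 0) (hγ : ∀ n, 0 < γ (n + 1))
    (hb : ∀ y, 0 < y → y ≤ x → Summable fun n => b n * y ^ γ n)
    (hm : Summable fun n => |b n| * (x ^ (γ n - α) * mom α (γ n))) :
    IntegrableOn (fun v => v ^ (-1 - α) *
      ((∑' n, b n * powPos (γ n) x) - ∑' n, b n * powPos (γ n) (x - v))) (Ioi 0) ∧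
    ∫ v in Ioi (0 : ℝ), v ^ (-1 - α) *
      ((∑' n, b n * powPos (γ n) x) - ∑' n, b n * powPos (γ n) (x - v)) =
      ∑' n, b n * (x ^ (γ n - α) * mom α (γ n)) := by
  have hγ' : ∀ n, -1 < γ n := by
    intro n; rcases n with _ | n
    · exact hγ₀
    · linarith [hγ n]
  have hsum : ∀ y, y ≤ x → Summable fun n => b n * powPos (γ n) y := by
    intro y hy
    rcases lt_or_ge 0 y with h | h
    · simpa only [powPos_of_pos h] using hb y h hy
    · simpa only [powPos_of_nonpos h, mul_zero] using summable_zero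
  have key := integrable_and_integral_of_hasSum (μ := volume.restrict (Ioi (0 : ℝ)))
    (F := fun n v => b n * (v ^ (-1 - α) * (powPos (γ n) x - powPos (γ n) (x - v))))
    (f := fun v => v ^ (-1 - α) *
      ((∑' n, b n * powPos (γ n) x) - ∑' n, b n * powPos (γ n) (x - v)))
    (fun n => (integrableOn_marchaud hα₀ hα₁ (hγ' n) hx).const_mul _) ?_ ?_
  · refine ⟨key.1, key.2.trans (tsum_congr fun n => ?_)⟩
    rw [integral_const_mul, integral_marchaud hx]
  · rw [← summable_nat_add_iff 1] at hm ⊢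
    refine hm.congr fun n => ?_
    simp only [norm_mul (b _)]
    rw [integral_const_mul, integral_abs_marchaud (hγ n) hx, Real.norm_eq_abs]
  · refine (ae_restrict_mem measurableSet_Ioi).mono fun v (hv : 0 < v) => ?_
    have h1 := (hsum x le_rfl).hasSum
    have h2 := (hsum (x - v) (by linarith)).hasSum
    refine ((h1.sub h2).mul_left (v ^ (-1 - α))).congr_fun fun n => ?_
    ring

lemma kInfIntegrand_eq {σ V v : ℝ} (hV : 0 < V) (hv : 0 < v) (φ : ℝ → ℝ) :
    kInfIntegrand σ φ V v =
      -(V ^ (2 / 3 : ℝ) * (v ^ (-1 - (σ - 1)) * (φ V - φ (V + v))) +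
        2 * V ^ (1 / 3 : ℝ) * (v ^ (-1 - (σ - 1 - 1 / 3)) * (φ V - φ (V + v))) +
        v ^ (-1 - (σ - 1 - 2 / 3)) * (φ V - φ (V + v))) := by
  have e0 : v ^ (-1 - (σ - 1)) = v ^ (-σ) := by congr 1; ring
  have e1 : v ^ (-1 - (σ - 1 - 1 / 3)) = v ^ (-σ) * v ^ (1 / 3 : ℝ) := by
    rw [← Real.rpow_add hv]; congr 1; ring
  have e2 : v ^ (-1 - (σ - 1 - 2 / 3)) = v ^ (-σ) * (v ^ (1 / 3 : ℝ) * v ^ (1 / 3 : ℝ)) := by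
    rw [← Real.rpow_add hv, ← Real.rpow_add hv]; congr 1; ring
  have e3 : V ^ (2 / 3 : ℝ) = V ^ (1 / 3 : ℝ) * V ^ (1 / 3 : ℝ) := by
    rw [← Real.rpow_add hV]; norm_num
  rw [e0, e1, e2, e3, kInfIntegrand]
  ring

/-- The three homogeneous parts of `-𝒦_∞`. -/
lemma kInf_of_parts {σ V : ℝ} (hV : 0 < V) {φ : ℝ → ℝ} {I₀ I₁ I₂ : ℝ}
    (h₀ : IntegrableOn (fun v => v ^ (-1 - (σ - 1)) * (φ V - φ (V + v))) (Ioi 0) ∧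
      ∫ v in Ioi (0 : ℝ), v ^ (-1 - (σ - 1)) * (φ V - φ (V + v)) = I₀)
    (h₁ : IntegrableOn (fun v => v ^ (-1 - (σ - 1 - 1 / 3)) * (φ V - φ (V + v))) (Ioi 0) ∧
      ∫ v in Ioi (0 : ℝ), v ^ (-1 - (σ - 1 - 1 / 3)) * (φ V - φ (V + v)) = I₁)
    (h₂ : IntegrableOn (fun v => v ^ (-1 - (σ - 1 - 2 / 3)) * (φ V - φ (V + v))) (Ioi 0) ∧
      ∫ v in Ioi (0 : ℝ), v ^ (-1 - (σ - 1 - 2 / 3)) * (φ V - φ (V + v)) = I₂) :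
    IntegrableOn (kInfIntegrand σ φ V) (Ioi 0) ∧
      -kInf σ φ V = V ^ (2 / 3 : ℝ) * I₀ + 2 * V ^ (1 / 3 : ℝ) * I₁ + I₂ := by
  have i0 := h₀.1.const_mul (V ^ (2 / 3 : ℝ))
  have i1 := h₁.1.const_mul (2 * V ^ (1 / 3 : ℝ))
  constructor
  · exact IntegrableOn.congr_fun ((i0.add i1).add h₂.1).neg
      (fun v hv => (kInfIntegrand_eq hV hv φ).symm) measurableSet_Ioi
  · have h := integral_add (i0.add i1) h₂.1
    simp only [Pi.add_apply] at h
    rw [kInf, setIntegral_congr_fun measurableSet_Ioi (fun v hv => kInfIntegrand_eq hV hv φ),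
      integral_neg, neg_neg, h, integral_add i0 i1,
      integral_const_mul, integral_const_mul, h₀.2, h₁.2, h₂.2]

/-- The exponents `n/3 + σ - 2` of the expansion of the fundamental solution at its pole. -/
def gam (σ : ℝ) (n : ℕ) : ℝ := n / 3 + σ - 2

/-- There is a series in the powers `(1 - V)^{n/3 + σ - 2}`, with leading coefficient `1`, which
converges on `(0, 1)` and is annihilated by `𝒦_∞` there. -/
lemma exists_series_solution {σ : ℝ} (hσ₁ : 5 / 3 < σ) (hσ₂ : σ < 2) :
    ∃ b : ℕ → ℝ, b 0 = 1 ∧ (∀ s : ℝ, 0 ≤ s → s < 1 → Summable fun n => |b n| * s ^ n) ∧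
      SolvesOn σ 1 (fun V => ∑' n, b n * powPos (gam σ n) (1 - V)) (fun _ => 0) := by
  have hgam1 : ∀ n, 0 < gam σ (n + 1) := fun n => by
    unfold gam; push_cast; have : (0 : ℝ) ≤ n := n.cast_nonneg; linarith
  have hgam0 : gam σ 0 = (σ - 1) - 1 := by unfold gam; push_cast; ring
  have hgt : Tendsto (gam σ) atTop atTop := by
    have h1 : Tendsto (fun n : ℕ => (n : ℝ) / 3) atTop atTop :=
      tendsto_natCast_atTop_atTop.atTop_div_const (by norm_num)
    exact (tendsto_atTop_add_const_right _ (σ - 2) h1).congr fun n => by unfold gam; ring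
  obtain ⟨b, hb0, hbs, hbe⟩ := exists_frobenius
    (m₀ := fun n => mom (σ - 1) (gam σ n)) (m₁ := fun n => mom (σ - 1 - 1 / 3) (gam σ n))
    (m₂ := fun n => mom (σ - 1 - 2 / 3) (gam σ n))
    (by simp only [hgam0]; exact mom_self (by linarith) (by linarith))
    (fun n => mom_pos (by linarith) (by linarith) (hgam1 n))
    (tendsto_mom (by linarith) (by linarith) hgt)
    (tendsto_mom_div (by linarith) (by norm_num) (by linarith) hgt)
    (tendsto_mom_div (by linarith) (by norm_num) (by linarith) hgt)
  refine ⟨b, hb0, fun s h0 h1 => (hbs s h0 h1).1, fun V hV => ?_⟩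
  set x := 1 - V with hx
  have hx0 : 0 < x := by linarith [hV.2]
  have hx1 : x < 1 := by linarith [hV.1]
  have hroot : ∀ y : ℝ, 0 < y → y < 1 → 0 ≤ y ^ (1 / 3 : ℝ) ∧ y ^ (1 / 3 : ℝ) < 1 := fun y h0 h1 =>
    ⟨Real.rpow_nonneg h0.le _, Real.rpow_lt_one h0.le h1 (by norm_num)⟩
  have hpow : ∀ (y : ℝ) (c : ℝ) (n : ℕ), 0 < y →
      y ^ (gam σ n - c) = y ^ (σ - 2 - c) * (y ^ (1 / 3 : ℝ)) ^ n := fun y c n h0 => by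
    rw [← Real.rpow_natCast, ← Real.rpow_mul h0.le, ← Real.rpow_add h0]
    congr 1; unfold gam; ring
  have hb : ∀ y, 0 < y → y ≤ x → Summable fun n => b n * y ^ gam σ n := by
    intro y h0 h1
    obtain ⟨r0, r1⟩ := hroot y h0 (by linarith)
    have : Summable fun n => b n * (y ^ (1 / 3 : ℝ)) ^ n := by
      refine ((hbs _ r0 r1).1).of_norm_bounded fun n => ?_
      rw [Real.norm_eq_abs, abs_mul, abs_of_nonneg (pow_nonneg r0 n)]
    refine (this.mul_left (y ^ (σ - 2))).congr fun n => ?_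
    have := hpow y 0 n h0
    rw [sub_zero, sub_zero] at this
    rw [this]; ring
  obtain ⟨r0, r1⟩ := hroot x hx0 hx1
  set s := x ^ (1 / 3 : ℝ) with hs
  have hpart : ∀ c : ℝ, 0 ≤ c → c ≤ 2 / 3 →
      Summable (fun n => |b n * mom (σ - 1 - c) (gam σ n)| * s ^ n) →
      IntegrableOn (fun v => v ^ (-1 - (σ - 1 - c)) * ((∑' n, b n * powPos (gam σ n) (1 - V)) -
        ∑' n, b n * powPos (gam σ n) (1 - (V + v)))) (Ioi 0) ∧
      ∫ v in Ioi (0 : ℝ), v ^ (-1 - (σ - 1 - c)) * ((∑' n, b n * powPos (gam σ n) (1 - V)) -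
        ∑' n, b n * powPos (gam σ n) (1 - (V + v))) =
        x ^ (c - 1) * ∑' n, b n * mom (σ - 1 - c) (gam σ n) * s ^ n := by
    intro c hc0 hc1 hsum
    have h := marchaud_tsum (b := b) (γ := gam σ) (α := σ - 1 - c) (x := x) (by linarith)
      (by linarith) hx0 (by rw [hgam0]; linarith) hgam1 hb ?_
    · have e : ∀ v, 1 - (V + v) = x - v := fun v => by rw [hx]; ring
      simp only [e, ← hx]
      refine ⟨h.1, h.2.trans ?_⟩
      rw [← tsum_mul_left]
      refine tsum_congr fun n => ?_
      rw [hpow x _ n hx0, ← hs]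
      have : σ - 2 - (σ - 1 - c) = c - 1 := by ring
      rw [this]; ring
    · have h2 := hsum.mul_left (x ^ (c - 1))
      rw [← summable_nat_add_iff 1] at h2 ⊢
      refine h2.congr fun n => ?_
      rw [hpow x _ (n + 1) hx0, ← hs, abs_mul, abs_of_nonneg (mom_nonneg (hgam1 n))]
      have : σ - 2 - (σ - 1 - c) = c - 1 := by ring
      rw [this]; ring
  obtain ⟨-, s0, s1, s2⟩ := hbs s r0 r1
  have p0 := hpart 0 le_rfl (by norm_num) (by simpa using s0)
  have p1 := hpart (1 / 3) (by norm_num) (by norm_num) s1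
  have p2 := hpart (2 / 3) (by norm_num) (by norm_num) s2
  simp only [sub_zero] at p0
  have key := kInf_of_parts (σ := σ) hV.1
    (φ := fun V => ∑' n, b n * powPos (gam σ n) (1 - V)) p0 p1 p2
  refine ⟨key.1, key.2.trans ?_⟩
  have heq := hbe s r0 r1
  have hs3 : s ^ 3 = x := by
    rw [hs, ← Real.rpow_natCast, ← Real.rpow_mul hx0.le]; norm_num
  have hV' : V = 1 - s ^ 3 := by rw [hs3, hx]; ring
  have e1 : x ^ (1 / 3 - 1 : ℝ) = x ^ (0 - 1 : ℝ) * s := by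
    rw [hs, ← Real.rpow_add hx0]; congr 1; ring
  have e2 : x ^ (2 / 3 - 1 : ℝ) = x ^ (0 - 1 : ℝ) * s ^ 2 := by
    rw [hs, ← Real.rpow_natCast, ← Real.rpow_mul hx0.le, ← Real.rpow_add hx0]; congr 1; norm_num
  rw [← hV'] at heq
  rw [e1, e2]
  linear_combination x ^ (0 - 1 : ℝ) * heq

/-! ### The maximum principle -/

lemma kInfIntegrand_sub (σ : ℝ) (φ ψ : ℝ → ℝ) (V : ℝ) :
    kInfIntegrand σ (fun x => φ x - ψ x) V =
      fun v => kInfIntegrand σ φ V v - kInfIntegrand σ ψ V v := by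
  funext v; simp only [kInfIntegrand]; ring

lemma SolvesOn.sub {σ b : ℝ} {φ ψ g h : ℝ → ℝ} (hφ : SolvesOn σ b φ g) (hψ : SolvesOn σ b ψ h) :
    SolvesOn σ b (fun x => φ x - ψ x) (fun x => g x - h x) := by
  intro V hV
  obtain ⟨i1, e1⟩ := hφ V hV
  obtain ⟨i2, e2⟩ := hψ V hV
  rw [kInf, kInfIntegrand_sub, integral_sub i1 i2]
  refine ⟨i1.sub i2, ?_⟩
  simp only [kInf] at e1 e2
  linarith

lemma SolvesOn.const_mul {σ b : ℝ} {φ g : ℝ → ℝ} (c : ℝ) (hφ : SolvesOn σ b φ g) :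
    SolvesOn σ b (fun x => c * φ x) (fun x => c * g x) := by
  intro V hV
  obtain ⟨i1, e1⟩ := hφ V hV
  have e : kInfIntegrand σ (fun x => c * φ x) V = fun v => c * kInfIntegrand σ φ V v := by
    funext v; simp only [kInfIntegrand]; ring
  rw [kInf, e, integral_const_mul]
  refine ⟨i1.const_mul c, ?_⟩
  rw [kInf] at e1
  linear_combination c * e1

/-- All jumps go to the right. At a point from which no smaller value can be reached, the equation
forces the reachable values to be equal to the value there. -/
lemma ae_eq_of_isMin {σ b V : ℝ} {w : ℝ → ℝ} (hV : 0 < V)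
    (hmin : ∀ x > V, x ≠ b → w V ≤ w x)
    (hint : IntegrableOn (kInfIntegrand σ w V) (Ioi 0)) (hK : 0 ≤ -kInf σ w V) :
    ∀ᵐ v ∂volume.restrict (Ioi (0 : ℝ)), w (V + v) = w V := by
  have hker : ∀ v : ℝ, 0 < v → 0 < v ^ (-σ) * (V ^ (1 / 3 : ℝ) + v ^ (1 / 3 : ℝ)) ^ 2 := by
    intro v hv; positivity
  have hnn : 0 ≤ᵐ[volume.restrict (Ioi (0 : ℝ))] kInfIntegrand σ w V := by
    have hne : ∀ᵐ v ∂volume.restrict (Ioi (0 : ℝ)), v ≠ b - V :=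
      ae_restrict_of_ae (Measure.ae_ne volume (b - V))
    filter_upwards [hne, ae_restrict_mem measurableSet_Ioi] with v hv (hv0 : 0 < v)
    have := hmin (V + v) (by linarith) fun h => hv (by linarith)
    exact mul_nonneg (hker v hv0).le (by linarith)
  have h0 : ∫ v in Ioi (0 : ℝ), kInfIntegrand σ w V v = 0 :=
    le_antisymm (by have := hK; rw [kInf] at this; linarith) (integral_nonneg_of_ae hnn)
  have h1 := (integral_eq_zero_iff_of_nonneg_ae hnn hint).1 h0
  filter_upwards [h1, ae_restrict_mem measurableSet_Ioi] with v hv (hv0 : 0 < v)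
  have := (mul_eq_zero.1 hv).resolve_left (hker v hv0).ne'
  linarith

lemma exists_gt_of_ae_restrict_Ioi {P : ℝ → Prop} (h : ∀ᵐ v ∂volume.restrict (Ioi (0 : ℝ)), P v)
    {c d : ℝ} (hc : 0 ≤ c) (hcd : c < d) : ∃ v, c < v ∧ v < d ∧ P v := by
  have h' : ∀ᵐ v ∂volume.restrict (Ioo c d), P v :=
    ae_restrict_of_ae_restrict_of_subset
      (Ioo_subset_Ioi_self.trans (Ioi_subset_Ioi hc)) h
  have : (ae (volume.restrict (Ioo c d))).NeBot := by
    rw [ae_neBot, Ne, Measure.restrict_eq_zero, Real.volume_Ioo]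
    simpa using hcd
  obtain ⟨v, hv, hv'⟩ := (h'.and (ae_restrict_mem measurableSet_Ioo)).exists
  exact ⟨v, hv'.1, hv'.2, hv⟩

/-- The maximum principle. No condition is needed at `V = 0`, as all jumps go to the right. -/
theorem nonneg_of_neg_kInf_nonneg {σ b : ℝ} {w g : ℝ → ℝ} (hcont : ContinuousOn w (Ioo 0 b))
    (hlim : ∀ ε > 0, ∀ᶠ V in 𝓝[<] b, -ε < w V) (hout : ∀ V > b, 0 ≤ w V)
    (hw : SolvesOn σ b w g) (hg : ∀ V ∈ Ioo 0 b, 0 ≤ g V) :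
    ∀ V ∈ Ioo 0 b, 0 ≤ w V := by
  intro V₁ hV₁
  by_contra! hneg
  -- By `hlim` and `hout`, the minimum of `w` on `[V₁, c']` is a minimum over all larger arguments.
  -- The equation there forces `w` to be constant to the right, contradicting `hout`.
  obtain ⟨c, hcb, hc⟩ := (mem_nhdsLT_iff_exists_Ioo_subset' hV₁.2).1 (hlim (-w V₁) (by linarith))
  obtain ⟨c', hc1, hc2⟩ := exists_between (max_lt hcb hV₁.2)
  have hVc : V₁ < c' := (le_max_right _ _).trans_lt hc1
  obtain ⟨V, hV, hmin⟩ := isCompact_Icc.exists_isMinOn (nonempty_Icc.2 hVc.le)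
    (hcont.mono fun x hx => ⟨hV₁.1.trans_le hx.1, hx.2.trans_lt hc2⟩)
  have hVV₁ : w V ≤ w V₁ := hmin ⟨le_rfl, hVc.le⟩
  have hV0 : 0 < V := hV₁.1.trans_le hV.1
  have hVb : V < b := hV.2.trans_lt hc2
  have hall : ∀ x > V, x ≠ b → w V ≤ w x := by
    intro x hx hxb
    rcases le_or_gt x c' with h | h
    · exact hmin ⟨hV.1.trans hx.le, h⟩
    rcases lt_or_gt_of_ne hxb with h' | h'
    · have : - -w V₁ < w x := hc ⟨(le_max_left _ _).trans_lt (hc1.trans h), h'⟩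
      linarith
    · linarith [hout x h']
  obtain ⟨i, e⟩ := hw V ⟨hV0, hVb⟩
  have hae := ae_eq_of_isMin hV0 hall i (by rw [e]; exact hg V ⟨hV0, hVb⟩)
  obtain ⟨v, hv, -, hwv⟩ := exists_gt_of_ae_restrict_Ioi hae (c := b - V) (d := b - V + 1)
    (by linarith) (by linarith)
  have := hout (V + v) (by linarith)
  linarith

theorem eq_zero_of_kInf_eq_zero {σ b : ℝ} {w : ℝ → ℝ} (hcont : ContinuousOn w (Ioo 0 b))
    (hlim : Tendsto w (𝓝[<] b) (𝓝 0)) (hout : ∀ V > b, w V = 0)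
    (hw : SolvesOn σ b w fun _ => 0) : ∀ V ∈ Ioo 0 b, w V = 0 := by
  intro V hV
  have h1 := nonneg_of_neg_kInf_nonneg hcont
    (fun ε hε => hlim.eventually (lt_mem_nhds (by linarith))) (fun V hV => (hout V hV).ge) hw
    (fun _ _ => le_rfl) V hV
  have hw' : SolvesOn σ b (fun x => -1 * w x) (fun _ => -1 * 0) := hw.const_mul (-1)
  have hl : Tendsto (fun x => -1 * w x) (𝓝[<] b) (𝓝 0) := by simpa using hlim.const_mul (-1)
  have h2 : 0 ≤ -1 * w V := nonneg_of_neg_kInf_nonneg (continuousOn_const.mul hcont)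
    (fun ε hε => hl.eventually (lt_mem_nhds (by linarith)))
    (fun V hV => by simp [hout V hV]) hw'
    (fun _ _ => by simp) V hV
  linarith

/-! ### The constant `C_*` -/

lemma auxQ_eq {σ w : ℝ} (hσ₁ : 1 < σ) (hw : 0 < w) :
    auxQ σ w = w ^ (σ - 2) / ((σ - 1) * (w + 1)) := by
  -- The integral has the antiderivative `-((w - z)/(z + 1))^{σ-1} / ((w + 1)(σ - 1))`.
  have hcont : ContinuousOn
      (fun z : ℝ => -((w - z) / (z + 1)) ^ (σ - 1) / ((w + 1) * (σ - 1))) (Icc 0 w) := by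
    have h1 : ContinuousOn (fun z : ℝ => (w - z) / (z + 1)) (Icc 0 w) := by
      refine ContinuousOn.div (by fun_prop) (by fun_prop) fun z hz => ?_
      linarith [hz.1]
    exact (h1.rpow_const fun z _ => Or.inr (by linarith)).neg.div_const _
  have hderiv : ∀ z ∈ Ioo 0 w, HasDerivAt
      (fun z : ℝ => -((w - z) / (z + 1)) ^ (σ - 1) / ((w + 1) * (σ - 1)))
      ((z + 1) ^ (-σ) * (w - z) ^ (σ - 2)) z := by
    intro z hz
    have hz1 : 0 < z + 1 := by linarith [hz.1]
    have hwz : 0 < w - z := by linarith [hz.2]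
    have hd : HasDerivAt (fun z : ℝ => (w - z) / (z + 1))
        ((-1 * (z + 1) - (w - z) * 1) / (z + 1) ^ 2) z :=
      ((hasDerivAt_id z).const_sub w).div ((hasDerivAt_id z).add_const 1) hz1.ne'
    have h := ((hd.rpow_const (p := σ - 1) (Or.inl (div_pos hwz hz1).ne')).neg).div_const
      ((w + 1) * (σ - 1))
    refine h.congr_deriv ?_
    have e1 : σ - 1 - 1 = σ - 2 := by ring
    rw [e1, Real.div_rpow hwz.le hz1.le]
    have e2 : (z + 1) ^ (-σ) = ((z + 1) ^ (σ - 2))⁻¹ * ((z + 1) ^ 2)⁻¹ := by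
      rw [← Real.rpow_natCast (z + 1) 2, ← Real.rpow_neg hz1.le, ← Real.rpow_neg hz1.le,
        ← Real.rpow_add hz1]
      congr 1; push_cast; ring
    rw [e2]
    have hp := (Real.rpow_pos_of_pos hz1 (σ - 2)).ne'
    have hs : σ - 1 ≠ 0 := by linarith
    have hw1 : w + 1 ≠ 0 := by linarith
    field_simp
    ring
  have hint := intervalIntegral.intervalIntegrable_deriv_of_nonneg (a := 0) (b := w)
    (by rwa [uIcc_of_le hw.le])
    (by rwa [min_eq_left hw.le, max_eq_right hw.le]) (by
      rw [min_eq_left hw.le, max_eq_right hw.le]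
      intro z hz
      exact mul_nonneg (Real.rpow_nonneg (by linarith [hz.1]) _)
        (Real.rpow_nonneg (by linarith [hz.2]) _))
  have key := intervalIntegral.integral_eq_sub_of_hasDerivAt_of_le hw.le hcont hderiv hint
  rw [auxQ, ← integral_Ioc_eq_integral_Ioo, ← intervalIntegral.integral_of_le hw.le, key]
  have hs : σ - 1 ≠ 0 := by linarith
  have e : w ^ (σ - 1) = w ^ (σ - 2) * w := by
    nth_rewrite 3 [← Real.rpow_one w]
    rw [← Real.rpow_add hw]; congr 1; ring
  simp only [sub_self, zero_div, Real.zero_rpow hs, sub_zero, zero_add, div_one, e]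
  field_simp
  ring

lemma integrableOn_beta {σ : ℝ} (hσ₁ : 1 < σ) (hσ₂ : σ < 2) :
    IntegrableOn (fun s : ℝ => s ^ (σ - 2) * (1 - s) ^ (1 - σ)) (Ioo 0 1) := by
  have h1 : IntegrableOn (fun s : ℝ => s ^ (σ - 2)) (Ioo 0 1) :=
    (intervalIntegral.integrableOn_Ioo_rpow_iff one_pos).2 (by linarith)
  have h2 : IntegrableOn (fun s : ℝ => (1 - s) ^ (1 - σ)) (Ioo 0 1) := by
    have := ((intervalIntegral.intervalIntegrable_rpow' (a := 1) (b := 0)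
      (r := 1 - σ) (by linarith)).comp_sub_left 1)
    norm_num at this
    exact this.1.mono_set Ioo_subset_Ioc_self
  refine ((h1.add h2).const_mul 2).mono' (by fun_prop) ?_
  refine (ae_restrict_mem measurableSet_Ioo).mono fun s hs => ?_
  have a1 : 0 ≤ s ^ (σ - 2) := Real.rpow_nonneg hs.1.le _
  have a2 : 0 ≤ (1 - s) ^ (1 - σ) := Real.rpow_nonneg (by linarith [hs.2]) _
  rw [Real.norm_of_nonneg (mul_nonneg a1 a2)]
  simp only [Pi.add_apply]
  have hb : ∀ y p : ℝ, 1 / 2 ≤ y → p ≤ 0 → -1 ≤ p → y ^ p ≤ 2 := fun y p hy hp hp' => by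
    calc y ^ p ≤ (1 / 2 : ℝ) ^ p := Real.rpow_le_rpow_of_nonpos (by norm_num) hy hp
      _ ≤ (1 / 2 : ℝ) ^ (-1 : ℝ) :=
        Real.rpow_le_rpow_of_exponent_ge (by norm_num) (by norm_num) hp'
      _ = 2 := by rw [Real.rpow_neg_one]; norm_num
  rcases le_total s (1 / 2) with h | h
  · have := hb (1 - s) (1 - σ) (by linarith) (by linarith) (by linarith)
    nlinarith
  · have := hb s (σ - 2) h (by linarith) (by linarith)
    nlinarith

lemma integral_beta_pos {σ : ℝ} (hσ₁ : 1 < σ) (hσ₂ : σ < 2) :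
    0 < ∫ s in Ioo (0 : ℝ) 1, s ^ (σ - 2) * (1 - s) ^ (1 - σ) := by
  rw [← integral_Ioc_eq_integral_Ioo, ← intervalIntegral.integral_of_le zero_le_one]
  refine intervalIntegral.intervalIntegral_pos_of_pos_on ?_ (fun s hs => ?_) one_pos
  · rw [intervalIntegrable_iff_integrableOn_Ioo_of_le zero_le_one]
    exact integrableOn_beta hσ₁ hσ₂
  · exact mul_pos (Real.rpow_pos_of_pos hs.1 _) (Real.rpow_pos_of_pos (by linarith [hs.2]) _)

lemma image_div_one_sub : (fun s : ℝ => s / (1 - s)) '' Ioo 0 1 = Ioi 0 := by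
  ext w
  constructor
  · rintro ⟨s, hs, rfl⟩
    exact div_pos hs.1 (by linarith [hs.2])
  · intro (hw : 0 < w)
    refine ⟨w / (1 + w), ⟨by positivity, by rw [div_lt_one (by linarith)]; linarith⟩, ?_⟩
    have : 1 + w ≠ 0 := by linarith
    simp only
    field_simp
    ring

/-- `C_* = (σ - 1) / B(σ - 1, 2 - σ)`, by the substitution `w = s / (1 - s)`. -/
lemma cStar_eq {σ : ℝ} (hσ₁ : 1 < σ) :
    cStar σ = (σ - 1) / ∫ s in Ioo (0 : ℝ) 1, s ^ (σ - 2) * (1 - s) ^ (1 - σ) := by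
  have hd : ∀ s ∈ Ioo (0 : ℝ) 1,
      HasDerivWithinAt (fun s : ℝ => s / (1 - s)) (1 / (1 - s) ^ 2) (Ioo 0 1) s := by
    intro s hs
    have h1 : 1 - s ≠ 0 := by linarith [hs.2]
    have := (hasDerivAt_id s).div ((hasDerivAt_id s).const_sub 1) h1
    refine (this.congr_deriv ?_).hasDerivWithinAt
    simp
  have hinj : InjOn (fun s : ℝ => s / (1 - s)) (Ioo 0 1) := by
    intro s hs t ht hst
    have h1 : 1 - s ≠ 0 := by linarith [hs.2]
    have h2 : 1 - t ≠ 0 := by linarith [ht.2]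
    simp only at hst
    rw [div_eq_div_iff h1 h2] at hst
    linarith
  have key := integral_image_eq_integral_abs_deriv_smul measurableSet_Ioo hd hinj (auxQ σ)
  rw [image_div_one_sub] at key
  rw [cStar, key, setIntegral_congr_fun
    (g := fun s => (1 / (σ - 1)) * (s ^ (σ - 2) * (1 - s) ^ (1 - σ))) measurableSet_Ioo,
    integral_const_mul, mul_inv, one_div, inv_inv, div_eq_mul_inv]
  intro s hs
  have h1 : 0 < 1 - s := by linarith [hs.2]
  simp only
  rw [auxQ_eq hσ₁ (div_pos hs.1 h1), Real.div_rpow hs.1.le h1.le, smul_eq_mul,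
    abs_of_pos (by positivity)]
  have e : (1 - s) ^ (1 - σ) = ((1 - s) ^ (σ - 2))⁻¹ * (1 - s)⁻¹ := by
    rw [← Real.rpow_neg h1.le, ← Real.rpow_neg_one (1 - s), ← Real.rpow_add h1]; congr 1; ring
  have hp := (Real.rpow_pos_of_pos h1 (σ - 2)).ne'
  have hs1 : σ - 1 ≠ 0 := by linarith
  have e2 : s / (1 - s) + 1 = 1 / (1 - s) := by field_simp; ring
  rw [e, e2]
  field_simp

lemma cStar_pos {σ : ℝ} (hσ₁ : 1 < σ) (hσ₂ : σ < 2) : 0 < cStar σ := by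
  rw [cStar_eq hσ₁]; exact div_pos (by linarith) (integral_beta_pos hσ₁ hσ₂)

/-! ### The fundamental solution with pole at `1` -/

/-- The function `(1 - V)_+^{σ-2} F((1 - V)^{1/3})`. -/
def profile (σ : ℝ) (F : ℝ → ℝ) (V : ℝ) : ℝ :=
  powPos (σ - 2) (1 - V) * F ((1 - V) ^ (1 / 3 : ℝ))

/-- `F` is a profile function: analytic on `(-1, 1)` with `F(0) = 1`, and such that
`(1 - V)_+^{σ-2} F((1 - V)^{1/3})` is annihilated by `𝒦_∞` on `(0, 1)`. -/
structure IsProfile (σ : ℝ) (F : ℝ → ℝ) : Prop where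
  analytic : AnalyticOnNhd ℝ F (Ioo (-1) 1)
  apply_zero : F 0 = 1
  equation : SolvesOn σ 1 (profile σ F) fun _ => 0

theorem exists_isProfile {σ : ℝ} (hσ₁ : 5 / 3 < σ) (hσ₂ : σ < 2) : ∃ F, IsProfile σ F := by
  obtain ⟨b, hb0, hbs, hsol⟩ := exists_series_solution hσ₁ hσ₂
  refine ⟨fun s => ∑' n, b n * s ^ n, ?_, ?_, ?_⟩
  · set p := FormalMultilinearSeries.ofScalars ℝ b with hp
    have hr : (1 : ENNReal) ≤ p.radius := by
      refine le_of_forall_lt fun r hr => ?_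
      have hne : r ≠ ⊤ := hr.ne_top
      lift r to NNReal using hne
      have hr1 : r < 1 := by exact_mod_cast hr
      obtain ⟨r', h1, h2⟩ := exists_between hr1
      refine lt_of_lt_of_le (by exact_mod_cast h1) (p.le_radius_of_summable (r := r') ?_)
      refine (hbs r' r'.2 (by exact_mod_cast h2)).congr fun n => ?_
      rw [hp, FormalMultilinearSeries.ofScalars_norm, Real.norm_eq_abs]
    have hpos : 0 < p.radius := lt_of_lt_of_le one_pos hr
    have hs : p.sum = fun s => ∑' n, b n * s ^ n := by
      funext s
      simp [hp, FormalMultilinearSeries.sum, mul_comm]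
    rw [← hs]
    refine (p.hasFPowerSeriesOnBall hpos).analyticOnNhd.mono fun s hs => ?_
    rw [Metric.mem_eball, edist_dist, Real.dist_eq, sub_zero]
    refine lt_of_lt_of_le ?_ hr
    rw [← ENNReal.ofReal_one]
    exact (ENNReal.ofReal_lt_ofReal_iff one_pos).2 (abs_lt.2 hs)
  · rw [tsum_eq_single 0 fun n hn => by simp [hn]]
    simp [hb0]
  · convert hsol using 2 with V
    unfold profile
    rcases lt_or_ge 0 (1 - V) with h | h
    · simp only [powPos_of_pos h]
      rw [← tsum_mul_left]
      refine tsum_congr fun n => ?_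
      have : (1 - V) ^ gam σ n = (1 - V) ^ (σ - 2) * ((1 - V) ^ (1 / 3 : ℝ)) ^ n := by
        rw [← Real.rpow_natCast, ← Real.rpow_mul h.le, ← Real.rpow_add h]
        congr 1; unfold gam; ring
      rw [this]; ring
    · simp [powPos_of_nonpos h]

/-- The pure power `(1 - V)_+^{σ-2}` is a supersolution. -/
lemma exists_solvesOn_powPos {σ : ℝ} (hσ₁ : 5 / 3 < σ) (hσ₂ : σ < 2) :
    ∃ g : ℝ → ℝ, SolvesOn σ 1 (fun V => powPos (σ - 2) (1 - V)) g ∧ ∀ V ∈ Ioo 0 1, 0 ≤ g V := by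
  have key : ∀ V ∈ Ioo (0 : ℝ) 1,
      IntegrableOn (kInfIntegrand σ (fun V => powPos (σ - 2) (1 - V)) V) (Ioi 0) ∧
      0 ≤ -kInf σ (fun V => powPos (σ - 2) (1 - V)) V := by
    intro V hV
    have hx : 0 < 1 - V := by linarith [hV.2]
    have hpart : ∀ c : ℝ, 0 ≤ c → c ≤ 2 / 3 →
        IntegrableOn (fun v => v ^ (-1 - (σ - 1 - c)) *
          (powPos (σ - 2) (1 - V) - powPos (σ - 2) (1 - (V + v)))) (Ioi 0) ∧
        ∫ v in Ioi (0 : ℝ), v ^ (-1 - (σ - 1 - c)) *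
          (powPos (σ - 2) (1 - V) - powPos (σ - 2) (1 - (V + v))) =
          (1 - V) ^ (σ - 2 - (σ - 1 - c)) * mom (σ - 1 - c) (σ - 2) := by
      intro c h0 h1
      simp only [← sub_sub 1 V]
      exact ⟨integrableOn_marchaud (by linarith) (by linarith) (by linarith) hx,
        integral_marchaud hx⟩
    have hm : ∀ c : ℝ, 0 ≤ c → c ≤ 2 / 3 →
        0 ≤ (1 - V) ^ (σ - 2 - (σ - 1 - c)) * mom (σ - 1 - c) (σ - 2) := by
      intro c h0 h1
      have := mom_sub_self_nonneg (α := σ - 1) (c := c) (by linarith) (by linarith) h0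
        (by linarith)
      rw [show σ - 1 - 1 = σ - 2 by ring] at this
      exact mul_nonneg (Real.rpow_nonneg hx.le _) this
    have p0 := hpart 0 le_rfl (by norm_num)
    have m0 := hm 0 le_rfl (by norm_num)
    simp only [sub_zero] at p0 m0
    have h := kInf_of_parts (σ := σ) hV.1 (φ := fun V => powPos (σ - 2) (1 - V)) p0
      (hpart (1 / 3) (by norm_num) (by norm_num)) (hpart (2 / 3) (by norm_num) le_rfl)
    refine ⟨h.1, ?_⟩
    rw [h.2]
    have := hm (1 / 3) (by norm_num) (by norm_num)
    have := hm (2 / 3) (by norm_num) le_rfl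
    have := Real.rpow_nonneg hV.1.le (2 / 3)
    have := Real.rpow_nonneg hV.1.le (1 / 3)
    positivity
  exact ⟨fun V => -kInf σ (fun V => powPos (σ - 2) (1 - V)) V,
    fun V hV => ⟨(key V hV).1, rfl⟩, fun V hV => (key V hV).2⟩

lemma tendsto_cbrt_one_sub : Tendsto (fun V : ℝ => (1 - V) ^ (1 / 3 : ℝ)) (𝓝[<] 1) (𝓝 0) := by
  have h : ContinuousAt (fun V : ℝ => (1 - V) ^ (1 / 3 : ℝ)) 1 :=
    ContinuousAt.rpow_const (by fun_prop) (Or.inr (by norm_num))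
  have := h.tendsto
  simp only [sub_self, Real.zero_rpow (by norm_num : (1 / 3 : ℝ) ≠ 0)] at this
  exact this.mono_left nhdsWithin_le_nhds

lemma cbrt_mem {V : ℝ} (hV : V ∈ Ioo (0 : ℝ) 1) : (1 - V) ^ (1 / 3 : ℝ) ∈ Ioo (0 : ℝ) 1 :=
  ⟨Real.rpow_pos_of_pos (by linarith [hV.2]) _,
    Real.rpow_lt_one (by linarith [hV.2]) (by linarith [hV.1]) (by norm_num)⟩

lemma analyticAt_rpow_const {f : ℝ → ℝ} {x : ℝ} (hf : AnalyticAt ℝ f x) (h : 0 < f x) (a : ℝ) :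
    AnalyticAt ℝ (fun y => f y ^ a) x := by
  have h1 : AnalyticAt ℝ (fun y => Real.exp (Real.log (f y) * a)) x :=
    ((hf.log h).mul analyticAt_const).rexp'
  refine h1.congr ?_
  filter_upwards [hf.continuousAt.eventually (lt_mem_nhds h)] with y hy
  rw [Real.rpow_def_of_pos hy]

namespace IsProfile

variable {σ : ℝ} {F : ℝ → ℝ}

lemma analyticAt_profile (hF : IsProfile σ F) {V : ℝ} (hV : V ∈ Ioo (0 : ℝ) 1) :
    AnalyticAt ℝ (profile σ F) V := by
  have hx : 0 < 1 - V := by linarith [hV.2]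
  have h1 : AnalyticAt ℝ (fun V : ℝ => 1 - V) V := analyticAt_const.sub analyticAt_id
  have hs := cbrt_mem hV
  have h2 := analyticAt_rpow_const h1 hx (σ - 2)
  have h3 := analyticAt_rpow_const h1 hx (1 / 3)
  have h4 : AnalyticAt ℝ F ((1 - V) ^ (1 / 3 : ℝ)) := hF.analytic _ ⟨by linarith [hs.1], hs.2⟩
  have h5 : AnalyticAt ℝ (F ∘ fun V : ℝ => (1 - V) ^ (1 / 3 : ℝ)) V :=
    AnalyticAt.comp (f := fun V : ℝ => (1 - V) ^ (1 / 3 : ℝ)) h4 h3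
  refine (h2.mul h5).congr ?_
  filter_upwards [Iio_mem_nhds hV.2] with W (hW : W < 1)
  simp [profile, powPos_of_pos (show 0 < 1 - W by linarith)]

lemma continuousOn_profile (hF : IsProfile σ F) : ContinuousOn (profile σ F) (Ioo 0 1) :=
  fun _ hV => (hF.analyticAt_profile hV).continuousAt.continuousWithinAt

lemma isBigO (hF : IsProfile σ F) : (fun s => F s - 1) =O[𝓝 0] fun s => s := by
  have h := (hF.analytic 0 (by norm_num)).differentiableAt.isBigO_sub
  simpa [hF.apply_zero] using h

lemma tendsto_one (hF : IsProfile σ F) : Tendsto F (𝓝 0) (𝓝 1) := by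
  have := (hF.analytic 0 (by norm_num)).continuousAt.tendsto
  rwa [hF.apply_zero] at this

lemma le_one (hF : IsProfile σ F) (hσ₁ : 5 / 3 < σ) (hσ₂ : σ < 2) {s : ℝ} (hs : s ∈ Ioo (0 : ℝ) 1) :
    F s ≤ 1 := by
  obtain ⟨g, hg, hg0⟩ := exists_solvesOn_powPos hσ₁ hσ₂
  -- The maximum principle applies to the difference with the pure power: it tends to `0` at the
  -- pole, being of order `(1 - V)^{σ - 2 + 1/3}` with `σ > 5/3`.
  have hw := hg.sub hF.equation
  have hlim : Tendsto (fun V => powPos (σ - 2) (1 - V) - profile σ F V) (𝓝[<] 1) (𝓝 0) := by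
    have h1 : (fun V : ℝ => (1 - V) ^ (σ - 2) * (F ((1 - V) ^ (1 / 3 : ℝ)) - 1)) =O[𝓝[<] 1]
        fun V => (1 - V) ^ (σ - 2) * (1 - V) ^ (1 / 3 : ℝ) :=
      (isBigO_refl _ _).mul (hF.isBigO.comp_tendsto tendsto_cbrt_one_sub)
    have h2 : Tendsto (fun V : ℝ => (1 - V) ^ (σ - 2) * (1 - V) ^ (1 / 3 : ℝ)) (𝓝[<] 1) (𝓝 0) := by
      have h : ContinuousAt (fun V : ℝ => (1 - V) ^ (σ - 5 / 3)) 1 :=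
        ContinuousAt.rpow_const (by fun_prop) (Or.inr (by linarith))
      have h := h.tendsto
      simp only [sub_self, Real.zero_rpow (by linarith : σ - 5 / 3 ≠ 0)] at h
      refine (h.mono_left nhdsWithin_le_nhds).congr' ?_
      filter_upwards [self_mem_nhdsWithin] with V (hV : V < 1)
      rw [← Real.rpow_add (by linarith)]; congr 1; ring
    have h3 := (h1.trans_tendsto h2).neg
    rw [neg_zero] at h3
    refine h3.congr' ?_
    filter_upwards [self_mem_nhdsWithin] with V (hV : V < 1)
    rw [profile, powPos_of_pos (by linarith)]; ring
  have hcont : ContinuousOn (fun V => powPos (σ - 2) (1 - V) - profile σ F V) (Ioo 0 1) := by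
    refine ContinuousOn.sub ?_ hF.continuousOn_profile
    have : ContinuousOn (fun V : ℝ => (1 - V) ^ (σ - 2)) (Ioo 0 1) :=
      ContinuousOn.rpow_const (by fun_prop) fun V hV => Or.inl (by linarith [hV.2])
    exact this.congr fun V hV => powPos_of_pos (by linarith [hV.2])
  have hpos := nonneg_of_neg_kInf_nonneg hcont
    (fun ε hε => hlim.eventually (lt_mem_nhds (by linarith)))
    (fun V hV => by simp [profile, powPos_of_nonpos (show 1 - V ≤ 0 by linarith)]) hw
    (fun V hV => by simpa using hg0 V hV)
  have hs3 : s ^ 3 < 1 := pow_lt_one₀ hs.1.le hs.2 (by norm_num)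
  have hs3' : 0 < s ^ 3 := by have := hs.1; positivity
  have h := hpos (1 - s ^ 3) ⟨by linarith, by linarith⟩
  have hroot : (1 - (1 - s ^ 3)) ^ (1 / 3 : ℝ) = s := by
    rw [sub_sub_cancel, ← Real.rpow_natCast, ← Real.rpow_mul hs.1.le]; norm_num
  rw [profile, hroot, sub_sub_cancel, powPos_of_pos hs3'] at h
  have := Real.rpow_pos_of_pos hs3' (σ - 2)
  nlinarith

lemma pos (hF : IsProfile σ F) {s : ℝ} (hs : s ∈ Ioo (0 : ℝ) 1) :
    0 < F s := by
  have hev : ∀ᶠ V in 𝓝[<] (1 : ℝ), 0 < profile σ F V := by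
    have h1 := tendsto_cbrt_one_sub.eventually (hF.tendsto_one.eventually (lt_mem_nhds one_pos))
    filter_upwards [h1, self_mem_nhdsWithin] with V hV (hV1 : V < 1)
    rw [profile, powPos_of_pos (by linarith)]
    exact mul_pos (Real.rpow_pos_of_pos (by linarith) _) hV
  have hout : ∀ V > 1, profile σ F V = 0 := fun V hV => by
    simp [profile, powPos_of_nonpos (show 1 - V ≤ 0 by linarith)]
  -- At a zero of the nonnegative function `profile σ F` the equation would force it to vanish to the
  -- right, whereas it is positive near the pole.
  have hnn := nonneg_of_neg_kInf_nonneg hF.continuousOn_profile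
    (fun ε hε => hev.mono fun V hV => by linarith) (fun V hV => (hout V hV).ge) hF.equation
    (fun _ _ => le_rfl)
  have hs3 : s ^ 3 < 1 := pow_lt_one₀ hs.1.le hs.2 (by norm_num)
  have hs3' : 0 < s ^ 3 := by have := hs.1; positivity
  set V := 1 - s ^ 3 with hVdef
  have hV : V ∈ Ioo (0 : ℝ) 1 := ⟨by linarith, by linarith⟩
  have hroot : (1 - V) ^ (1 / 3 : ℝ) = s := by
    rw [hVdef, sub_sub_cancel, ← Real.rpow_natCast, ← Real.rpow_mul hs.1.le]; norm_num
  have hprof : profile σ F V = (s ^ 3) ^ (σ - 2) * F s := by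
    rw [profile, hroot, hVdef, sub_sub_cancel, powPos_of_pos hs3']
  have hne : profile σ F V ≠ 0 := by
    intro h0
    obtain ⟨i, e⟩ := hF.equation V hV
    have hae := ae_eq_of_isMin (b := 1) hV.1 (fun x hx hx1 => ?_) i e.ge
    · obtain ⟨c, hc, hc'⟩ := (mem_nhdsLT_iff_exists_Ioo_subset' hV.2).1 hev
      obtain ⟨v, hv1, hv2, hv⟩ := exists_gt_of_ae_restrict_Ioi hae (c := max c V - V)
        (d := 1 - V) (by linarith [le_max_right c V]) (by
          have := max_lt hc hV.2; linarith)
      have : 0 < profile σ F (V + v) :=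
        hc' ⟨by linarith [le_max_left c V], by linarith⟩
      linarith
    · rw [h0]
      rcases lt_or_gt_of_ne hx1 with h | h
      · exact hnn x ⟨hV.1.trans hx, h⟩
      · rw [hout x h]
  have h := lt_of_le_of_ne (hnn V hV) hne.symm
  rw [hprof] at h
  exact pos_of_mul_pos_right h (Real.rpow_nonneg hs3'.le _)

end IsProfile

/-! ### Logarithmic coordinates -/

/-- The Lévy density on `(0, ∞)` of the operator `𝒦_∞` in the coordinate `t = log (b / V)`. -/
def levy (σ y : ℝ) : ℝ :=
  Real.exp y * ((Real.exp y - 1) ^ (-σ) * (1 + (Real.exp y - 1) ^ (1 / 3 : ℝ)) ^ 2)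

/-- The operator `Φ ↦ ∫_0^∞ ν(y) (Φ(t) - Φ(t - y)) dy`, where `ν` is the Lévy density. -/
def logOp (σ : ℝ) (Φ : ℝ → ℝ) (t : ℝ) : ℝ :=
  ∫ y in Ioi (0 : ℝ), levy σ y * (Φ t - Φ (t - y))

lemma image_mul_exp_sub_one {V : ℝ} (hV : 0 < V) :
    (fun y : ℝ => V * (Real.exp y - 1)) '' Ioi 0 = Ioi 0 := by
  ext w
  constructor
  · rintro ⟨y, hy, rfl⟩
    have := Real.one_lt_exp_iff.2 hy
    exact mul_pos hV (by linarith)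
  · intro (hw : 0 < w)
    refine ⟨Real.log (1 + w / V), Real.log_pos (by linarith [div_pos hw hV]), ?_⟩
    simp only
    rw [Real.exp_log (by positivity)]
    field_simp
    ring

/-- In the coordinate `t = log (b / V)` the operator `-𝒦_∞` is, up to the factor `V^{5/3-σ}`,
translation invariant. -/
lemma kInf_log {σ b V : ℝ} (hb : 0 < b) (hV : 0 < V) {φ Φ : ℝ → ℝ}
    (hφ : ∀ x > 0, φ x = Φ (Real.log (b / x))) :
    (IntegrableOn (kInfIntegrand σ φ V) (Ioi 0) ↔
      IntegrableOn (fun y => levy σ y * (Φ (Real.log (b / V)) - Φ (Real.log (b / V) - y)))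
        (Ioi 0)) ∧
    -kInf σ φ V = V ^ (5 / 3 - σ) * logOp σ Φ (Real.log (b / V)) := by
  have hd : ∀ y ∈ Ioi (0 : ℝ), HasDerivWithinAt (fun y : ℝ => V * (Real.exp y - 1))
      (V * Real.exp y) (Ioi 0) y := fun y _ =>
    (((Real.hasDerivAt_exp y).sub_const 1).const_mul V).hasDerivWithinAt
  have hinj : InjOn (fun y : ℝ => V * (Real.exp y - 1)) (Ioi 0) := by
    intro y _ z _ h
    have := mul_left_cancel₀ hV.ne' h
    exact Real.exp_injective (by linarith)
  have hpt : ∀ y ∈ Ioi (0 : ℝ),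
      |V * Real.exp y| • kInfIntegrand σ φ V (V * (Real.exp y - 1)) =
      -(V ^ (5 / 3 - σ)) *
        (levy σ y * (Φ (Real.log (b / V)) - Φ (Real.log (b / V) - y))) := by
    intro y (hy : 0 < y)
    have he := Real.one_lt_exp_iff.2 hy
    have hr : 0 < Real.exp y - 1 := by linarith
    have e1 : V + V * (Real.exp y - 1) = V * Real.exp y := by ring
    have e2 : Real.log (b / (V * Real.exp y)) = Real.log (b / V) - y := by
      rw [← div_div, Real.log_div (by positivity) (Real.exp_pos y).ne', Real.log_exp]
    have e3 : V ^ (5 / 3 - σ) = V * (V ^ (-σ) * (V ^ (1 / 3 : ℝ) * V ^ (1 / 3 : ℝ))) := by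
      nth_rewrite 2 [← Real.rpow_one V]
      rw [← Real.rpow_add hV, ← Real.rpow_add hV, ← Real.rpow_add hV]; congr 1; ring
    rw [abs_of_pos (by positivity), smul_eq_mul, kInfIntegrand, e1, hφ V hV,
      hφ _ (by positivity), e2, Real.mul_rpow hV.le hr.le, Real.mul_rpow hV.le hr.le, e3, levy]
    ring
  have hc : -(V ^ (5 / 3 - σ)) ≠ 0 := neg_ne_zero.2 (Real.rpow_pos_of_pos hV _).ne'
  constructor
  · have h := integrableOn_image_iff_integrableOn_abs_deriv_smul measurableSet_Ioi hd hinj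
      (kInfIntegrand σ φ V)
    rw [image_mul_exp_sub_one hV] at h
    rw [h, integrableOn_congr_fun hpt measurableSet_Ioi, IntegrableOn, IntegrableOn,
      integrable_const_mul_iff hc.isUnit]
  · have h := integral_image_eq_integral_abs_deriv_smul measurableSet_Ioi hd hinj
      (kInfIntegrand σ φ V)
    rw [image_mul_exp_sub_one hV] at h
    rw [kInf, h, setIntegral_congr_fun measurableSet_Ioi hpt, integral_const_mul, logOp]
    ring

lemma solvesOn_iff_log {σ b : ℝ} (hb : 0 < b) {φ Φ g : ℝ → ℝ}
    (hφ : ∀ x > 0, φ x = Φ (Real.log (b / x))) :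
    SolvesOn σ b φ g ↔ ∀ t > 0,
      IntegrableOn (fun y => levy σ y * (Φ t - Φ (t - y))) (Ioi 0) ∧
        logOp σ Φ t = (b * Real.exp (-t)) ^ (σ - 5 / 3) * g (b * Real.exp (-t)) := by
  have hcancel : ∀ V : ℝ, 0 < V → V ^ (σ - 5 / 3) * V ^ (5 / 3 - σ) = 1 := fun V hV => by
    rw [← Real.rpow_add hV]; simp
  constructor
  · intro h t ht
    have hV : 0 < b * Real.exp (-t) := by positivity
    have hVb : b * Real.exp (-t) < b := by
      have : Real.exp (-t) < 1 := by simpa using ht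
      nlinarith
    have hlog : Real.log (b / (b * Real.exp (-t))) = t := by
      rw [div_mul_cancel_left₀ hb.ne', Real.log_inv, Real.log_exp, neg_neg]
    obtain ⟨i, e⟩ := h _ ⟨hV, hVb⟩
    obtain ⟨k1, k2⟩ := kInf_log (σ := σ) hb hV hφ
    rw [hlog] at k1 k2
    refine ⟨k1.1 i, ?_⟩
    rw [← e, k2, ← mul_assoc, hcancel _ hV, one_mul]
  · intro h V hV
    have ht : 0 < Real.log (b / V) := Real.log_pos (by rw [one_lt_div hV.1]; exact hV.2)
    have hexp : b * Real.exp (-Real.log (b / V)) = V := by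
      rw [Real.exp_neg, Real.exp_log (div_pos hb hV.1), inv_div]
      field_simp
    obtain ⟨i, e⟩ := h _ ht
    obtain ⟨k1, k2⟩ := kInf_log (σ := σ) hb hV.1 hφ
    rw [hexp] at e
    refine ⟨k1.2 i, ?_⟩
    rw [k2, e, ← mul_assoc, mul_comm (V ^ _), hcancel _ hV.1, one_mul]

/-! ### The Lévy density and its tail -/

/-- The tail `∫_y^∞ ν` of the Lévy density, for `y > 0`. -/
def levyTail (σ y : ℝ) : ℝ :=
  (Real.exp y - 1) ^ (1 - σ) / (σ - 1) + 2 * (Real.exp y - 1) ^ (4 / 3 - σ) / (σ - 4 / 3) +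
    (Real.exp y - 1) ^ (5 / 3 - σ) / (σ - 5 / 3)

lemma exp_sub_one_pos {y : ℝ} (hy : 0 < y) : 0 < Real.exp y - 1 := by
  linarith [Real.one_lt_exp_iff.2 hy]

lemma levy_eq (σ : ℝ) {y : ℝ} (hy : 0 < y) :
    levy σ y = Real.exp y * ((Real.exp y - 1) ^ (-σ) + 2 * (Real.exp y - 1) ^ (1 / 3 - σ) +
      (Real.exp y - 1) ^ (2 / 3 - σ)) := by
  have hr := exp_sub_one_pos hy
  have e1 : (Real.exp y - 1) ^ (1 / 3 - σ) =
      (Real.exp y - 1) ^ (-σ) * (Real.exp y - 1) ^ (1 / 3 : ℝ) := by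
    rw [← Real.rpow_add hr]; congr 1; ring
  have e2 : (Real.exp y - 1) ^ (2 / 3 - σ) = (Real.exp y - 1) ^ (-σ) *
      ((Real.exp y - 1) ^ (1 / 3 : ℝ) * (Real.exp y - 1) ^ (1 / 3 : ℝ)) := by
    rw [← Real.rpow_add hr, ← Real.rpow_add hr]; congr 1; ring
  rw [levy, e1, e2]; ring

lemma levy_pos (σ : ℝ) {y : ℝ} (hy : 0 < y) : 0 < levy σ y := by
  have hr := exp_sub_one_pos hy
  unfold levy; positivity

lemma measurable_levy (σ : ℝ) : Measurable (levy σ) := by unfold levy; fun_prop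

lemma measurable_levyTail (σ : ℝ) : Measurable (levyTail σ) := by unfold levyTail; fun_prop

lemma hasDerivAt_levyTail {σ : ℝ} (hσ₁ : 5 / 3 < σ) {y : ℝ} (hy : 0 < y) :
    HasDerivAt (levyTail σ) (-levy σ y) y := by
  have hr := exp_sub_one_pos hy
  have hd : ∀ p : ℝ, HasDerivAt (fun y : ℝ => (Real.exp y - 1) ^ p)
      (Real.exp y * p * (Real.exp y - 1) ^ (p - 1)) y := fun p =>
    ((Real.hasDerivAt_exp y).sub_const 1).rpow_const (Or.inl hr.ne')
  have h := (((hd (1 - σ)).div_const (σ - 1)).add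
    (((hd (4 / 3 - σ)).const_mul 2).div_const (σ - 4 / 3))).add
    ((hd (5 / 3 - σ)).div_const (σ - 5 / 3))
  refine h.congr_deriv ?_
  rw [levy_eq σ hy]
  have h1 : σ - 1 ≠ 0 := by linarith
  have h2 : σ - 4 / 3 ≠ 0 := by linarith
  have h3 : σ - 5 / 3 ≠ 0 := by linarith
  rw [show 1 - σ - 1 = -σ by ring, show 4 / 3 - σ - 1 = 1 / 3 - σ by ring,
    show 5 / 3 - σ - 1 = 2 / 3 - σ by ring, show 1 - σ = -(σ - 1) by ring,
    show 4 / 3 - σ = -(σ - 4 / 3) by ring, show 5 / 3 - σ = -(σ - 5 / 3) by ring]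
  generalize (Real.exp y - 1) ^ (-σ) = A
  generalize (Real.exp y - 1) ^ (1 / 3 - σ) = B
  generalize (Real.exp y - 1) ^ (2 / 3 - σ) = C
  generalize Real.exp y = E
  generalize σ - 1 = a at *
  generalize σ - 4 / 3 = b at *
  generalize σ - 5 / 3 = c at *
  field_simp
  ring

lemma tendsto_levyTail_atTop {σ : ℝ} (hσ₁ : 5 / 3 < σ) :
    Tendsto (levyTail σ) atTop (𝓝 0) := by
  have hr : Tendsto (fun y : ℝ => Real.exp y - 1) atTop atTop :=
    tendsto_atTop_add_const_right _ _ Real.tendsto_exp_atTop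
  have hp : ∀ p : ℝ, 0 < p → Tendsto (fun y : ℝ => (Real.exp y - 1) ^ (-p)) atTop (𝓝 0) :=
    fun p hp => (tendsto_rpow_neg_atTop hp).comp hr
  have h := (((hp (σ - 1) (by linarith)).div_const (σ - 1)).add
    (((hp (σ - 4 / 3) (by linarith)).const_mul 2).div_const (σ - 4 / 3))).add
    ((hp (σ - 5 / 3) (by linarith)).div_const (σ - 5 / 3))
  simp only [mul_zero, zero_div, add_zero, neg_sub] at h
  exact h

lemma integrableOn_levy {σ : ℝ} (hσ₁ : 5 / 3 < σ) {c : ℝ} (hc : 0 < c) :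
    IntegrableOn (levy σ) (Ioi c) := by
  have := integrableOn_Ioi_deriv_of_nonpos' (a := c)
    (fun y (hy : c ≤ y) => hasDerivAt_levyTail hσ₁ (hc.trans_le hy))
    (fun y (hy : c < y) => by linarith [levy_pos σ (hc.trans hy)]) (tendsto_levyTail_atTop hσ₁)
  simpa using this.neg

lemma integral_levy {σ : ℝ} (hσ₁ : 5 / 3 < σ) {c : ℝ} (hc : 0 < c) :
    ∫ y in Ioi c, levy σ y = levyTail σ c := by
  have := integral_Ioi_of_hasDerivAt_of_nonpos' (a := c)
    (fun y (hy : c ≤ y) => hasDerivAt_levyTail hσ₁ (hc.trans_le hy))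
    (fun y (hy : c < y) => by linarith [levy_pos σ (hc.trans hy)]) (tendsto_levyTail_atTop hσ₁)
  rw [integral_neg] at this
  linarith

lemma levyTail_nonneg {σ : ℝ} (hσ₁ : 5 / 3 < σ) {y : ℝ} (hy : 0 < y) : 0 ≤ levyTail σ y := by
  rw [← integral_levy hσ₁ hy]
  exact setIntegral_nonneg measurableSet_Ioi fun z hz => (levy_pos σ (hy.trans hz)).le

lemma levyTail_anti {σ : ℝ} (hσ₁ : 5 / 3 < σ) {x y : ℝ} (hx : 0 < x) (hxy : x ≤ y) :
    levyTail σ y ≤ levyTail σ x := by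
  rw [← integral_levy hσ₁ hx, ← integral_levy hσ₁ (hx.trans_le hxy)]
  refine setIntegral_mono_set (integrableOn_levy hσ₁ hx) ?_ (Ioi_subset_Ioi hxy).eventuallyLE
  exact (ae_restrict_mem measurableSet_Ioi).mono fun z hz => (levy_pos σ (hx.trans hz)).le

/-- As a function of `r = e^y - 1` the Lévy density is a sum of negative powers. -/
lemma levy_anti {σ : ℝ} (hσ₁ : 5 / 3 < σ) {x y : ℝ} (hx : 0 < x) (hxy : x ≤ y) :
    levy σ y ≤ levy σ x := by
  have key : ∀ {z : ℝ}, 0 < z → levy σ z =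
      (Real.exp z - 1) ^ (-σ) + 2 * (Real.exp z - 1) ^ (1 / 3 - σ) +
      (Real.exp z - 1) ^ (2 / 3 - σ) + ((Real.exp z - 1) ^ (1 - σ) +
      2 * (Real.exp z - 1) ^ (4 / 3 - σ) + (Real.exp z - 1) ^ (5 / 3 - σ)) := by
    intro z hz
    have hr := exp_sub_one_pos hz
    have e : ∀ p : ℝ, (Real.exp z - 1) ^ (1 + p) = (Real.exp z - 1) * (Real.exp z - 1) ^ p :=
      fun p => by rw [Real.rpow_add hr, Real.rpow_one]
    rw [levy_eq σ hz, show 1 - σ = 1 + -σ by ring, show 4 / 3 - σ = 1 + (1 / 3 - σ) by ring,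
      show 5 / 3 - σ = 1 + (2 / 3 - σ) by ring, e, e, e]
    ring
  have hy := hx.trans_le hxy
  have hrx := exp_sub_one_pos hx
  have hle : Real.exp x - 1 ≤ Real.exp y - 1 := by gcongr
  have hp : ∀ p : ℝ, p ≤ 0 → (Real.exp y - 1) ^ p ≤ (Real.exp x - 1) ^ p := fun p hp =>
    Real.rpow_le_rpow_of_nonpos hrx hle hp
  rw [key hx, key hy]
  have := hp (-σ) (by linarith)
  have := hp (1 / 3 - σ) (by linarith)
  have := hp (2 / 3 - σ) (by linarith)
  have := hp (1 - σ) (by linarith)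
  have := hp (4 / 3 - σ) (by linarith)
  have := hp (5 / 3 - σ) (by linarith)
  linarith

lemma integrableOn_mul_levy {σ : ℝ} (hσ₁ : 5 / 3 < σ) (hσ₂ : σ < 2) (c : ℝ) :
    IntegrableOn (fun y => y * levy σ y) (Ioc 0 c) := by
  set C := Real.exp c * (1 + (Real.exp c - 1) ^ (1 / 3 : ℝ)) ^ 2 with hC
  have h1 : IntegrableOn (fun y : ℝ => C * y ^ (1 - σ)) (Ioc 0 c) := by
    rcases le_or_gt c 0 with h | h
    · simp [Ioc_eq_empty_of_le h]
    have := (intervalIntegral.intervalIntegrable_rpow' (a := 0) (b := c) (r := 1 - σ)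
      (by linarith)).1
    exact this.const_mul C
  refine h1.mono' (by have := measurable_levy σ; fun_prop) ?_
  refine (ae_restrict_mem measurableSet_Ioc).mono fun y hy => ?_
  have hr := exp_sub_one_pos hy.1
  rw [Real.norm_of_nonneg (mul_nonneg hy.1.le (levy_pos σ hy.1).le)]
  have e1 : y ^ (1 - σ) = y * y ^ (-σ) := by
    rw [sub_eq_add_neg, Real.rpow_add hy.1, Real.rpow_one]
  have h2 : (Real.exp y - 1) ^ (-σ) ≤ y ^ (-σ) :=
    Real.rpow_le_rpow_of_nonpos hy.1 (by linarith [Real.add_one_le_exp y]) (by linarith)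
  have h3 : Real.exp y ≤ Real.exp c := Real.exp_le_exp.2 hy.2
  have h4 : (Real.exp y - 1) ^ (1 / 3 : ℝ) ≤ (Real.exp c - 1) ^ (1 / 3 : ℝ) := by gcongr
  have h5 : 0 ≤ (Real.exp y - 1) ^ (1 / 3 : ℝ) := by positivity
  calc y * levy σ y
      ≤ y * (Real.exp c * (y ^ (-σ) * (1 + (Real.exp c - 1) ^ (1 / 3 : ℝ)) ^ 2)) := by
        unfold levy
        have := hy.1.le
        have : 0 ≤ (Real.exp y - 1) ^ (-σ) := by positivity
        gcongr
    _ = C * y ^ (1 - σ) := by rw [e1, hC]; ring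

/-- The tail compared with its leading power at `0`. -/
lemma levyTail_mul_rpow {σ : ℝ} {y : ℝ} (hy : 0 < y) :
    levyTail σ y * y ^ (σ - 1) = ((Real.exp y - 1) / y) ^ (1 - σ) / (σ - 1) +
      2 * (((Real.exp y - 1) / y) ^ (4 / 3 - σ) * y ^ (1 / 3 : ℝ)) / (σ - 4 / 3) +
      ((Real.exp y - 1) / y) ^ (5 / 3 - σ) * y ^ (2 / 3 : ℝ) / (σ - 5 / 3) := by
  have hr := exp_sub_one_pos hy
  have e : ∀ p q : ℝ, q - p = σ - 1 →
      ((Real.exp y - 1) / y) ^ p * y ^ q = (Real.exp y - 1) ^ p * y ^ (σ - 1) := fun p q h => by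
    rw [Real.div_rpow hr.le hy.le, ← h, Real.rpow_sub hy]; ring
  have e0 := e (1 - σ) 0 (by ring)
  rw [Real.rpow_zero, mul_one] at e0
  rw [e0, e _ _ (by ring), e _ _ (by ring), levyTail]
  ring

lemma one_le_exp_sub_one_div {y : ℝ} (hy : 0 < y) : 1 ≤ (Real.exp y - 1) / y := by
  rw [one_le_div hy]; linarith [Real.add_one_le_exp y]

lemma exists_levyTail_le {σ : ℝ} (hσ₁ : 5 / 3 < σ) (c : ℝ) :
    ∃ C, 0 ≤ C ∧ ∀ y ∈ Ioc 0 c, levyTail σ y ≤ C * y ^ (1 - σ) := by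
  rcases le_or_gt c 0 with hc | hc
  · exact ⟨0, le_rfl, fun y hy => absurd (hy.1.trans_le hy.2) hc.not_gt⟩
  have h1 : 0 < σ - 1 := by linarith
  have h2 : 0 < σ - 4 / 3 := by linarith
  have h3 : 0 < σ - 5 / 3 := by linarith
  refine ⟨1 / (σ - 1) + 2 * (1 * c ^ (1 / 3 : ℝ)) / (σ - 4 / 3) +
    1 * c ^ (2 / 3 : ℝ) / (σ - 5 / 3), by positivity, fun y hy => ?_⟩
  have hq := one_le_exp_sub_one_div hy.1
  have hp : ∀ p : ℝ, p ≤ 0 → ((Real.exp y - 1) / y) ^ p ≤ 1 := fun p hp =>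
    Real.rpow_le_one_of_one_le_of_nonpos hq hp
  have hyc : ∀ p : ℝ, 0 ≤ p → y ^ p ≤ c ^ p := fun p hp => Real.rpow_le_rpow hy.1.le hy.2 hp
  have key : levyTail σ y * y ^ (σ - 1) ≤ 1 / (σ - 1) +
      2 * (1 * c ^ (1 / 3 : ℝ)) / (σ - 4 / 3) + 1 * c ^ (2 / 3 : ℝ) / (σ - 5 / 3) := by
    rw [levyTail_mul_rpow hy.1]
    have := hp (1 - σ) (by linarith)
    have := hp (4 / 3 - σ) (by linarith)
    have := hp (5 / 3 - σ) (by linarith)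
    have := hyc (1 / 3) (by norm_num)
    have := hyc (2 / 3) (by norm_num)
    have : 0 ≤ y ^ (1 / 3 : ℝ) := Real.rpow_nonneg hy.1.le _
    have : 0 ≤ y ^ (2 / 3 : ℝ) := Real.rpow_nonneg hy.1.le _
    gcongr
  have hyp := Real.rpow_pos_of_pos hy.1 (σ - 1)
  rw [show 1 - σ = -(σ - 1) by ring, Real.rpow_neg hy.1.le, ← div_eq_mul_inv, le_div_iff₀ hyp]
  exact key

lemma tendsto_levyTail_mul_rpow {σ : ℝ} :
    Tendsto (fun y => levyTail σ y * y ^ (σ - 1)) (𝓝[>] 0) (𝓝 (1 / (σ - 1))) := by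
  have hq : Tendsto (fun y : ℝ => (Real.exp y - 1) / y) (𝓝[>] 0) (𝓝 1) := by
    have h := (Real.hasDerivAt_exp 0).tendsto_slope_zero_right
    simpa [smul_eq_mul, div_eq_inv_mul] using h
  have hqp : ∀ p : ℝ, Tendsto (fun y : ℝ => ((Real.exp y - 1) / y) ^ p) (𝓝[>] 0) (𝓝 1) :=
      fun p => by
    simpa using hq.rpow_const (p := p) (Or.inl one_ne_zero)
  have hy : ∀ p : ℝ, 0 < p → Tendsto (fun y : ℝ => y ^ p) (𝓝[>] 0) (𝓝 0) := fun p hp => by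
    have := (Real.continuousAt_rpow_const 0 p (Or.inr hp.le)).tendsto
    rw [Real.zero_rpow hp.ne'] at this
    exact this.mono_left nhdsWithin_le_nhds
  have h := (((hqp (1 - σ)).div_const (σ - 1)).add
    ((((hqp (4 / 3 - σ)).mul (hy (1 / 3) (by norm_num))).const_mul 2).div_const (σ - 4 / 3))).add
    (((hqp (5 / 3 - σ)).mul (hy (2 / 3) (by norm_num))).div_const (σ - 5 / 3))
  simp only [mul_zero, zero_div, add_zero] at h
  refine h.congr' ?_
  filter_upwards [self_mem_nhdsWithin] with y hy
  rw [levyTail_mul_rpow hy]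

lemma integrableOn_levyTail {σ : ℝ} (hσ₁ : 5 / 3 < σ) (hσ₂ : σ < 2) (c : ℝ) :
    IntegrableOn (levyTail σ) (Ioc 0 c) := by
  obtain ⟨C, hC0, hC⟩ := exists_levyTail_le hσ₁ c
  have h1 : IntegrableOn (fun y : ℝ => C * y ^ (1 - σ)) (Ioc 0 c) := by
    rcases le_or_gt c 0 with h | h
    · simp [Ioc_eq_empty_of_le h]
    have := (intervalIntegral.intervalIntegrable_rpow' (a := 0) (b := c) (r := 1 - σ)
      (by linarith)).1
    exact this.const_mul C
  refine h1.mono' (measurable_levyTail σ).aestronglyMeasurable ?_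
  refine (ae_restrict_mem measurableSet_Ioc).mono fun y hy => ?_
  rw [Real.norm_of_nonneg (levyTail_nonneg hσ₁ hy.1)]
  exact hC y hy

/-! ### The operator in logarithmic coordinates as the derivative of a convolution -/

/-- The convolution `∫_0^t f(t - z) g(z) dz` on the half-line. -/
def hconv (f g : ℝ → ℝ) (t : ℝ) : ℝ := ∫ z in Ioo 0 t, f (t - z) * g z

/-- Functions supported in `[0, ∞)`, integrable near `0` and locally Lipschitz on `(0, ∞)`. -/
structure Causal (W : ℝ → ℝ) : Prop where
  measurable : Measurable W
  zero : ∀ t ≤ 0, W t = 0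
  integrableOn : ∀ c, IntegrableOn W (Ioc 0 c)
  lip : ∀ a c, 0 < a → ∃ L : ℝ, 0 ≤ L ∧ ∀ x ∈ Icc a c, ∀ y ∈ Icc a c, |W x - W y| ≤ L * |x - y|

namespace Causal

variable {W : ℝ → ℝ}

lemma continuousAt (hW : Causal W) {t : ℝ} (ht : 0 < t) : ContinuousAt W t := by
  obtain ⟨L, hL0, hL⟩ := hW.lip (t / 2) (t + 1) (by linarith)
  have hL' : LipschitzOnWith ⟨L, hL0⟩ W (Icc (t / 2) (t + 1)) :=
    LipschitzOnWith.of_dist_le_mul fun x hx y hy => hL x hx y hy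
  exact hL'.continuousOn.continuousAt (Icc_mem_nhds (by linarith) (by linarith))

lemma bdd (hW : Causal W) (a c : ℝ) (ha : 0 < a) : ∃ M, 0 ≤ M ∧ ∀ x ∈ Icc a c, |W x| ≤ M := by
  obtain ⟨M, hM⟩ := isCompact_Icc.exists_bound_of_continuousOn (f := W) (s := Icc a c)
    fun x hx => (hW.continuousAt (ha.trans_le hx.1)).continuousWithinAt
  exact ⟨max M 0, le_max_right _ _, fun x hx => (hM x hx).trans (le_max_left _ _)⟩

lemma integrableOn_Iic (hW : Causal W) (c : ℝ) : IntegrableOn W (Iic c) := by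
  have h0 : IntegrableOn W (Iic 0) :=
    integrableOn_zero.congr_fun (fun x hx => (hW.zero x hx).symm) measurableSet_Iic
  refine (h0.union (hW.integrableOn c)).mono_set fun x (hx : x ≤ c) => ?_
  rcases le_or_gt x 0 with h | h
  · exact Or.inl h
  · exact Or.inr ⟨h, hx⟩

lemma intervalIntegrable (hW : Causal W) (a c : ℝ) : IntervalIntegrable W volume a c :=
  ⟨(hW.integrableOn_Iic c).mono_set Ioc_subset_Iic_self,
    (hW.integrableOn_Iic a).mono_set Ioc_subset_Iic_self⟩

lemma integrable_indicator (hW : Causal W) (c : ℝ) : Integrable ((Iic c).indicator W) :=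
  (integrable_indicator_iff measurableSet_Iic).2 (hW.integrableOn_Iic c)

end Causal

section LogOp

variable {σ : ℝ} {W : ℝ → ℝ}

/-- Small jumps are controlled by the Lipschitz constant, large ones by the integral of `W`. -/
lemma Causal.exists_bound (hσ₁ : 5 / 3 < σ) (hσ₂ : σ < 2) (hW : Causal W) {a : ℝ} (ha : 0 < a)
    (c : ℝ) : ∃ C, ∀ s ∈ Icc a c,
      IntegrableOn (fun y => levy σ y * (W s - W (s - y))) (Ioi 0) ∧
      ∫ y in Ioi (0 : ℝ), ‖levy σ y * (W s - W (s - y))‖ ≤ C := by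
  set δ := a / 2 with hδ
  have hδ0 : 0 < δ := by positivity
  obtain ⟨L, hL0, hL⟩ := hW.lip δ c hδ0
  obtain ⟨M, hM0, hM⟩ := hW.bdd a c ha
  set Wc := (Iic c).indicator W with hWc
  -- A majorant of the integrand whose integral does not depend on `s`.
  set E : ℝ → ℝ → ℝ := fun s y => L * (Ioc 0 δ).indicator (fun y => y * levy σ y) y +
    M * (Ioi δ).indicator (levy σ) y + levy σ δ * ‖Wc (s - y)‖ with hE
  have hi1 : Integrable ((Ioc 0 δ).indicator fun y => y * levy σ y) :=
    (integrable_indicator_iff measurableSet_Ioc).2 (integrableOn_mul_levy hσ₁ hσ₂ δ)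
  have hi2 : Integrable ((Ioi δ).indicator (levy σ)) :=
    (integrable_indicator_iff measurableSet_Ioi).2 (integrableOn_levy hσ₁ hδ0)
  have hi3 : Integrable Wc := hW.integrable_indicator c
  have hEi : ∀ s, Integrable (E s) := fun s =>
    ((hi1.const_mul L).add (hi2.const_mul M)).add
      ((hi3.comp_sub_left s).norm.const_mul (levy σ δ))
  have hE0 : ∀ s y, 0 ≤ E s y := by
    intro s y
    have h1 : 0 ≤ (Ioc 0 δ).indicator (fun y => y * levy σ y) y :=
      indicator_nonneg (fun y hy => mul_nonneg hy.1.le (levy_pos σ hy.1).le) y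
    have h2 : 0 ≤ (Ioi δ).indicator (levy σ) y :=
      indicator_nonneg (fun y hy => (levy_pos σ (hδ0.trans hy)).le) y
    have h3 := (levy_pos σ hδ0).le
    simp only [hE]
    positivity
  have hbd : ∀ s ∈ Icc a c, ∀ y ∈ Ioi (0 : ℝ), ‖levy σ y * (W s - W (s - y))‖ ≤ E s y := by
    intro s hs y (hy : 0 < y)
    rw [norm_mul, Real.norm_of_nonneg (levy_pos σ hy).le, Real.norm_eq_abs]
    have h3 : 0 ≤ levy σ δ * ‖Wc (s - y)‖ := mul_nonneg (levy_pos σ hδ0).le (norm_nonneg _)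
    rcases le_or_gt y δ with h | h
    · have hmem : y ∈ Ioc 0 δ := ⟨hy, h⟩
      have hnm : y ∉ Ioi δ := not_lt.2 h
      simp only [hE, indicator_of_mem hmem, indicator_of_notMem hnm, mul_zero, add_zero]
      have hsy : |W s - W (s - y)| ≤ L * |s - (s - y)| :=
        hL s ⟨by linarith [hs.1], hs.2⟩ (s - y) ⟨by linarith [hs.1], by linarith [hs.2]⟩
      rw [sub_sub_cancel, abs_of_pos hy] at hsy
      have := mul_le_mul_of_nonneg_left hsy (levy_pos σ hy).le
      linarith
    · have hmem : y ∉ Ioc 0 δ := fun h' => absurd h'.2 h.not_ge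
      have hnm : y ∈ Ioi δ := h
      have hsy : s - y ∈ Iic c := by simp only [mem_Iic]; linarith [hs.2]
      simp only [hE, indicator_of_notMem hmem, indicator_of_mem hnm, mul_zero, zero_add, hWc,
        indicator_of_mem hsy, Real.norm_eq_abs]
      have h1 := levy_anti hσ₁ hδ0 h.le
      have h2 := abs_sub (W s) (W (s - y))
      have h4 := hM s hs
      have h5 := (levy_pos σ hy).le
      have h6 := abs_nonneg (W (s - y))
      calc levy σ y * |W s - W (s - y)| ≤ levy σ y * (M + |W (s - y)|) := by gcongr; linarith
        _ ≤ M * levy σ y + levy σ δ * |W (s - y)| := by nlinarith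
  have hmeas : ∀ s, Measurable fun y => levy σ y * (W s - W (s - y)) := fun s =>
    (measurable_levy σ).mul (measurable_const.sub (hW.measurable.comp (by fun_prop)))
  have hint : ∀ s ∈ Icc a c, IntegrableOn (fun y => levy σ y * (W s - W (s - y))) (Ioi 0) := by
    intro s hs
    exact (hEi s).integrableOn.mono' (hmeas s).aestronglyMeasurable
      ((ae_restrict_mem measurableSet_Ioi).mono (hbd s hs))
  refine ⟨L * (∫ y, (Ioc 0 δ).indicator (fun y => y * levy σ y) y) +
    M * (∫ y, (Ioi δ).indicator (levy σ) y) + levy σ δ * ∫ y, ‖Wc y‖, fun s hs =>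
    ⟨hint s hs, ?_⟩⟩
  calc ∫ y in Ioi (0 : ℝ), ‖levy σ y * (W s - W (s - y))‖ ≤ ∫ y in Ioi (0 : ℝ), E s y :=
        setIntegral_mono_on (hint s hs).norm (hEi s).integrableOn measurableSet_Ioi (hbd s hs)
    _ ≤ ∫ y, E s y := setIntegral_le_integral (hEi s) (Eventually.of_forall (hE0 s))
    _ = _ := by
        have h := integral_add ((hi1.const_mul L).add (hi2.const_mul M))
          ((hi3.comp_sub_left s).norm.const_mul (levy σ δ))
        simp only [Pi.add_apply] at h
        rw [h, integral_add (hi1.const_mul L) (hi2.const_mul M), integral_const_mul,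
          integral_const_mul, integral_const_mul,
          integral_sub_left_eq_self (fun y => ‖Wc y‖) volume s]

lemma Causal.integrableOn_levyTail_mul (hσ₁ : 5 / 3 < σ) (hσ₂ : σ < 2) (hW : Causal W) {t : ℝ}
    (ht : 0 < t) : IntegrableOn (fun z => levyTail σ (t - z) * W z) (Ioo 0 t) := by
  have hmeas : Measurable fun z => levyTail σ (t - z) * W z :=
    ((measurable_levyTail σ).comp (by fun_prop)).mul hW.measurable
  have hun : Ioo 0 t = Ioc 0 (t / 2) ∪ Ioo (t / 2) t :=
    (Ioc_union_Ioo_eq_Ioo (by linarith) (by linarith)).symm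
  rw [hun]
  refine IntegrableOn.union ?_ ?_
  · refine ((hW.integrableOn (t / 2)).norm.const_mul (levyTail σ (t / 2))).mono'
      hmeas.aestronglyMeasurable ((ae_restrict_mem measurableSet_Ioc).mono fun z hz => ?_)
    rw [norm_mul, Real.norm_of_nonneg (levyTail_nonneg hσ₁ (by linarith [hz.2]))]
    gcongr
    exact levyTail_anti hσ₁ (by linarith) (by linarith [hz.2])
  · obtain ⟨M, hM0, hM⟩ := hW.bdd (t / 2) t (by linarith)
    have hT : IntegrableOn (fun z => levyTail σ (t - z)) (Ioo (t / 2) t) := by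
      have h : IntervalIntegrable (levyTail σ) volume 0 (t / 2) := by
        rw [intervalIntegrable_iff_integrableOn_Ioc_of_le (by linarith)]
        exact integrableOn_levyTail hσ₁ hσ₂ _
      have h' := (h.comp_sub_left t).symm
      rw [sub_zero, show t - t / 2 = t / 2 by ring,
        intervalIntegrable_iff_integrableOn_Ioo_of_le (by linarith)] at h'
      exact h'
    refine (hT.const_mul M).mono' hmeas.aestronglyMeasurable
      ((ae_restrict_mem measurableSet_Ioo).mono fun z hz => ?_)
    have h1 := levyTail_nonneg hσ₁ (show 0 < t - z by linarith [hz.2])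
    rw [norm_mul, Real.norm_of_nonneg h1, mul_comm]
    gcongr
    exact hM z ⟨hz.1.le, hz.2.le⟩

/-- The contribution of the jumps across the level `t`. -/
lemma Causal.integral_levy_mul_integral (hσ₁ : 5 / 3 < σ) (hσ₂ : σ < 2) (hW : Causal W) {t : ℝ}
    (ht : 0 < t) : IntegrableOn (fun y => levy σ y * ∫ z in (t - y)..t, W z) (Ioi 0) ∧
      ∫ y in Ioi (0 : ℝ), levy σ y * ∫ z in (t - y)..t, W z = hconv (levyTail σ) W t := by
  -- Fubini: a jump of size `y` started at `t - y` crosses `z ∈ (0, t)` when `y > t - z`, and the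
  -- jumps longer than `t - z` have total mass `levyTail σ (t - z)`.
  set k : ℝ → ℝ → ℝ := fun z y => (Ioi (t - z)).indicator (levy σ) y * W z with hk
  have hkm : Measurable (Function.uncurry k) := by
    have hset : MeasurableSet {p : ℝ × ℝ | t - p.1 < p.2} :=
      measurableSet_lt (by fun_prop) (by fun_prop)
    have : Function.uncurry k = fun p : ℝ × ℝ =>
        ({p : ℝ × ℝ | t - p.1 < p.2}.indicator (fun p => levy σ p.2) p) * W p.1 := by
      funext p
      simp only [Function.uncurry, hk, indicator, mem_Ioi, mem_ofPred_eq]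
    rw [this]
    exact (((measurable_levy σ).comp measurable_snd).indicator hset).mul
      (hW.measurable.comp measurable_fst)
  have hset : ∀ z ∈ Ioo 0 t, Ioi (0 : ℝ) ∩ Ioi (t - z) = Ioi (t - z) := fun z hz =>
    inter_eq_right.2 (Ioi_subset_Ioi (by linarith [hz.2]))
  have hki : ∀ z ∈ Ioo 0 t, IntegrableOn (k z) (Ioi 0) := by
    intro z hz
    refine Integrable.mul_const ?_ (W z)
    refine Integrable.integrableOn ?_
    exact (integrable_indicator_iff measurableSet_Ioi).2
      (integrableOn_levy hσ₁ (by linarith [hz.2]))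
  have hkint : ∀ z ∈ Ioo 0 t, ∫ y in Ioi (0 : ℝ), k z y = levyTail σ (t - z) * W z := by
    intro z hz
    simp only [hk]
    rw [integral_mul_const, setIntegral_indicator measurableSet_Ioi, hset z hz,
      integral_levy hσ₁ (by linarith [hz.2])]
  have hknorm : ∀ z ∈ Ioo 0 t, ∫ y in Ioi (0 : ℝ), ‖k z y‖ = ‖levyTail σ (t - z) * W z‖ := by
    intro z hz
    have : ∀ y, ‖k z y‖ = (Ioi (t - z)).indicator (levy σ) y * ‖W z‖ := by
      intro y
      simp only [hk]
      rw [norm_mul, Real.norm_of_nonneg]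
      exact indicator_nonneg (fun y (hy : t - z < y) => (levy_pos σ (by linarith [hz.2])).le) y
    simp only [this]
    rw [integral_mul_const, setIntegral_indicator measurableSet_Ioi, hset z hz,
      integral_levy hσ₁ (by linarith [hz.2]), norm_mul,
      Real.norm_of_nonneg (levyTail_nonneg hσ₁ (by linarith [hz.2]))]
  have hprod : Integrable (Function.uncurry k)
      ((volume.restrict (Ioo 0 t)).prod (volume.restrict (Ioi 0))) := by
    rw [integrable_prod_iff hkm.aestronglyMeasurable]
    refine ⟨(ae_restrict_mem measurableSet_Ioo).mono hki, ?_⟩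
    exact IntegrableOn.congr_fun (hW.integrableOn_levyTail_mul hσ₁ hσ₂ ht).norm
      (fun z hz => (hknorm z hz).symm) measurableSet_Ioo
  have hinner : ∀ y ∈ Ioi (0 : ℝ),
      ∫ z in Ioo 0 t, k z y = levy σ y * ∫ z in (t - y)..t, W z := by
    intro y (hy : 0 < y)
    have e1 : ∀ z, k z y = levy σ y * (Ioi (t - y)).indicator W z := by
      intro z
      simp only [hk, indicator, mem_Ioi]
      split_ifs with h1 h2 h2
      · rfl
      · exact absurd (by linarith) h2
      · exact absurd (by linarith) h1
      · simp
    simp only [e1]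
    rw [integral_const_mul]
    congr 1
    rw [intervalIntegral.integral_of_le (by linarith), integral_Ioc_eq_integral_Ioo,
      setIntegral_indicator measurableSet_Ioi]
    refine setIntegral_eq_of_subset_of_forall_sdiff_eq_zero measurableSet_Ioo
      (fun z hz => ⟨hz.2, hz.1.2⟩) (fun z hz => hW.zero z ?_) |>.symm
    by_contra! h
    exact hz.2 ⟨⟨h, hz.1.2⟩, hz.1.1⟩
  constructor
  · exact IntegrableOn.congr_fun hprod.integral_prod_right hinner measurableSet_Ioi
  · rw [← setIntegral_congr_fun measurableSet_Ioi hinner, ← integral_integral_swap hprod, hconv]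
    exact setIntegral_congr_fun measurableSet_Ioo hkint

/-- The operator is the derivative of the convolution with the Lévy tail, in integrated form. -/
theorem Causal.integral_logOp (hσ₁ : 5 / 3 < σ) (hσ₂ : σ < 2) (hW : Causal W) {t₁ t₂ : ℝ}
    (h₁ : 0 < t₁) (h₁₂ : t₁ ≤ t₂) :
    IntervalIntegrable (logOp σ W) volume t₁ t₂ ∧
    ∫ s in t₁..t₂, logOp σ W s = hconv (levyTail σ) W t₂ - hconv (levyTail σ) W t₁ := by
  obtain ⟨C, hC⟩ := hW.exists_bound hσ₁ hσ₂ h₁ t₂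
  set f : ℝ → ℝ → ℝ := fun s y => levy σ y * (W s - W (s - y)) with hf
  have hfm : Measurable (Function.uncurry f) :=
    ((measurable_levy σ).comp measurable_snd).mul
      ((hW.measurable.comp measurable_fst).sub (hW.measurable.comp (by fun_prop)))
  have hprod : Integrable (Function.uncurry f)
      ((volume.restrict (Ioc t₁ t₂)).prod (volume.restrict (Ioi 0))) := by
    rw [integrable_prod_iff hfm.aestronglyMeasurable]
    refine ⟨(ae_restrict_mem measurableSet_Ioc).mono fun s hs => (hC s ⟨hs.1.le, hs.2⟩).1, ?_⟩
    refine Integrable.mono' (g := fun _ => C) (by simp)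
      hfm.aestronglyMeasurable.norm.integral_prod_right'
      ((ae_restrict_mem measurableSet_Ioc).mono fun s hs => ?_)
    rw [Real.norm_of_nonneg (integral_nonneg fun _ => norm_nonneg _)]
    exact (hC s ⟨hs.1.le, hs.2⟩).2
  have hinner : ∀ y, ∫ s in Ioc t₁ t₂, f s y =
      levy σ y * (∫ z in (t₂ - y)..t₂, W z) - levy σ y * ∫ z in (t₁ - y)..t₁, W z := by
    intro y
    simp only [hf]
    rw [integral_const_mul, ← intervalIntegral.integral_of_le h₁₂,
      intervalIntegral.integral_sub (hW.intervalIntegrable _ _)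
        (by simpa using (hW.intervalIntegrable (t₁ - y) (t₂ - y)).comp_sub_right y),
      intervalIntegral.integral_comp_sub_right, ← mul_sub]
    congr 1
    have e1 := intervalIntegral.integral_add_adjacent_intervals
      (hW.intervalIntegrable (t₁ - y) t₁) (hW.intervalIntegrable t₁ t₂)
    have e2 := intervalIntegral.integral_add_adjacent_intervals
      (hW.intervalIntegrable (t₁ - y) (t₂ - y)) (hW.intervalIntegrable (t₂ - y) t₂)
    linarith
  obtain ⟨i1, e1⟩ := hW.integral_levy_mul_integral hσ₁ hσ₂ h₁
  obtain ⟨i2, e2⟩ := hW.integral_levy_mul_integral hσ₁ hσ₂ (h₁.trans_le h₁₂)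
  constructor
  · rw [intervalIntegrable_iff_integrableOn_Ioc_of_le h₁₂]
    exact hprod.integral_prod_left
  · rw [intervalIntegral.integral_of_le h₁₂]
    have hswap := integral_integral_swap hprod
    simp only [hf] at hswap
    simp only [logOp]
    rw [hswap]
    simp only [hf] at hinner
    simp only [hinner]
    rw [integral_sub i2 i1, e1, e2]

/-- Continuity of `logOp σ W`, by dominated convergence for the small jumps and, after the
substitution `z = s - y`, also for the large ones. -/
theorem Causal.continuousAt_logOp (hσ₁ : 5 / 3 < σ) (hσ₂ : σ < 2) (hW : Causal W) {t : ℝ}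
    (ht : 0 < t) : ContinuousAt (logOp σ W) t := by
  set δ := t / 4 with hδ
  have hδ0 : 0 < δ := by positivity
  have hnhds : Ioo (t / 2) (2 * t) ∈ 𝓝 t := Ioo_mem_nhds (by linarith) (by linarith)
  obtain ⟨C, hC⟩ := hW.exists_bound hσ₁ hσ₂ (half_pos ht) (2 * t)
  obtain ⟨L, hL0, hL⟩ := hW.lip δ (2 * t) hδ0
  have hdecomp : ∀ s ∈ Ioo (t / 2) (2 * t), logOp σ W s =
      (∫ y in Ioc 0 δ, levy σ y * (W s - W (s - y))) + W s * levyTail σ δ -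
        ∫ z, (Ioi δ).indicator (levy σ) (s - z) * W z := by
    intro s hs
    have hi := (hC s ⟨hs.1.le, hs.2.le⟩).1
    have hun : Ioi (0 : ℝ) = Ioc 0 δ ∪ Ioi δ := (Ioc_union_Ioi_eq_Ioi hδ0.le).symm
    have hd : Disjoint (Ioc (0 : ℝ) δ) (Ioi δ) := by
      rw [Set.disjoint_left]; intro x hx hx'; exact absurd hx' (not_lt.2 hx.2)
    rw [hun] at hi
    have hlev := (integrableOn_levy hσ₁ hδ0).mul_const (W s)
    have hi2 : IntegrableOn (fun y => levy σ y * W (s - y)) (Ioi δ) := by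
      refine IntegrableOn.congr_fun (hlev.sub hi.right_of_union) (fun y _ => ?_) measurableSet_Ioi
      simp only [Pi.sub_apply]; ring
    rw [logOp, hun, setIntegral_union hd measurableSet_Ioi hi.left_of_union hi.right_of_union]
    have e : ∫ y in Ioi δ, levy σ y * (W s - W (s - y)) =
        W s * levyTail σ δ - ∫ z, (Ioi δ).indicator (levy σ) (s - z) * W z := by
      rw [← integral_sub_left_eq_self (fun z => (Ioi δ).indicator (levy σ) (s - z) * W z) volume s]
      simp only [mul_sub, sub_sub_cancel]
      rw [integral_sub hlev hi2, integral_mul_const, integral_levy hσ₁ hδ0, mul_comm]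
      congr 1
      rw [← integral_indicator measurableSet_Ioi]
      congr 1
      funext y
      by_cases h : y ∈ Ioi δ
      · rw [indicator_of_mem h, indicator_of_mem h]
      · rw [indicator_of_notMem h, indicator_of_notMem h, zero_mul]
    rw [e]; ring
  have hcW := hW.continuousAt ht
  have c1 : ContinuousAt (fun s => ∫ y in Ioc 0 δ, levy σ y * (W s - W (s - y))) t := by
    refine continuousAt_of_dominated (bound := fun y => L * (y * levy σ y))
      (Eventually.of_forall fun s => ?_) ?_ ((integrableOn_mul_levy hσ₁ hσ₂ δ).const_mul L) ?_
    · exact ((measurable_levy σ).mul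
        (measurable_const.sub (hW.measurable.comp (by fun_prop)))).aestronglyMeasurable
    · filter_upwards [hnhds] with s hs
      refine (ae_restrict_mem measurableSet_Ioc).mono fun y hy => ?_
      have hsy := hL s ⟨by linarith [hs.1], hs.2.le⟩ (s - y)
        ⟨by linarith [hs.1, hy.2], by linarith [hs.2, hy.1]⟩
      rw [sub_sub_cancel, abs_of_pos hy.1] at hsy
      rw [norm_mul, Real.norm_of_nonneg (levy_pos σ hy.1).le, Real.norm_eq_abs]
      have := mul_le_mul_of_nonneg_left hsy (levy_pos σ hy.1).le
      linarith
    · refine (ae_restrict_mem measurableSet_Ioc).mono fun y hy => ?_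
      have h2 : ContinuousAt (fun s => W (s - y)) t :=
        ContinuousAt.comp (f := fun s => s - y) (hW.continuousAt (by linarith [hy.2]))
          (by fun_prop)
      exact continuousAt_const.mul (hcW.sub h2)
  have c2 : ContinuousAt (fun s => ∫ z, (Ioi δ).indicator (levy σ) (s - z) * W z) t := by
    refine continuousAt_of_dominated
      (bound := fun z => levy σ δ * ‖(Iic (2 * t)).indicator W z‖)
      (Eventually.of_forall fun s => ?_) ?_
      ((hW.integrable_indicator (2 * t)).norm.const_mul (levy σ δ)) ?_
    · exact ((((measurable_levy σ).indicator measurableSet_Ioi).comp (by fun_prop)).mul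
        hW.measurable).aestronglyMeasurable
    · filter_upwards [hnhds] with s hs
      refine Eventually.of_forall fun z => ?_
      rw [norm_mul]
      by_cases h : δ < s - z
      · have hz : z ∈ Iic (2 * t) := by simp only [mem_Iic]; linarith [hs.2]
        rw [indicator_of_mem (show s - z ∈ Ioi δ from h), indicator_of_mem hz,
          Real.norm_of_nonneg (levy_pos σ (hδ0.trans h)).le]
        gcongr
        exact levy_anti hσ₁ hδ0 h.le
      · rw [indicator_of_notMem (show s - z ∉ Ioi δ from h), norm_zero, zero_mul]
        exact mul_nonneg (levy_pos σ hδ0).le (norm_nonneg _)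
    · filter_upwards [Measure.ae_ne volume (t - δ)] with z hz
      refine ContinuousAt.mul ?_ continuousAt_const
      rcases lt_or_gt_of_ne hz with h | h
      · have h1 : ContinuousAt (fun s => levy σ (s - z)) t := by
          have hd := (exp_sub_one_pos (show 0 < t - z by linarith)).ne'
          unfold levy
          refine ContinuousAt.mul (by fun_prop) (ContinuousAt.mul ?_ (ContinuousAt.pow ?_ 2))
          · exact ContinuousAt.rpow_const (by fun_prop) (Or.inl hd)
          · exact continuousAt_const.add (ContinuousAt.rpow_const (by fun_prop) (Or.inl hd))
        refine h1.congr ?_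
        filter_upwards [Ioi_mem_nhds (show z + δ < t by linarith)] with s (hs : z + δ < s)
        rw [indicator_of_mem]; simp only [mem_Ioi]; linarith
      · refine (continuousAt_const (y := (0 : ℝ))).congr ?_
        filter_upwards [Iio_mem_nhds (show t < z + δ by linarith)] with s (hs : s < z + δ)
        rw [indicator_of_notMem]; simp only [mem_Ioi]; linarith
  refine ((c1.add (hcW.mul (continuousAt_const (y := levyTail σ δ)))).sub c2).congr ?_
  filter_upwards [hnhds] with s hs
  exact (hdecomp s hs).symm

end LogOp

/-! ### Convolutions on the half-line -/

lemma measurable_of_continuousOn_Ioi {f : ℝ → ℝ} (hf : ContinuousOn f (Ioi 0))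
    (h0 : ∀ t ≤ 0, f t = 0) : Measurable f := by
  classical
  have h := hf.measurable_piecewise (g := fun _ => (0 : ℝ)) continuousOn_const measurableSet_Ioi
  have e : (Ioi (0 : ℝ)).piecewise f (fun _ => 0) = f := by
    funext t
    by_cases ht : t ∈ Ioi (0 : ℝ)
    · rw [piecewise_eq_of_mem _ _ _ ht]
    · rw [piecewise_eq_of_notMem _ _ _ ht, h0 t (not_lt.1 ht)]
  rwa [e] at h

lemma hconv_eq_intervalIntegral (f g : ℝ → ℝ) {t : ℝ} (ht : 0 ≤ t) :
    hconv f g t = ∫ z in (0 : ℝ)..t, f (t - z) * g z := by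
  rw [hconv, intervalIntegral.integral_of_le ht, integral_Ioc_eq_integral_Ioo]

section Convolution

variable {f g : ℝ → ℝ}

lemma Causal.integrableOn_mul (hf : Causal f) (hg : Causal g) (t : ℝ) :
    IntegrableOn (fun z => f (t - z) * g z) (Ioc 0 t) := by
  rcases le_or_gt t 0 with ht | ht
  · simp [Ioc_eq_empty_of_le ht]
  have hmeas : Measurable fun z => f (t - z) * g z :=
    (hf.measurable.comp (by fun_prop)).mul hg.measurable
  have hun : Ioc 0 t = Ioc 0 (t / 2) ∪ Ioc (t / 2) t :=
    (Ioc_union_Ioc_eq_Ioc (by linarith) (by linarith)).symm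
  rw [hun]
  refine IntegrableOn.union ?_ ?_
  · obtain ⟨M, hM0, hM⟩ := hf.bdd (t / 2) t (by linarith)
    refine ((hg.integrableOn (t / 2)).norm.const_mul M).mono' hmeas.aestronglyMeasurable
      ((ae_restrict_mem measurableSet_Ioc).mono fun z hz => ?_)
    rw [norm_mul]
    gcongr
    exact hM _ ⟨by linarith [hz.2], by linarith [hz.1]⟩
  · obtain ⟨M, hM0, hM⟩ := hg.bdd (t / 2) t (by linarith)
    have hT : IntegrableOn (fun z => f (t - z)) (Ioc (t / 2) t) := by
      have h' := ((hf.intervalIntegrable 0 (t / 2)).comp_sub_left t).symm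
      rwa [sub_zero, show t - t / 2 = t / 2 by ring,
        intervalIntegrable_iff_integrableOn_Ioc_of_le (by linarith)] at h'
    refine (hT.norm.const_mul M).mono' hmeas.aestronglyMeasurable
      ((ae_restrict_mem measurableSet_Ioc).mono fun z hz => ?_)
    rw [norm_mul, mul_comm]
    gcongr
    exact hM z ⟨hz.1.le, hz.2⟩

lemma Causal.intervalIntegrable_mul (hf : Causal f) (hg : Causal g) {t a b : ℝ} (ha : 0 ≤ a)
    (hab : a ≤ b) (hb : b ≤ t) : IntervalIntegrable (fun z => f (t - z) * g z) volume a b := by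
  rw [intervalIntegrable_iff_integrableOn_Ioc_of_le hab]
  exact (hf.integrableOn_mul hg t).mono_set (Ioc_subset_Ioc ha hb)

/-- Splitting the convolution at a level `d < t` puts the increments of `t` on the factor that is
evaluated away from `0`. -/
lemma Causal.hconv_split (hf : Causal f) (hg : Causal g) {d t : ℝ} (hd : 0 ≤ d) (ht : d ≤ t) :
    hconv f g t = (∫ z in (0 : ℝ)..d, f (t - z) * g z) +
      ∫ z in (0 : ℝ)..(t - d), g (t - z) * f z := by
  rw [hconv_eq_intervalIntegral f g (hd.trans ht),
    ← intervalIntegral.integral_add_adjacent_intervals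
      (hf.intervalIntegrable_mul hg le_rfl hd ht) (hf.intervalIntegrable_mul hg hd ht le_rfl)]
  congr 1
  have h := intervalIntegral.integral_comp_sub_left (a := d) (b := t)
    (fun z => g (t - z) * f z) t
  rw [sub_self] at h
  rw [← h]
  refine intervalIntegral.integral_congr fun z _ => ?_
  simp only [sub_sub_cancel]
  ring

lemma Causal.exists_lipschitz_hconv (hf : Causal f) (hg : Causal g) {a : ℝ} (c : ℝ) (ha : 0 < a) :
    ∃ L, 0 ≤ L ∧ ∀ x ∈ Icc a c, ∀ y ∈ Icc a c, |hconv f g x - hconv f g y| ≤ L * |x - y| := by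
  set d := a / 2 with hd
  have hd0 : 0 < d := by positivity
  obtain ⟨Lf, hLf0, hLf⟩ := hf.lip d c hd0
  obtain ⟨Lg, hLg0, hLg⟩ := hg.lip d c hd0
  obtain ⟨Mf, hMf0, hMf⟩ := hf.bdd d c hd0
  obtain ⟨Mg, hMg0, hMg⟩ := hg.bdd d c hd0
  set If := ∫ z in Ioc 0 c, ‖f z‖ with hIf
  set Ig := ∫ z in Ioc 0 c, ‖g z‖ with hIg
  have hIf0 : 0 ≤ If := integral_nonneg fun _ => norm_nonneg _
  have hIg0 : 0 ≤ Ig := integral_nonneg fun _ => norm_nonneg _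
  have hle : ∀ {h : ℝ → ℝ}, Causal h → ∀ e, 0 ≤ e → e ≤ c →
      ∫ z in (0 : ℝ)..e, ‖h z‖ ≤ ∫ z in Ioc 0 c, ‖h z‖ := by
    intro h hh e he0 hec
    rw [intervalIntegral.integral_of_le he0]
    exact setIntegral_mono_set (hh.integrableOn c).norm
      (Eventually.of_forall fun _ => norm_nonneg _) (Ioc_subset_Ioc_right hec).eventuallyLE
  refine ⟨Lf * Ig + (Lg * If + Mg * Mf), by positivity, ?_⟩
  have key : ∀ x ∈ Icc a c, ∀ y ∈ Icc a c, x ≤ y →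
      |hconv f g y - hconv f g x| ≤ (Lf * Ig + (Lg * If + Mg * Mf)) * (y - x) := by
    intro x hx y hy hxy
    have hdx : d ≤ x := by linarith [hx.1]
    have hdy : d ≤ y := by linarith [hy.1]
    rw [hf.hconv_split hg hd0.le hdx, hf.hconv_split hg hd0.le hdy,
      ← intervalIntegral.integral_add_adjacent_intervals (a := 0) (b := x - d) (c := y - d)
        (hg.intervalIntegrable_mul hf le_rfl (by linarith) (by linarith))
        (hg.intervalIntegrable_mul hf (by linarith) (by linarith) (by linarith))]
    have e1 : |(∫ z in (0 : ℝ)..d, f (y - z) * g z) - ∫ z in (0 : ℝ)..d, f (x - z) * g z| ≤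
        Lf * Ig * (y - x) := by
      rw [← intervalIntegral.integral_sub (hf.intervalIntegrable_mul hg le_rfl hd0.le hdy)
        (hf.intervalIntegrable_mul hg le_rfl hd0.le hdx)]
      have h := intervalIntegral.norm_integral_le_of_norm_le (a := 0) (b := d) (μ := volume)
        (f := fun z => f (y - z) * g z - f (x - z) * g z)
        (g := fun z => Lf * (y - x) * ‖g z‖) hd0.le
        (Eventually.of_forall fun z hz => ?_) ((hg.intervalIntegrable 0 d).norm.const_mul _)
      · rw [Real.norm_eq_abs] at h
        refine h.trans ?_
        rw [intervalIntegral.integral_const_mul]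
        have h2 := mul_le_mul_of_nonneg_left (hle hg d hd0.le (by linarith [hx.2]))
          (mul_nonneg hLf0 (sub_nonneg.2 hxy))
        linarith
      · rw [← sub_mul, norm_mul, Real.norm_eq_abs]
        have h2 := hLf (y - z) ⟨by linarith [hz.2, hy.1], by linarith [hz.1, hy.2]⟩ (x - z)
          ⟨by linarith [hz.2, hx.1], by linarith [hz.1, hx.2]⟩
        rw [show y - z - (x - z) = y - x by ring, abs_of_nonneg (sub_nonneg.2 hxy)] at h2
        gcongr
    have e2 : |(∫ z in (0 : ℝ)..(x - d), g (y - z) * f z) -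
        ∫ z in (0 : ℝ)..(x - d), g (x - z) * f z| ≤ Lg * If * (y - x) := by
      rw [← intervalIntegral.integral_sub
        (hg.intervalIntegrable_mul hf le_rfl (by linarith) (by linarith))
        (hg.intervalIntegrable_mul hf le_rfl (by linarith) (by linarith))]
      have h := intervalIntegral.norm_integral_le_of_norm_le (a := 0) (b := x - d) (μ := volume)
        (f := fun z => g (y - z) * f z - g (x - z) * f z)
        (g := fun z => Lg * (y - x) * ‖f z‖) (by linarith)
        (Eventually.of_forall fun z hz => ?_) ((hf.intervalIntegrable 0 _).norm.const_mul _)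
      · rw [Real.norm_eq_abs] at h
        refine h.trans ?_
        rw [intervalIntegral.integral_const_mul]
        have h2 := mul_le_mul_of_nonneg_left
          (hle hf (x - d) (by linarith) (by linarith [hx.2]))
          (mul_nonneg hLg0 (sub_nonneg.2 hxy))
        linarith
      · rw [← sub_mul, norm_mul, Real.norm_eq_abs]
        have h2 := hLg (y - z) ⟨by linarith [hz.2], by linarith [hz.1, hy.2]⟩ (x - z)
          ⟨by linarith [hz.2], by linarith [hz.1, hx.2]⟩
        rw [show y - z - (x - z) = y - x by ring, abs_of_nonneg (sub_nonneg.2 hxy)] at h2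
        gcongr
    have e3 : |∫ z in (x - d)..(y - d), g (y - z) * f z| ≤ Mg * Mf * (y - x) := by
      have h := intervalIntegral.norm_integral_le_of_norm_le_const (a := x - d) (b := y - d)
        (f := fun z => g (y - z) * f z) (C := Mg * Mf) (fun z hz => ?_)
      · rwa [Real.norm_eq_abs, show y - d - (x - d) = y - x by ring,
          abs_of_nonneg (sub_nonneg.2 hxy)] at h
      · rw [uIoc_of_le (by linarith)] at hz
        rw [norm_mul]
        exact mul_le_mul (hMg _ ⟨by linarith [hz.2], by linarith [hz.1, hx.1, hy.2]⟩)
          (hMf _ ⟨by linarith [hz.1, hx.1], by linarith [hz.2, hy.2]⟩) (abs_nonneg _) hMg0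
    calc _ = |((∫ z in (0 : ℝ)..d, f (y - z) * g z) - ∫ z in (0 : ℝ)..d, f (x - z) * g z) +
          ((∫ z in (0 : ℝ)..(x - d), g (y - z) * f z) -
            ∫ z in (0 : ℝ)..(x - d), g (x - z) * f z) +
          ∫ z in (x - d)..(y - d), g (y - z) * f z| := by congr 1; ring
      _ ≤ Lf * Ig * (y - x) + Lg * If * (y - x) + Mg * Mf * (y - x) :=
          (abs_add_le _ _).trans (add_le_add ((abs_add_le _ _).trans (add_le_add e1 e2)) e3)
      _ = _ := by ring
  intro x hx y hy
  rcases le_total x y with h | h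
  · rw [abs_sub_comm, abs_sub_comm x y, abs_of_nonneg (sub_nonneg.2 h)]
    exact key x hx y hy h
  · rw [abs_of_nonneg (sub_nonneg.2 h)]
    exact key y hy x hx h

theorem Causal.causal_hconv (hf : Causal f) (hg : Causal g) : Causal (hconv f g) := by
  have hzero : ∀ t ≤ 0, hconv f g t = 0 := fun t ht => by
    simp [hconv, Ioo_eq_empty_of_le ht]
  have hcont : ContinuousOn (hconv f g) (Ioi 0) := by
    intro t (ht : 0 < t)
    obtain ⟨L, hL0, hL⟩ := hf.exists_lipschitz_hconv hg (t + 1) (half_pos ht)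
    have hL' : LipschitzOnWith ⟨L, hL0⟩ (hconv f g) (Icc (t / 2) (t + 1)) :=
      LipschitzOnWith.of_dist_le_mul fun x hx y hy => hL x hx y hy
    exact (hL'.continuousOn.continuousAt
      (Icc_mem_nhds (by linarith) (by linarith))).continuousWithinAt
  refine ⟨measurable_of_continuousOn_Ioi hcont hzero, hzero, fun c => ?_,
    fun a c ha => hf.exists_lipschitz_hconv hg c ha⟩
  have h := (hg.integrable_indicator c).integrable_convolution (ContinuousLinearMap.mul ℝ ℝ)
    (hf.integrable_indicator c)
  refine IntegrableOn.congr_fun h.integrableOn (fun t ht => ?_) measurableSet_Ioc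
  rw [convolution_def, hconv, ← integral_indicator measurableSet_Ioo]
  congr 1
  funext z
  simp only [ContinuousLinearMap.mul_apply']
  by_cases hz : z ∈ Ioo 0 t
  · have h1 : z ∈ Iic c := hz.2.le.trans ht.2
    have h2 : t - z ∈ Iic c := by simp only [mem_Iic]; linarith [hz.1, ht.2]
    rw [indicator_of_mem hz, indicator_of_mem h1, indicator_of_mem h2, mul_comm]
  · rw [indicator_of_notMem hz]
    rcases le_or_gt z 0 with h | h
    · simp [indicator, hg.zero z h]
    · have : t - z ≤ 0 := by
        by_contra! h'
        exact hz ⟨h, by linarith⟩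
      simp [indicator, hf.zero _ this]

/-- If the convolution of the Lévy tail with `U ≥ 0` is `1`, then `logOp σ` inverts the
convolution with `U`. -/
theorem Causal.hconv_levyTail_hconv {σ : ℝ} {U h : ℝ → ℝ} (hσ₁ : 5 / 3 < σ) (hσ₂ : σ < 2)
    (hU : Causal U) (hU0 : ∀ t, 0 ≤ U t) (hUT : ∀ t > 0, hconv (levyTail σ) U t = 1)
    (hh : Causal h) {t : ℝ} (ht : 0 < t) :
    hconv (levyTail σ) (hconv U h) t = ∫ z in (0 : ℝ)..t, h z := by
  -- Fubini is associativity of the convolution: `levyTail * (U * h) = (levyTail * U) * h = 1 * h`.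
  set k : ℝ → ℝ → ℝ := fun z s => levyTail σ (t - s) * U (s - z) * h z with hk
  have hkm : Measurable (Function.uncurry k) :=
    (((measurable_levyTail σ).comp (by fun_prop)).mul (hU.measurable.comp (by fun_prop))).mul
      (hh.measurable.comp measurable_fst)
  have hshift : ∀ z ∈ Ioo 0 t,
      IntegrableOn (fun s => levyTail σ (t - s) * U (s - z)) (Ioo 0 t) ∧
      ∫ s in Ioo 0 t, levyTail σ (t - s) * U (s - z) = 1 := by
    intro z hz
    set q : ℝ → ℝ := (Ioo 0 (t - z)).indicator fun s => levyTail σ (t - z - s) * U s with hq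
    have hqi : Integrable q := (integrable_indicator_iff measurableSet_Ioo).2
      (hU.integrableOn_levyTail_mul hσ₁ hσ₂ (by linarith [hz.2]))
    have e : ∀ s ∈ Ioo 0 t, q (s - z) = levyTail σ (t - s) * U (s - z) := by
      intro s hs
      by_cases h : s - z ∈ Ioo 0 (t - z)
      · rw [hq, indicator_of_mem h, show t - z - (s - z) = t - s by ring]
      · have : s - z ≤ 0 := by
          by_contra! h'
          exact h ⟨h', by linarith [hs.2]⟩
        rw [hq, indicator_of_notMem h, hU.zero _ this, mul_zero]
    constructor
    · exact IntegrableOn.congr_fun (hqi.comp_sub_right z).integrableOn e measurableSet_Ioo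
    · rw [← setIntegral_congr_fun measurableSet_Ioo e,
        setIntegral_eq_integral_of_forall_compl_eq_zero,
        integral_sub_right_eq_self, integral_indicator measurableSet_Ioo]
      · exact hUT _ (by linarith [hz.2])
      · intro s hs
        rw [hq, indicator_of_notMem]
        exact fun h => hs ⟨by linarith [h.1, hz.1], by linarith [h.2]⟩
  have hprod : Integrable (Function.uncurry k)
      ((volume.restrict (Ioo 0 t)).prod (volume.restrict (Ioo 0 t))) := by
    rw [integrable_prod_iff hkm.aestronglyMeasurable]
    refine ⟨(ae_restrict_mem measurableSet_Ioo).mono fun z hz =>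
      (hshift z hz).1.mul_const (h z), ?_⟩
    refine IntegrableOn.congr_fun
      ((hh.integrableOn t).mono_set Ioo_subset_Ioc_self).norm (fun z hz => ?_) measurableSet_Ioo
    have e : ∀ s ∈ Ioo 0 t, ‖Function.uncurry k (z, s)‖ =
        levyTail σ (t - s) * U (s - z) * ‖h z‖ := by
      intro s hs
      simp only [Function.uncurry, hk]
      rw [norm_mul, Real.norm_of_nonneg
        (mul_nonneg (levyTail_nonneg hσ₁ (by linarith [hs.2])) (hU0 _))]
    rw [setIntegral_congr_fun measurableSet_Ioo e, integral_mul_const, (hshift z hz).2, one_mul]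
  have hswap := integral_integral_swap hprod
  have eL : ∀ z ∈ Ioo 0 t, ∫ s in Ioo 0 t, k z s = h z := by
    intro z hz
    simp only [hk]
    rw [integral_mul_const, (hshift z hz).2, one_mul]
  have eR : ∀ s ∈ Ioo 0 t, ∫ z in Ioo 0 t, k z s =
      levyTail σ (t - s) * hconv U h s := by
    intro s hs
    simp only [hk, mul_assoc]
    rw [integral_const_mul, hconv]
    congr 1
    refine setIntegral_eq_of_subset_of_forall_sdiff_eq_zero measurableSet_Ioo
      (Ioo_subset_Ioo_right hs.2.le) (fun z hz => ?_)
    have : s - z ≤ 0 := by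
      by_contra! h'
      exact hz.2 ⟨hz.1.1, by linarith⟩
    rw [hU.zero _ this, zero_mul]
  rw [setIntegral_congr_fun measurableSet_Ioo eL, setIntegral_congr_fun measurableSet_Ioo eR]
    at hswap
  rw [intervalIntegral.integral_of_le ht.le, integral_Ioc_eq_integral_Ioo, hswap]
  rfl

theorem Causal.logOp_hconv {σ : ℝ} {U h : ℝ → ℝ} (hσ₁ : 5 / 3 < σ) (hσ₂ : σ < 2)
    (hU : Causal U) (hU0 : ∀ t, 0 ≤ U t) (hUT : ∀ t > 0, hconv (levyTail σ) U t = 1)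
    (hh : Causal h) {t : ℝ} (ht : 0 < t) : logOp σ (hconv U h) t = h t := by
  have hW := hU.causal_hconv hh
  have hcont : ContinuousOn (logOp σ (hconv U h)) (Ioi 0) := fun s hs =>
    (hW.continuousAt_logOp hσ₁ hσ₂ hs).continuousWithinAt
  have hcont' : ContinuousOn h (Ioi 0) := fun s hs => (hh.continuousAt hs).continuousWithinAt
  have hlt : t / 2 < t := by linarith
  have d1 := intervalIntegral.integral_hasDerivAt_right
    (hW.integral_logOp hσ₁ hσ₂ (half_pos ht) hlt.le).1
    (hcont.stronglyMeasurableAtFilter isOpen_Ioi t ht) (hW.continuousAt_logOp hσ₁ hσ₂ ht)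
  have d2 := intervalIntegral.integral_hasDerivAt_right (hh.intervalIntegrable (t / 2) t)
    (hcont'.stronglyMeasurableAtFilter isOpen_Ioi t ht) (hh.continuousAt ht)
  -- Both sides are derivatives at `t` of `s ↦ ∫_{t/2}^s h`.
  refine d1.unique (d2.congr_of_eventuallyEq ?_)
  filter_upwards [Ioi_mem_nhds hlt] with s (hs : t / 2 < s)
  rw [(hW.integral_logOp hσ₁ hσ₂ (half_pos ht) hs.le).2,
    hU.hconv_levyTail_hconv hσ₁ hσ₂ hU0 hUT hh (by linarith),
    hU.hconv_levyTail_hconv hσ₁ hσ₂ hU0 hUT hh (half_pos ht)]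
  have := intervalIntegral.integral_add_adjacent_intervals (hh.intervalIntegrable 0 (t / 2))
    (hh.intervalIntegrable (t / 2) s)
  linarith

end Convolution

/-! ### The potential density -/

/-- The fundamental solution with pole at `1`, in the coordinate `t = log (1 / V)`: the potential
density of the subordinator with Lévy density `levy σ`. -/
def potential (σ : ℝ) (F : ℝ → ℝ) (t : ℝ) : ℝ := cStar σ * profile σ F (Real.exp (-t))

lemma one_sub_exp_neg_mem {t : ℝ} (ht : 0 < t) : 1 - Real.exp (-t) ∈ Ioo (0 : ℝ) 1 := by
  have h1 : Real.exp (-t) < 1 := by simpa using ht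
  have h2 := Real.exp_pos (-t)
  exact ⟨by linarith, by linarith⟩

lemma exp_neg_mem {t : ℝ} (ht : 0 < t) : Real.exp (-t) ∈ Ioo (0 : ℝ) 1 :=
  ⟨Real.exp_pos _, by simpa using ht⟩

lemma potential_of_nonpos (σ : ℝ) (F : ℝ → ℝ) {t : ℝ} (ht : t ≤ 0) : potential σ F t = 0 := by
  have : 1 ≤ Real.exp (-t) := Real.one_le_exp (by linarith)
  rw [potential, profile, powPos_of_nonpos (by linarith), zero_mul, mul_zero]

lemma potential_of_pos (σ : ℝ) (F : ℝ → ℝ) {t : ℝ} (ht : 0 < t) : potential σ F t =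
    cStar σ * ((1 - Real.exp (-t)) ^ (σ - 2) * F ((1 - Real.exp (-t)) ^ (1 / 3 : ℝ))) := by
  rw [potential, profile, powPos_of_pos (one_sub_exp_neg_mem ht).1]

/-- The fundamental solution `G(V, V₀)`, obtained from the one with pole at `1` by scaling. -/
def green (σ : ℝ) (F : ℝ → ℝ) (V V₀ : ℝ) : ℝ :=
  V₀ ^ (σ - 8 / 3) * (cStar σ * profile σ F (V / V₀))

lemma green_eq_potential (σ : ℝ) (F : ℝ → ℝ) {V V₀ : ℝ} (hV : 0 < V) (hV₀ : 0 < V₀) :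
    green σ F V V₀ = V₀ ^ (σ - 8 / 3) * potential σ F (Real.log (V₀ / V)) := by
  rw [green, potential, Real.exp_neg, Real.exp_log (div_pos hV₀ hV), inv_div]

lemma green_of_lt (σ : ℝ) (F : ℝ → ℝ) {V V₀ : ℝ} (hV₀ : 0 < V₀) (h : V < V₀) :
    green σ F V V₀ = cStar σ * V₀ ^ (-(2 / 3) : ℝ) * (V₀ - V) ^ (σ - 2) *
      F ((1 - V / V₀) ^ (1 / 3 : ℝ)) := by
  have h1 : 0 < 1 - V / V₀ := by
    have := (div_lt_one hV₀).2 h; linarith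
  have e : 1 - V / V₀ = (V₀ - V) / V₀ := by field_simp
  have e2 : V₀ ^ (-(2 / 3) : ℝ) = V₀ ^ (σ - 8 / 3) * (V₀ ^ (σ - 2))⁻¹ := by
    rw [← Real.rpow_neg hV₀.le, ← Real.rpow_add hV₀]; congr 1; ring
  rw [green, profile, powPos_of_pos h1, e2]
  nth_rewrite 1 [e]
  rw [Real.div_rpow (by linarith) hV₀.le]
  ring

lemma green_of_ge (σ : ℝ) (F : ℝ → ℝ) {V V₀ : ℝ} (hV₀ : 0 < V₀) (h : V₀ ≤ V) :
    green σ F V V₀ = 0 := by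
  have : 1 - V / V₀ ≤ 0 := by
    have := (one_le_div hV₀).2 h; linarith
  rw [green, profile, powPos_of_nonpos this]; ring

namespace IsProfile

variable {σ : ℝ} {F : ℝ → ℝ}

lemma potential_nonneg (hF : IsProfile σ F) (hσ₁ : 5 / 3 < σ) (hσ₂ : σ < 2) (t : ℝ) :
    0 ≤ potential σ F t := by
  rcases le_or_gt t 0 with ht | ht
  · rw [potential_of_nonpos σ F ht]
  · rw [potential_of_pos σ F ht]
    have h1 := cbrt_mem (exp_neg_mem ht)
    have h2 := one_sub_exp_neg_mem ht
    exact mul_nonneg (cStar_pos (by linarith) hσ₂).le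
      (mul_nonneg (Real.rpow_nonneg h2.1.le _) (hF.pos h1).le)

/-- On bounded intervals the potential density is dominated by its leading power at `0`. -/
lemma exists_potential_le (hF : IsProfile σ F) (hσ₁ : 5 / 3 < σ) (hσ₂ : σ < 2) (c : ℝ) :
    ∃ C, 0 ≤ C ∧ ∀ t ∈ Ioc 0 c, potential σ F t ≤ C * t ^ (σ - 2) := by
  have hc := (cStar_pos (by linarith : 1 < σ) hσ₂).le
  refine ⟨cStar σ * Real.exp (-c) ^ (σ - 2), by positivity, fun t ht => ?_⟩
  have h1 := cbrt_mem (exp_neg_mem ht.1)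
  have h2 := one_sub_exp_neg_mem ht.1
  have h3 : Real.exp (-c) * t ≤ 1 - Real.exp (-t) := by
    have e1 : Real.exp (-c) ≤ Real.exp (-t) := Real.exp_le_exp.2 (by linarith [ht.2])
    have e2 : t + 1 ≤ Real.exp t := Real.add_one_le_exp t
    have e3 : Real.exp (-t) * Real.exp t = 1 := by rw [← Real.exp_add]; simp
    have e4 := Real.exp_pos (-t)
    nlinarith [ht.1]
  have h4 : (1 - Real.exp (-t)) ^ (σ - 2) ≤ (Real.exp (-c) * t) ^ (σ - 2) :=
    Real.rpow_le_rpow_of_nonpos (mul_pos (Real.exp_pos _) ht.1) h3 (by linarith)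
  rw [Real.mul_rpow (Real.exp_pos _).le ht.1.le] at h4
  rw [potential_of_pos σ F ht.1, mul_assoc]
  refine mul_le_mul_of_nonneg_left ?_ hc
  calc (1 - Real.exp (-t)) ^ (σ - 2) * F ((1 - Real.exp (-t)) ^ (1 / 3 : ℝ))
      ≤ (1 - Real.exp (-t)) ^ (σ - 2) * 1 := by
        have := Real.rpow_nonneg h2.1.le (σ - 2)
        gcongr
        exact hF.le_one hσ₁ hσ₂ h1
    _ ≤ _ := by rw [mul_one]; exact h4

lemma contDiffOn_potential (hF : IsProfile σ F) : ContDiffOn ℝ 1 (potential σ F) (Ioi 0) := by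
  intro t ht
  have h1 : AnalyticAt ℝ (fun t : ℝ => Real.exp (-t)) t := analyticAt_id.neg.rexp'
  have h2 := AnalyticAt.comp (f := fun t : ℝ => Real.exp (-t)) (x := t)
    (hF.analyticAt_profile (exp_neg_mem ht)) h1
  have h3 : AnalyticAt ℝ (potential σ F) t := analyticAt_const.mul h2
  exact h3.contDiffAt.contDiffWithinAt

lemma causal_potential (hF : IsProfile σ F) (hσ₁ : 5 / 3 < σ) (hσ₂ : σ < 2) :
    Causal (potential σ F) where
  measurable := measurable_of_continuousOn_Ioi hF.contDiffOn_potential.continuousOn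
    fun _ => potential_of_nonpos σ F
  zero _ := potential_of_nonpos σ F
  integrableOn c := by
    obtain ⟨C, hC0, hC⟩ := hF.exists_potential_le hσ₁ hσ₂ c
    have hmeas : Measurable (potential σ F) :=
      measurable_of_continuousOn_Ioi hF.contDiffOn_potential.continuousOn
        fun _ => potential_of_nonpos σ F
    have h1 : IntegrableOn (fun y : ℝ => C * y ^ (σ - 2)) (Ioc 0 c) := by
      rcases le_or_gt c 0 with h | h
      · simp [Ioc_eq_empty_of_le h]
      have := (intervalIntegral.intervalIntegrable_rpow' (a := 0) (b := c) (r := σ - 2)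
        (by linarith)).1
      exact this.const_mul C
    refine h1.mono' hmeas.aestronglyMeasurable
      ((ae_restrict_mem measurableSet_Ioc).mono fun t ht => ?_)
    rw [Real.norm_of_nonneg (hF.potential_nonneg hσ₁ hσ₂ t)]
    exact hC t ht
  lip a c ha := by
    obtain ⟨K, hK⟩ := (hF.contDiffOn_potential.mono
      fun x (hx : x ∈ Icc a c) => ha.trans_le hx.1).exists_lipschitzOnWith one_ne_zero
      (convex_Icc _ _) isCompact_Icc
    exact ⟨K, K.2, fun x hx y hy => hK.dist_le_mul x hx y hy⟩

lemma log_equation (hF : IsProfile σ F) {t : ℝ} (ht : 0 < t) :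
    IntegrableOn (fun y => levy σ y * (potential σ F t - potential σ F (t - y))) (Ioi 0) ∧
      logOp σ (potential σ F) t = 0 := by
  have h := (solvesOn_iff_log one_pos (Φ := potential σ F) (fun x hx => by
    rw [potential, Real.exp_neg, Real.exp_log (by positivity), inv_div, div_one])).1
    (hF.equation.const_mul (cStar σ)) t ht
  simpa using h

lemma tendsto_potential_mul_rpow (hF : IsProfile σ F) :
    Tendsto (fun t => potential σ F t * t ^ (2 - σ)) (𝓝[>] 0) (𝓝 (cStar σ)) := by
  have hq : Tendsto (fun t : ℝ => (1 - Real.exp (-t)) / t) (𝓝[>] 0) (𝓝 1) := by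
    have hd : HasDerivAt (fun t : ℝ => 1 - Real.exp (-t)) 1 0 := by
      have h1 := ((hasDerivAt_id (0 : ℝ)).neg.exp).const_sub 1
      simpa using h1
    have h := hd.tendsto_slope_zero_right
    simpa [smul_eq_mul, div_eq_inv_mul] using h
  have hs : Tendsto (fun t : ℝ => (1 - Real.exp (-t)) ^ (1 / 3 : ℝ)) (𝓝[>] 0) (𝓝 0) := by
    have h : ContinuousAt (fun t : ℝ => (1 - Real.exp (-t)) ^ (1 / 3 : ℝ)) 0 :=
      ContinuousAt.rpow_const (by fun_prop) (Or.inr (by norm_num))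
    have := h.tendsto
    simp only [neg_zero, Real.exp_zero, sub_self,
      Real.zero_rpow (by norm_num : (1 / 3 : ℝ) ≠ 0)] at this
    exact this.mono_left nhdsWithin_le_nhds
  have h := ((hq.rpow_const (p := σ - 2) (Or.inl one_ne_zero)).mul
    (hF.tendsto_one.comp hs)).const_mul (cStar σ)
  simp only [Real.one_rpow, mul_one] at h
  refine h.congr' ?_
  filter_upwards [self_mem_nhdsWithin] with t (ht : 0 < t)
  have h2 := one_sub_exp_neg_mem ht
  rw [potential_of_pos σ F ht, Real.div_rpow h2.1.le ht.le,
    show 2 - σ = -(σ - 2) by ring, Real.rpow_neg ht.le, Function.comp_apply]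
  ring

/-- Near `0` both factors of the convolution are close to powers, whose convolution is a Beta
integral; the constant `C_*` makes the limit `1`. -/
lemma tendsto_hconv_levyTail_potential (hF : IsProfile σ F) (hσ₁ : 5 / 3 < σ) (hσ₂ : σ < 2) :
    Tendsto (hconv (levyTail σ) (potential σ F)) (𝓝[>] 0) (𝓝 1) := by
  have hU := hF.causal_potential hσ₁ hσ₂
  obtain ⟨CT, hCT0, hCT⟩ := exists_levyTail_le hσ₁ 1
  obtain ⟨CU, hCU0, hCU⟩ := hF.exists_potential_le hσ₁ hσ₂ 1
  have hscale : ∀ t > 0, hconv (levyTail σ) (potential σ F) t =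
      ∫ s in Ioo (0 : ℝ) 1, t * (levyTail σ (t * (1 - s)) * potential σ F (t * s)) := by
    intro t ht
    rw [hconv_eq_intervalIntegral _ _ ht.le, ← integral_Ioc_eq_integral_Ioo,
      ← intervalIntegral.integral_of_le zero_le_one, intervalIntegral.integral_const_mul]
    have h := intervalIntegral.integral_comp_mul_left (a := 0) (b := 1)
      (fun z => levyTail σ (t - z) * potential σ F z) ht.ne'
    rw [mul_zero, mul_one, smul_eq_mul] at h
    rw [eq_inv_mul_iff_mul_eq₀ ht.ne'] at h
    rw [← h]
    simp only [mul_sub, mul_one]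
  have hpow : ∀ t > 0, ∀ s ∈ Ioo (0 : ℝ) 1,
      t * ((t * (1 - s)) ^ (1 - σ) * (t * s) ^ (σ - 2)) = s ^ (σ - 2) * (1 - s) ^ (1 - σ) := by
    intro t ht s hs
    rw [Real.mul_rpow ht.le (by linarith [hs.2]), Real.mul_rpow ht.le hs.1.le]
    have : t * (t ^ (1 - σ) * t ^ (σ - 2)) = 1 := by
      rw [← Real.rpow_add ht, show 1 - σ + (σ - 2) = -1 by ring, Real.rpow_neg_one,
        mul_inv_cancel₀ ht.ne']
    linear_combination (s ^ (σ - 2) * (1 - s) ^ (1 - σ)) * this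
  have hlim : Tendsto (fun t : ℝ => ∫ s in Ioo (0 : ℝ) 1,
      t * (levyTail σ (t * (1 - s)) * potential σ F (t * s))) (𝓝[>] 0)
      (𝓝 (∫ s in Ioo (0 : ℝ) 1, 1 / (σ - 1) * cStar σ * (s ^ (σ - 2) * (1 - s) ^ (1 - σ)))) := by
    refine tendsto_integral_filter_of_dominated_convergence
      (fun s => CT * CU * (s ^ (σ - 2) * (1 - s) ^ (1 - σ))) ?_ ?_
      ((integrableOn_beta (by linarith) hσ₂).const_mul _) ?_
    · refine Eventually.of_forall fun t => Measurable.aestronglyMeasurable ?_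
      exact measurable_const.mul (((measurable_levyTail σ).comp (by fun_prop)).mul
        (hU.measurable.comp (by fun_prop)))
    · filter_upwards [Ioc_mem_nhdsGT one_pos] with t ht
      refine (ae_restrict_mem measurableSet_Ioo).mono fun s hs => ?_
      have p1 : 0 < t * (1 - s) := mul_pos ht.1 (by linarith [hs.2])
      have p2 : 0 < t * s := mul_pos ht.1 hs.1
      have q1 := levyTail_nonneg hσ₁ p1
      have q2 := hF.potential_nonneg hσ₁ hσ₂ (t * s)
      have b1 := hCT (t * (1 - s)) ⟨p1, by nlinarith [ht.1, ht.2, hs.1, hs.2]⟩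
      have b2 := hCU (t * s) ⟨p2, by nlinarith [ht.1, ht.2, hs.1, hs.2]⟩
      rw [Real.norm_of_nonneg (mul_nonneg ht.1.le (mul_nonneg q1 q2)), ← hpow t ht.1 s hs]
      calc t * (levyTail σ (t * (1 - s)) * potential σ F (t * s))
          ≤ t * ((CT * (t * (1 - s)) ^ (1 - σ)) * (CU * (t * s) ^ (σ - 2))) := by
            have := ht.1.le
            have : 0 ≤ (t * (1 - s)) ^ (1 - σ) := Real.rpow_nonneg p1.le _
            gcongr
        _ = _ := by ring
    · refine (ae_restrict_mem measurableSet_Ioo).mono fun s hs => ?_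
      have hto : ∀ c : ℝ, 0 < c → Tendsto (fun t : ℝ => t * c) (𝓝[>] 0) (𝓝[>] 0) := by
        intro c hc
        refine tendsto_nhdsWithin_iff.2 ⟨?_, ?_⟩
        · have : Tendsto (fun t : ℝ => t * c) (𝓝 0) (𝓝 (0 * c)) := tendsto_id.mul_const c
          rw [zero_mul] at this
          exact this.mono_left nhdsWithin_le_nhds
        · filter_upwards [self_mem_nhdsWithin] with t (ht : 0 < t)
          exact mul_pos ht hc
      have h1 := (tendsto_levyTail_mul_rpow (σ := σ)).comp (hto (1 - s) (by linarith [hs.2]))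
      have h2 := hF.tendsto_potential_mul_rpow.comp (hto s hs.1)
      refine ((h1.mul h2).mul_const (s ^ (σ - 2) * (1 - s) ^ (1 - σ))).congr' ?_
      filter_upwards [self_mem_nhdsWithin] with t (ht : 0 < t)
      have p1 : 0 < t * (1 - s) := mul_pos ht (by linarith [hs.2])
      have p2 : 0 < t * s := mul_pos ht hs.1
      simp only [Function.comp_apply]
      rw [← hpow t ht s hs, show 1 - σ = -(σ - 1) by ring, show σ - 2 = -(2 - σ) by ring,
        Real.rpow_neg p1.le, Real.rpow_neg p2.le]
      have n1 := (Real.rpow_pos_of_pos p1 (σ - 1)).ne'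
      have n2 := (Real.rpow_pos_of_pos p2 (2 - σ)).ne'
      field_simp
  have hone : ∫ s in Ioo (0 : ℝ) 1, 1 / (σ - 1) * cStar σ * (s ^ (σ - 2) * (1 - s) ^ (1 - σ)) =
      1 := by
    rw [integral_const_mul, cStar_eq (by linarith)]
    have h1 := (integral_beta_pos (by linarith : 1 < σ) hσ₂).ne'
    have h2 : σ - 1 ≠ 0 := by linarith
    field_simp
  rw [hone] at hlim
  refine hlim.congr' ?_
  filter_upwards [self_mem_nhdsWithin] with t ht
  exact (hscale t ht).symm

/-- The convolution of the Lévy tail with the potential density is constant since its derivative is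
`logOp σ (potential σ F) = 0`. -/
theorem hconv_levyTail_potential (hF : IsProfile σ F) (hσ₁ : 5 / 3 < σ) (hσ₂ : σ < 2) {t : ℝ}
    (ht : 0 < t) : hconv (levyTail σ) (potential σ F) t = 1 := by
  -- Constancy on `(0, t]` and the limit at `0` give the value.
  have hconst : ∀ s ∈ Ioc 0 t, hconv (levyTail σ) (potential σ F) s =
      hconv (levyTail σ) (potential σ F) t := by
    intro s hs
    have h := ((hF.causal_potential hσ₁ hσ₂).integral_logOp hσ₁ hσ₂ hs.1 hs.2).2
    rw [intervalIntegral.integral_congr (g := fun _ => (0 : ℝ)),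
      intervalIntegral.integral_zero] at h
    · linarith
    · intro x hx
      rw [uIcc_of_le hs.2] at hx
      exact (hF.log_equation (hs.1.trans_le hx.1)).2
  have h1 : Tendsto (hconv (levyTail σ) (potential σ F)) (𝓝[>] 0)
      (𝓝 (hconv (levyTail σ) (potential σ F) t)) := by
    refine tendsto_const_nhds.congr' ?_
    filter_upwards [Ioc_mem_nhdsGT ht] with s hs
    exact (hconst s hs).symm
  exact tendsto_nhds_unique h1 (hF.tendsto_hconv_levyTail_potential hσ₁ hσ₂)

/-! ### The fundamental solution -/

theorem isFundamentalSolution (hF : IsProfile σ F) (hσ₁ : 5 / 3 < σ) (hσ₂ : σ < 2) :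
    IsFundamentalSolution σ (green σ F) where
  analytic V₀ hV₀ V hV := by
    have h1 : AnalyticAt ℝ (fun V : ℝ => V / V₀) V := analyticAt_id.div_const
    have h2 := AnalyticAt.comp (f := fun V : ℝ => V / V₀) (x := V)
      (hF.analyticAt_profile (V := V / V₀) ⟨div_pos hV.1 hV₀, (div_lt_one hV₀).2 hV.2⟩) h1
    exact analyticAt_const.mul (analyticAt_const.mul h2)
  vanish V₀ hV₀ V hV := green_of_ge σ F hV₀ (le_of_lt hV)
  equation V₀ hV₀ := by
    -- In the coordinate `log (V₀ / V)` the equation no longer involves `V₀`.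
    have h : SolvesOn σ V₀ (fun V => cStar σ * profile σ F (V / V₀)) fun _ => 0 := by
      refine (solvesOn_iff_log hV₀ (Φ := potential σ F) fun x hx => ?_).2 fun t ht => ?_
      · rw [potential, Real.exp_neg, Real.exp_log (div_pos hV₀ hx), inv_div]
      · simpa using hF.log_equation ht
    have h2 := h.const_mul (V₀ ^ (σ - 8 / 3))
    simp only [mul_zero] at h2
    exact h2
  asymptotics V₀ hV₀ := by
    have hc := cStar_pos (by linarith : 1 < σ) hσ₂
    have hlim : Tendsto (fun V : ℝ => (1 - V / V₀) ^ (1 / 3 : ℝ)) (𝓝[<] V₀) (𝓝 0) := by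
      have h : ContinuousAt (fun V : ℝ => (1 - V / V₀) ^ (1 / 3 : ℝ)) V₀ :=
        ContinuousAt.rpow_const (by fun_prop) (Or.inr (by norm_num))
      have := h.tendsto
      simp only [div_self hV₀.ne', sub_self,
        Real.zero_rpow (by norm_num : (1 / 3 : ℝ) ≠ 0)] at this
      exact this.mono_left nhdsWithin_le_nhds
    have h1 := hF.isBigO.comp_tendsto hlim
    have h2 : (fun V : ℝ => (1 - V / V₀) ^ (1 / 3 : ℝ)) =O[𝓝[<] V₀]
        fun V => (V₀ - V) ^ (1 / 3 : ℝ) := by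
      have h3 : (fun V : ℝ => (V₀ ^ (1 / 3 : ℝ))⁻¹ * (V₀ - V) ^ (1 / 3 : ℝ)) =O[𝓝[<] V₀]
        fun V => (V₀ - V) ^ (1 / 3 : ℝ) := (isBigO_refl _ _).const_mul_left _
      refine h3.congr' ?_ EventuallyEq.rfl
      filter_upwards [self_mem_nhdsWithin] with V (hV : V < V₀)
      have e : 1 - V / V₀ = (V₀ - V) / V₀ := by field_simp
      rw [e, Real.div_rpow (by linarith) hV₀.le]
      field_simp
    refine (h1.trans h2).congr' ?_ EventuallyEq.rfl
    filter_upwards [self_mem_nhdsWithin] with V (hV : V < V₀)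
    have n1 : cStar σ * V₀ ^ (-(2 / 3) : ℝ) * (V₀ - V) ^ (σ - 2) ≠ 0 := by
      have : 0 < V₀ - V := by linarith
      positivity
    simp only [Function.comp_apply]
    rw [green_of_lt σ F hV₀ hV, mul_div_cancel_left₀ _ n1]
  bounds V₀ hV₀ V hV := by
    have hc := cStar_pos (by linarith : 1 < σ) hσ₂
    have hx : 0 < V₀ - V := by linarith [hV.2]
    have hs := cbrt_mem (V := V / V₀) ⟨div_pos hV.1 hV₀, (div_lt_one hV₀).2 hV.2⟩
    have hpos : 0 < cStar σ * V₀ ^ (-(2 / 3) : ℝ) * (V₀ - V) ^ (σ - 2) := by positivity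
    rw [green_of_lt σ F hV₀ hV.2]
    exact ⟨mul_pos hpos (hF.pos hs), mul_le_of_le_one_right hpos.le (hF.le_one hσ₁ hσ₂ hs)⟩

end IsProfile

/-- Two fundamental solutions differ by a null solution which vanishes at the pole, the singular
terms of order `(V₀ - V)^{σ-2}` cancelling since `σ - 2 + 1/3 > 0`. -/
theorem IsFundamentalSolution.unique {σ : ℝ} (hσ₁ : 5 / 3 < σ) (hσ₂ : σ < 2) {G G' : ℝ → ℝ → ℝ}
    (hG : IsFundamentalSolution σ G) (hG' : IsFundamentalSolution σ G') {V₀ V : ℝ} (hV₀ : 0 < V₀)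
    (hV : V ∈ Ioo 0 V₀) : G' V V₀ = G V V₀ := by
  have hc := cStar_pos (by linarith : 1 < σ) hσ₂
  have hlim : Tendsto (fun V => G' V V₀ - G V V₀) (𝓝[<] V₀) (𝓝 0) := by
    have h1 := (hG'.asymptotics V₀ hV₀).sub (hG.asymptotics V₀ hV₀)
    have h2 := (isBigO_refl (fun V : ℝ => cStar σ * V₀ ^ (-(2 / 3) : ℝ) * (V₀ - V) ^ (σ - 2))
      (𝓝[<] V₀)).mul h1
    have h3 : Tendsto (fun V : ℝ => cStar σ * V₀ ^ (-(2 / 3) : ℝ) * (V₀ - V) ^ (σ - 2) *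
        (V₀ - V) ^ (1 / 3 : ℝ)) (𝓝[<] V₀) (𝓝 0) := by
      have h : ContinuousAt (fun V : ℝ => (V₀ - V) ^ (σ - 5 / 3)) V₀ :=
        ContinuousAt.rpow_const (by fun_prop) (Or.inr (by linarith))
      have h := h.tendsto
      simp only [sub_self, Real.zero_rpow (by linarith : σ - 5 / 3 ≠ 0)] at h
      have h := (h.mono_left (nhdsWithin_le_nhds (s := Iio V₀))).const_mul
        (cStar σ * V₀ ^ (-(2 / 3) : ℝ))
      rw [mul_zero] at h
      refine h.congr' ?_
      filter_upwards [self_mem_nhdsWithin] with V (hV : V < V₀)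
      rw [mul_assoc _ (_ ^ (σ - 2)), ← Real.rpow_add (by linarith)]
      congr 2; ring
    refine (h2.trans_tendsto h3).congr' ?_
    filter_upwards [self_mem_nhdsWithin] with V (hV : V < V₀)
    have n1 : cStar σ * V₀ ^ (-(2 / 3) : ℝ) * (V₀ - V) ^ (σ - 2) ≠ 0 := by
      have : 0 < V₀ - V := by linarith
      positivity
    generalize cStar σ * V₀ ^ (-(2 / 3) : ℝ) * (V₀ - V) ^ (σ - 2) = A at n1
    field_simp
    ring
  have heq : SolvesOn σ V₀ (fun V => G' V V₀ - G V V₀) fun _ => 0 := by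
    simpa using (hG'.equation V₀ hV₀).sub (hG.equation V₀ hV₀)
  have h := eq_zero_of_kInf_eq_zero
    ((hG'.analytic V₀ hV₀).continuousOn.sub (hG.analytic V₀ hV₀).continuousOn) hlim
    (fun V hV => by simp [hG'.vanish V₀ hV₀ V hV, hG.vanish V₀ hV₀ V hV]) heq V hV
  have h : G' V V₀ - G V V₀ = 0 := h
  linarith

/-! ### Data of the boundary value problem in logarithmic coordinates -/

/-- The rate of jumps of the process from `V` to `η`, so that
`𝒦_∞ φ(V) = ∫_V^∞ kern V η (φ(η) - φ(V)) dη`. -/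
def kern (σ V η : ℝ) : ℝ := (η - V) ^ (-σ) * (V ^ (1 / 3 : ℝ) + (η - V) ^ (1 / 3 : ℝ)) ^ 2

/-- The source `g` on `(0, b)` in the coordinate `t = log (b / V)`, with the weight that makes the
equation translation invariant. -/
def logSource (σ b : ℝ) (g : ℝ → ℝ) (t : ℝ) : ℝ :=
  if 0 < t then (b * Real.exp (-t)) ^ (σ - 5 / 3) * g (b * Real.exp (-t)) else 0

/-- The source produced in `t > 0` by the exterior values `ψ`, given on `t < 0` and written as a
function of `-t`. -/
def extSource (σ : ℝ) (ψ : ℝ → ℝ) (t : ℝ) : ℝ :=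
  if 0 < t then ∫ x in Ioi (0 : ℝ), levy σ (t + x) * ψ x else 0

lemma logSource_of_pos (σ b : ℝ) (g : ℝ → ℝ) {t : ℝ} (ht : 0 < t) :
    logSource σ b g t = (b * Real.exp (-t)) ^ (σ - 5 / 3) * g (b * Real.exp (-t)) := if_pos ht

lemma extSource_of_pos (σ : ℝ) (ψ : ℝ → ℝ) {t : ℝ} (ht : 0 < t) :
    extSource σ ψ t = ∫ x in Ioi (0 : ℝ), levy σ (t + x) * ψ x := if_pos ht

lemma image_mul_exp {b : ℝ} (hb : 0 < b) : (fun x : ℝ => b * Real.exp x) '' Ioi 0 = Ioi b := by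
  ext η
  constructor
  · rintro ⟨x, hx, rfl⟩
    have := Real.one_lt_exp_iff.2 hx
    simp only [mem_Ioi]; nlinarith
  · intro (h : b < η)
    refine ⟨Real.log (η / b), Real.log_pos (by rwa [one_lt_div hb]), ?_⟩
    simp only
    rw [Real.exp_log (div_pos (hb.trans h) hb)]
    field_simp

lemma image_mul_exp_neg {b : ℝ} (hb : 0 < b) (t : ℝ) :
    (fun z : ℝ => b * Real.exp (-z)) '' Ioo 0 t = Ioo (b * Real.exp (-t)) b := by
  ext x
  constructor
  · rintro ⟨z, hz, rfl⟩
    have h1 : Real.exp (-z) < 1 := by simpa using hz.1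
    have h2 : Real.exp (-t) < Real.exp (-z) := Real.exp_lt_exp.2 (by linarith [hz.2])
    exact ⟨by simp only; gcongr, by simp only; nlinarith⟩
  · intro h
    have hx : 0 < x := lt_trans (by positivity) h.1
    have he : Real.exp (-Real.log (b / x)) = x / b := by
      rw [Real.exp_neg, Real.exp_log (div_pos hb hx), inv_div]
    refine ⟨Real.log (b / x), ⟨Real.log_pos (by rw [one_lt_div hx]; exact h.2), ?_⟩, ?_⟩
    · rw [Real.log_lt_iff_lt_exp (div_pos hb hx), div_lt_iff₀ hx]
      have := mul_lt_mul_of_pos_right h.1 (Real.exp_pos t)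
      rw [mul_assoc, ← Real.exp_add, neg_add_cancel, Real.exp_zero, mul_one] at this
      linarith
    · simp only
      rw [he]; field_simp

/-- Integration against the jump rates in logarithmic coordinates. -/
lemma kern_log {σ b t : ℝ} (hb : 0 < b) (ht : 0 < t) (f : ℝ → ℝ) :
    (IntegrableOn (fun η => kern σ (b * Real.exp (-t)) η * f η) (Ioi b) ↔
      IntegrableOn (fun x => levy σ (t + x) * f (b * Real.exp x)) (Ioi 0)) ∧
    (b * Real.exp (-t)) ^ (σ - 5 / 3) * ∫ η in Ioi b, kern σ (b * Real.exp (-t)) η * f η =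
      ∫ x in Ioi (0 : ℝ), levy σ (t + x) * f (b * Real.exp x) := by
  set V := b * Real.exp (-t) with hV
  have hV0 : 0 < V := by positivity
  have hd : ∀ x ∈ Ioi (0 : ℝ), HasDerivWithinAt (fun x : ℝ => b * Real.exp x)
      (b * Real.exp x) (Ioi 0) x := fun x _ =>
    ((Real.hasDerivAt_exp x).const_mul b).hasDerivWithinAt
  have hinj : InjOn (fun x : ℝ => b * Real.exp x) (Ioi 0) := fun x _ y _ h =>
    Real.exp_injective (mul_left_cancel₀ hb.ne' h)
  have hpt : ∀ x ∈ Ioi (0 : ℝ), |b * Real.exp x| • (kern σ V (b * Real.exp x) *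
      f (b * Real.exp x)) = V ^ (5 / 3 - σ) * (levy σ (t + x) * f (b * Real.exp x)) := by
    intro x (hx : 0 < x)
    have hr := exp_sub_one_pos (show 0 < t + x by linarith)
    have e1 : b * Real.exp x = V * Real.exp (t + x) := by
      rw [hV, mul_assoc, ← Real.exp_add]; congr 2; ring
    have e2 : b * Real.exp x - V = V * (Real.exp (t + x) - 1) := by rw [e1]; ring
    have e3 : V ^ (5 / 3 - σ) = V * (V ^ (-σ) * (V ^ (1 / 3 : ℝ) * V ^ (1 / 3 : ℝ))) := by
      nth_rewrite 2 [← Real.rpow_one V]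
      rw [← Real.rpow_add hV0, ← Real.rpow_add hV0, ← Real.rpow_add hV0]; congr 1; ring
    rw [abs_of_pos (by positivity), smul_eq_mul, kern, e2, Real.mul_rpow hV0.le hr.le,
      Real.mul_rpow hV0.le hr.le, e3, levy]
    nth_rewrite 1 [e1]
    ring
  have hc : V ^ (5 / 3 - σ) ≠ 0 := (Real.rpow_pos_of_pos hV0 _).ne'
  constructor
  · have h := integrableOn_image_iff_integrableOn_abs_deriv_smul measurableSet_Ioi hd hinj
      (fun η => kern σ V η * f η)
    rw [image_mul_exp hb] at h
    rw [h, integrableOn_congr_fun hpt measurableSet_Ioi, IntegrableOn, IntegrableOn,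
      integrable_const_mul_iff hc.isUnit]
  · have h := integral_image_eq_integral_abs_deriv_smul measurableSet_Ioi hd hinj
      (fun η => kern σ V η * f η)
    rw [image_mul_exp hb] at h
    rw [h, setIntegral_congr_fun measurableSet_Ioi hpt, integral_const_mul, ← mul_assoc,
      ← Real.rpow_add hV0]
    simp

/-- Integration against the fundamental solution in logarithmic coordinates. -/
lemma green_log {σ b t : ℝ} (F : ℝ → ℝ) (hb : 0 < b) (h : ℝ → ℝ) :
    (IntegrableOn (fun V₀ => green σ F (b * Real.exp (-t)) V₀ * h V₀)
        (Ioo (b * Real.exp (-t)) b) ↔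
      IntegrableOn (fun z => potential σ F (t - z) * logSource σ b h z) (Ioo 0 t)) ∧
    ∫ V₀ in Ioo (b * Real.exp (-t)) b, green σ F (b * Real.exp (-t)) V₀ * h V₀ =
      hconv (potential σ F) (logSource σ b h) t := by
  have hd : ∀ z ∈ Ioo 0 t, HasDerivWithinAt (fun z : ℝ => b * Real.exp (-z))
      (b * (Real.exp (-z) * -1)) (Ioo 0 t) z := fun z _ =>
    (((hasDerivAt_id z).neg.exp).const_mul b).hasDerivWithinAt
  have hinj : InjOn (fun z : ℝ => b * Real.exp (-z)) (Ioo 0 t) := fun x _ y _ h =>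
    neg_injective (Real.exp_injective (mul_left_cancel₀ hb.ne' h))
  have hpt : ∀ z ∈ Ioo 0 t, |b * (Real.exp (-z) * -1)| •
      (green σ F (b * Real.exp (-t)) (b * Real.exp (-z)) * h (b * Real.exp (-z))) =
      potential σ F (t - z) * logSource σ b h z := by
    intro z hz
    have hz0 : 0 < b * Real.exp (-z) := by positivity
    have e1 : Real.log (b * Real.exp (-z) / (b * Real.exp (-t))) = t - z := by
      rw [mul_div_mul_left _ _ hb.ne', ← Real.exp_sub, Real.log_exp]; ring
    have e2 : (b * Real.exp (-z)) ^ (σ - 5 / 3) =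
        (b * Real.exp (-z)) * (b * Real.exp (-z)) ^ (σ - 8 / 3) := by
      nth_rewrite 2 [← Real.rpow_one (b * Real.exp (-z))]
      rw [← Real.rpow_add hz0]; congr 1; ring
    rw [green_eq_potential σ F (by positivity) hz0, e1, logSource_of_pos σ b h hz.1, e2,
      smul_eq_mul, show b * (Real.exp (-z) * -1) = -(b * Real.exp (-z)) by ring, abs_neg,
      abs_of_pos hz0]
    ring
  constructor
  · have k := integrableOn_image_iff_integrableOn_abs_deriv_smul measurableSet_Ioo hd hinj
      (fun V₀ => green σ F (b * Real.exp (-t)) V₀ * h V₀)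
    rw [image_mul_exp_neg hb] at k
    rw [k, integrableOn_congr_fun hpt measurableSet_Ioo]
  · have k := integral_image_eq_integral_abs_deriv_smul measurableSet_Ioo hd hinj
      (fun V₀ => green σ F (b * Real.exp (-t)) V₀ * h V₀)
    rw [image_mul_exp_neg hb] at k
    rw [k, setIntegral_congr_fun measurableSet_Ioo hpt, hconv]

lemma Causal.add {f g : ℝ → ℝ} (hf : Causal f) (hg : Causal g) : Causal fun t => f t + g t where
  measurable := hf.measurable.add hg.measurable
  zero t ht := by rw [hf.zero t ht, hg.zero t ht, add_zero]
  integrableOn c := (hf.integrableOn c).add (hg.integrableOn c)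
  lip a c ha := by
    obtain ⟨L, hL0, hL⟩ := hf.lip a c ha
    obtain ⟨L', hL0', hL'⟩ := hg.lip a c ha
    refine ⟨L + L', by positivity, fun x hx y hy => ?_⟩
    rw [show f x + g x - (f y + g y) = (f x - f y) + (g x - g y) by ring, add_mul]
    exact (abs_add_le _ _).trans (add_le_add (hL x hx y hy) (hL' x hx y hy))

lemma causal_of_lip {f : ℝ → ℝ} (h0 : ∀ t ≤ 0, f t = 0)
    (hlip : ∀ a c, 0 < a → ∃ L : ℝ, 0 ≤ L ∧
      ∀ x ∈ Icc a c, ∀ y ∈ Icc a c, |f x - f y| ≤ L * |x - y|)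
    (hint : ∀ c, ∃ B : ℝ → ℝ, IntegrableOn B (Ioc 0 c) ∧ ∀ t ∈ Ioc 0 c, |f t| ≤ B t) :
    Causal f := by
  have hcont : ContinuousOn f (Ioi 0) := by
    intro t (ht : 0 < t)
    obtain ⟨L, hL0, hL⟩ := hlip (t / 2) (t + 1) (half_pos ht)
    have hL' : LipschitzOnWith ⟨L, hL0⟩ f (Icc (t / 2) (t + 1)) :=
      LipschitzOnWith.of_dist_le_mul fun x hx y hy => hL x hx y hy
    exact (hL'.continuousOn.continuousAt
      (Icc_mem_nhds (by linarith) (by linarith))).continuousWithinAt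
  have hm := measurable_of_continuousOn_Ioi hcont h0
  refine ⟨hm, h0, fun c => ?_, hlip⟩
  obtain ⟨B, hB, hfB⟩ := hint c
  exact hB.mono' hm.aestronglyMeasurable ((ae_restrict_mem measurableSet_Ioc).mono hfB)

lemma abs_logSource_le {σ b M : ℝ} {g : ℝ → ℝ} (hb : 0 < b) (hg : ∀ V ∈ Ioo 0 b, |g V| ≤ M)
    {t : ℝ} (ht : 0 < t) :
    |logSource σ b g t| ≤ b ^ (σ - 5 / 3) * M * Real.exp (-(σ - 5 / 3) * t) := by
  have hmem : b * Real.exp (-t) ∈ Ioo 0 b :=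
    ⟨by positivity, mul_lt_of_lt_one_right hb (exp_neg_mem ht).2⟩
  rw [logSource_of_pos σ b g ht, abs_mul, Real.mul_rpow hb.le (Real.exp_pos _).le,
    ← Real.exp_mul, abs_of_pos (by positivity), show -t * (σ - 5 / 3) = -(σ - 5 / 3) * t by ring]
  have := hg _ hmem
  have h1 : 0 ≤ b ^ (σ - 5 / 3) * Real.exp (-(σ - 5 / 3) * t) := by positivity
  nlinarith

lemma causal_logSource {σ b : ℝ} {g : ℝ → ℝ} (hσ₁ : 5 / 3 < σ) (hb : 0 < b) (hg : LocLip b g)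
    (hM : ∃ M : ℝ, ∀ V ∈ Ioo 0 b, |g V| ≤ M) : Causal (logSource σ b g) := by
  obtain ⟨M, hM⟩ := hM
  have hM0 : 0 ≤ M := (abs_nonneg _).trans (hM (b / 2) ⟨by linarith, by linarith⟩)
  refine causal_of_lip (fun t ht => if_neg ht.not_gt) (fun a c ha => ?_) fun c =>
    ⟨fun _ => b ^ (σ - 5 / 3) * M, integrableOn_const measure_Ioc_lt_top.ne, fun t ht => ?_⟩
  · set δ := min (b * Real.exp (-c)) (b - b * Real.exp (-a)) with hδ
    have hδ0 : 0 < δ := lt_min (by positivity)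
      (sub_pos.2 (mul_lt_of_lt_one_right hb (exp_neg_mem ha).2))
    obtain ⟨L, hL⟩ := hg δ hδ0
    have hp : ContDiff ℝ 1 (fun t : ℝ => (b * Real.exp (-t)) ^ (σ - 5 / 3)) := by
      refine ContDiff.rpow_const_of_ne (by fun_prop) fun t => ?_
      positivity
    obtain ⟨K, hK⟩ := hp.contDiffOn.exists_lipschitzOnWith one_ne_zero (convex_Icc a c)
      isCompact_Icc
    have he : ContDiff ℝ 1 (fun t : ℝ => b * Real.exp (-t)) := by fun_prop
    obtain ⟨K', hK'⟩ := he.contDiffOn.exists_lipschitzOnWith one_ne_zero (convex_Icc a c)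
      isCompact_Icc
    refine ⟨b ^ (σ - 5 / 3) * (L * K') + M * K, by positivity, fun x hx y hy => ?_⟩
    have hx0 : 0 < x := ha.trans_le hx.1
    have hy0 : 0 < y := ha.trans_le hy.1
    have hmem : ∀ z ∈ Icc a c, b * Real.exp (-z) ∈ Icc δ (b - δ) := by
      intro z hz
      have h1 : b * Real.exp (-c) ≤ b * Real.exp (-z) := by gcongr; exact hz.2
      have h2 : b * Real.exp (-z) ≤ b * Real.exp (-a) := by gcongr; exact hz.1
      have h3 : δ ≤ b - b * Real.exp (-a) := min_le_right _ _
      exact ⟨(min_le_left _ _).trans h1, by linarith⟩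
    have k1 := hL.dist_le_mul _ (hmem x hx) _ (hmem y hy)
    have k2 := hK.dist_le_mul x hx y hy
    have k3 := hK'.dist_le_mul x hx y hy
    simp only [Real.dist_eq] at k1 k2 k3
    have hmy : b * Real.exp (-y) ∈ Ioo 0 b :=
      ⟨by positivity, mul_lt_of_lt_one_right hb (exp_neg_mem hy0).2⟩
    have k4 := hM _ hmy
    have k5 : (b * Real.exp (-x)) ^ (σ - 5 / 3) ≤ b ^ (σ - 5 / 3) :=
      Real.rpow_le_rpow (by positivity)
        (mul_le_of_le_one_right hb.le (exp_neg_mem hx0).2.le) (by linarith)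
    rw [logSource_of_pos σ b g hx0, logSource_of_pos σ b g hy0]
    set X := (b * Real.exp (-x)) ^ (σ - 5 / 3)
    set Y := (b * Real.exp (-y)) ^ (σ - 5 / 3)
    have hX : 0 ≤ X := by positivity
    calc |X * g (b * Real.exp (-x)) - Y * g (b * Real.exp (-y))|
        = |X * (g (b * Real.exp (-x)) - g (b * Real.exp (-y))) +
            (X - Y) * g (b * Real.exp (-y))| := by congr 1; ring
      _ ≤ X * |g (b * Real.exp (-x)) - g (b * Real.exp (-y))| +
            |X - Y| * |g (b * Real.exp (-y))| := by
          refine (abs_add_le _ _).trans ?_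
          rw [abs_mul, abs_mul, abs_of_nonneg hX]
      _ ≤ b ^ (σ - 5 / 3) * (L * (K' * |x - y|)) + K * |x - y| * M := by
          have : |g (b * Real.exp (-x)) - g (b * Real.exp (-y))| ≤ L * (K' * |x - y|) :=
            k1.trans (by gcongr)
          gcongr
      _ = _ := by ring
  · refine (abs_logSource_le hb hM ht.1).trans ?_
    have : Real.exp (-(σ - 5 / 3) * t) ≤ 1 := by
      rw [Real.exp_le_one_iff]; nlinarith [ht.1]
    have h1 : 0 ≤ b ^ (σ - 5 / 3) * M := by positivity
    nlinarith

section ExtSource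

variable {σ M : ℝ} {ψ : ℝ → ℝ}

lemma levy_add_integrable (hσ₁ : 5 / 3 < σ) {t : ℝ} (ht : 0 < t) :
    IntegrableOn (fun x => levy σ (t + x)) (Ioi 0) ∧
      ∫ x in Ioi (0 : ℝ), levy σ (t + x) = levyTail σ t := by
  have hmp := measurePreserving_add_left (volume : Measure ℝ) t
  have hemb : MeasurableEmbedding fun x : ℝ => t + x := measurableEmbedding_addLeft t
  have hpre : (fun x : ℝ => t + x) ⁻¹' Ioi t = Ioi 0 := by ext x; simp
  constructor
  · have := (hmp.integrableOn_comp_preimage hemb (f := levy σ) (s := Ioi t)).2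
      (integrableOn_levy hσ₁ ht)
    rwa [hpre] at this
  · rw [← integral_levy hσ₁ ht, ← hmp.setIntegral_preimage_emb hemb (levy σ) (Ioi t), hpre]

lemma extSource_integrable (hσ₁ : 5 / 3 < σ)
    (hψm : AEStronglyMeasurable ψ (volume.restrict (Ioi 0))) (hψ : ∀ x > 0, |ψ x| ≤ M) {t : ℝ}
    (ht : 0 < t) : IntegrableOn (fun x => levy σ (t + x) * ψ x) (Ioi 0) := by
  refine Integrable.mul_bdd (c := M) (levy_add_integrable hσ₁ ht).1 hψm ?_
  exact (ae_restrict_mem measurableSet_Ioi).mono fun x hx => hψ x hx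

lemma abs_extSource_le (hσ₁ : 5 / 3 < σ) (hψ : ∀ x > 0, |ψ x| ≤ M) {t : ℝ}
    (ht : 0 < t) : |extSource σ ψ t| ≤ M * levyTail σ t := by
  rw [extSource_of_pos σ ψ ht, ← (levy_add_integrable hσ₁ ht).2, ← integral_const_mul,
    ← Real.norm_eq_abs]
  refine norm_integral_le_of_norm_le ((levy_add_integrable hσ₁ ht).1.const_mul M)
    ((ae_restrict_mem measurableSet_Ioi).mono fun x (hx : 0 < x) => ?_)
  have h1 := levy_pos σ (show 0 < t + x by linarith)
  rw [norm_mul, Real.norm_of_nonneg h1.le, mul_comm]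
  gcongr
  exact hψ x hx

/-- The Lévy density being monotone, the modulus of continuity of `extSource` is that of the Lévy
tail. -/
lemma causal_extSource (hσ₁ : 5 / 3 < σ) (hσ₂ : σ < 2)
    (hψm : AEStronglyMeasurable ψ (volume.restrict (Ioi 0))) (hψ : ∀ x > 0, |ψ x| ≤ M) :
    Causal (extSource σ ψ) := by
  have hM0 : 0 ≤ M := (abs_nonneg _).trans (hψ 1 one_pos)
  refine causal_of_lip (fun t ht => if_neg ht.not_gt) (fun a c ha => ?_) fun c =>
    ⟨fun t => M * levyTail σ t, (integrableOn_levyTail hσ₁ hσ₂ c).const_mul M,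
      fun t ht => abs_extSource_le hσ₁ hψ ht.1⟩
  have key : ∀ x ∈ Icc a c, ∀ y ∈ Icc a c, x ≤ y →
      |extSource σ ψ x - extSource σ ψ y| ≤ M * levy σ a * |x - y| := by
    intro x hx y hy hxy
    have hx0 : 0 < x := ha.trans_le hx.1
    have hy0 : 0 < y := ha.trans_le hy.1
    have h1 : |extSource σ ψ x - extSource σ ψ y| ≤ M * (levyTail σ x - levyTail σ y) := by
      rw [extSource_of_pos σ ψ hx0, extSource_of_pos σ ψ hy0,
        ← integral_sub (extSource_integrable hσ₁ hψm hψ hx0) (extSource_integrable hσ₁ hψm hψ hy0),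
        ← (levy_add_integrable hσ₁ hx0).2, ← (levy_add_integrable hσ₁ hy0).2,
        ← integral_sub (levy_add_integrable hσ₁ hx0).1 (levy_add_integrable hσ₁ hy0).1,
        ← integral_const_mul, ← Real.norm_eq_abs]
      refine norm_integral_le_of_norm_le
        (((levy_add_integrable hσ₁ hx0).1.sub (levy_add_integrable hσ₁ hy0).1).const_mul M)
        ((ae_restrict_mem measurableSet_Ioi).mono fun z (hz : 0 < z) => ?_)
      have h2 := levy_anti hσ₁ (show 0 < x + z by linarith) (show x + z ≤ y + z by linarith)
      rw [← sub_mul, norm_mul, Real.norm_of_nonneg (sub_nonneg.2 h2), mul_comm]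
      have := hψ z hz
      have h3 := sub_nonneg.2 h2
      rw [Real.norm_eq_abs]
      gcongr
    have h2 : levyTail σ x - levyTail σ y ≤ levy σ a * |x - y| := by
      have hb := Convex.norm_image_sub_le_of_norm_hasDerivWithin_le (f := levyTail σ)
        (f' := fun z => -levy σ z) (C := levy σ a) (s := Icc a c)
        (fun z hz => (hasDerivAt_levyTail hσ₁ (ha.trans_le hz.1)).hasDerivWithinAt)
        (fun z hz => by
          rw [norm_neg, Real.norm_of_nonneg (levy_pos σ (ha.trans_le hz.1)).le]
          exact levy_anti hσ₁ ha hz.1) (convex_Icc a c) hy hx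
      exact (le_abs_self _).trans hb
    calc _ ≤ M * (levyTail σ x - levyTail σ y) := h1
      _ ≤ M * (levy σ a * |x - y|) := by gcongr
      _ = _ := by ring
  refine ⟨M * levy σ a, mul_nonneg hM0 (levy_pos σ ha).le, fun x hx y hy => ?_⟩
  rcases le_total x y with h | h
  · exact key x hx y hy h
  · rw [abs_sub_comm, abs_sub_comm x y]
    exact key y hy x hx h

end ExtSource

lemma hconv_comm (f g : ℝ → ℝ) (t : ℝ) : hconv f g t = hconv g f t := by
  rcases le_or_gt t 0 with ht | ht
  · simp [hconv, Ioo_eq_empty_of_le ht]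
  rw [hconv_eq_intervalIntegral f g ht.le, hconv_eq_intervalIntegral g f ht.le]
  have h := intervalIntegral.integral_comp_sub_left (a := 0) (b := t)
    (fun z => g (t - z) * f z) t
  rw [sub_self, sub_zero] at h
  rw [← h]
  refine intervalIntegral.integral_congr fun z _ => ?_
  simp only [sub_sub_cancel]
  ring

lemma Causal.hconv_add {f g h : ℝ → ℝ} (hf : Causal f) (hg : Causal g) (hh : Causal h) (t : ℝ) :
    hconv f (fun s => g s + h s) t = hconv f g t + hconv f h t := by
  simp only [hconv, mul_add]
  exact integral_add ((hf.integrableOn_mul hg t).mono_set Ioo_subset_Ioc_self)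
    ((hf.integrableOn_mul hh t).mono_set Ioo_subset_Ioc_self)

/-! ### Solution of the boundary value problem -/

/-- The effect of exterior values on `logOp`. -/
lemma logOp_of_exterior {σ M : ℝ} {W ψ Φ : ℝ → ℝ} (hσ₁ : 5 / 3 < σ) (hσ₂ : σ < 2) (hW : Causal W)
    (hψm : AEStronglyMeasurable ψ (volume.restrict (Ioi 0))) (hψ : ∀ x > 0, |ψ x| ≤ M)
    (hΦ : ∀ t, Φ t = if 0 < t then W t else ψ (-t)) {t : ℝ} (ht : 0 < t) :
    IntegrableOn (fun y => levy σ y * (Φ t - Φ (t - y))) (Ioi 0) ∧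
      logOp σ Φ t = logOp σ W t - extSource σ ψ t := by
  set k : ℝ → ℝ := fun y => levy σ y * ψ (y - t) with hk
  have e : ∀ y, levy σ y * (Φ t - Φ (t - y)) =
      levy σ y * (W t - W (t - y)) - (Ici t).indicator k y := by
    intro y
    rw [hΦ t, if_pos ht, hΦ (t - y)]
    rcases lt_or_ge y t with h | h
    · rw [if_pos (by linarith), indicator_of_notMem (by simpa using h), sub_zero]
    · rw [if_neg (by linarith), indicator_of_mem (mem_Ici.2 h), hW.zero (t - y) (by linarith),
        neg_sub]
      simp only [hk]
      ring
  have hmp := measurePreserving_add_left (volume : Measure ℝ) t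
  have hemb : MeasurableEmbedding fun x : ℝ => t + x := measurableEmbedding_addLeft t
  have hpre : (fun x : ℝ => t + x) ⁻¹' Ioi t = Ioi 0 := by ext x; simp
  have hkt : ∀ x, k (t + x) = levy σ (t + x) * ψ x := fun x => by simp [hk]
  have i2 : IntegrableOn k (Ioi t) := by
    rw [← hmp.integrableOn_comp_preimage hemb, hpre]
    simpa only [Function.comp_def, hkt] using extSource_integrable hσ₁ hψm hψ ht
  have i2' : IntegrableOn ((Ici t).indicator k) (Ioi 0) :=
    ((integrable_indicator_iff measurableSet_Ici).2
      ((integrableOn_Ici_iff_integrableOn_Ioi (by simp)).2 i2)).integrableOn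
  have v2 : ∫ y in Ioi (0 : ℝ), (Ici t).indicator k y = extSource σ ψ t := by
    rw [setIntegral_indicator measurableSet_Ici,
      inter_eq_self_of_subset_right (Ici_subset_Ioi.2 ht),
      integral_Ici_eq_integral_Ioi, ← hmp.setIntegral_preimage_emb hemb k (Ioi t), hpre,
      extSource_of_pos σ ψ ht]
    simp only [hkt]
  obtain ⟨_, hC⟩ := hW.exists_bound hσ₁ hσ₂ ht t
  have i1 := (hC t ⟨le_rfl, le_rfl⟩).1
  simp only [logOp, e]
  exact ⟨i1.sub i2', by rw [integral_sub i1 i2', v2]⟩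

lemma BddLip.exists_log_bound {b : ℝ} {Ψ : ℝ → ℝ} (hb : 0 < b) (hΨ : BddLip b Ψ) :
    ∃ M, 0 ≤ M ∧ (∀ x > 0, |Ψ (b * Real.exp x)| ≤ M) ∧ |Ψ b| ≤ M ∧
      ∀ x > 0, |Ψ (b * Real.exp x) - Ψ b| ≤ M * min x 1 := by
  obtain ⟨⟨M, hM⟩, L, hL⟩ := hΨ
  have hM0 : 0 ≤ M := (abs_nonneg _).trans (hM b (mem_Ici.2 le_rfl))
  have hmem : ∀ x > (0 : ℝ), b * Real.exp x ∈ Ici b := fun x hx =>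
    le_mul_of_one_le_right hb.le (Real.one_le_exp hx.le)
  have hK : 0 ≤ L * (b * Real.exp 1) := by positivity
  refine ⟨2 * M + L * (b * Real.exp 1), by positivity, fun x hx => ?_, ?_, fun x hx => ?_⟩
  · linarith [hM _ (hmem x hx)]
  · linarith [hM b (mem_Ici.2 le_rfl)]
  · rcases le_or_gt x 1 with h | h
    · have h1 := hL.dist_le_mul _ (hmem x hx) b (mem_Ici.2 le_rfl)
      rw [Real.dist_eq, Real.dist_eq, abs_of_nonneg (sub_nonneg.2 (mem_Ici.1 (hmem x hx)))] at h1
      have h2 : Real.exp x - 1 ≤ Real.exp 1 * x := by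
        have e1 := Real.add_one_le_exp (-x)
        have e2 : Real.exp (-x) * Real.exp x = 1 := by rw [← Real.exp_add]; simp
        have e3 : Real.exp x ≤ Real.exp 1 := Real.exp_le_exp.2 h
        have e4 := Real.exp_pos x
        nlinarith
      rw [min_eq_left h]
      calc _ ≤ L * (b * Real.exp x - b) := h1
        _ = L * b * (Real.exp x - 1) := by ring
        _ ≤ L * b * (Real.exp 1 * x) := by gcongr
        _ ≤ _ := by nlinarith
    · rw [min_eq_right h.le, mul_one]
      have h1 := hM _ (hmem x hx)
      have h2 := hM b (mem_Ici.2 le_rfl)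
      have := abs_sub (Ψ (b * Real.exp x)) (Ψ b)
      linarith

lemma BddLip.aestronglyMeasurable_log {b : ℝ} {Ψ : ℝ → ℝ} (hb : 0 < b) (hΨ : BddLip b Ψ) :
    AEStronglyMeasurable (fun x => Ψ (b * Real.exp x)) (volume.restrict (Ioi 0)) := by
  obtain ⟨L, hL⟩ := hΨ.2
  refine ContinuousOn.aestronglyMeasurable ?_ measurableSet_Ioi
  exact hL.continuousOn.comp (by fun_prop) fun x (hx : 0 < x) =>
    le_mul_of_one_le_right hb.le (Real.one_le_exp hx.le)

/-- The source, interior and exterior, of the boundary value problem in logarithmic coordinates. -/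
def bvpSource (σ b : ℝ) (g Ψ : ℝ → ℝ) (t : ℝ) : ℝ :=
  logSource σ b g t + extSource σ (fun x => Ψ (b * Real.exp x)) t

/-- The solution of the boundary value problem, with the value `Ψ b` at the point `b`. -/
def bvpSolution (σ : ℝ) (F : ℝ → ℝ) (b : ℝ) (g Ψ : ℝ → ℝ) (x : ℝ) : ℝ :=
  if b ≤ x then Ψ x else hconv (potential σ F) (bvpSource σ b g Ψ) (Real.log (b / x))

lemma bvpSolution_of_pos (σ : ℝ) (F : ℝ → ℝ) {b : ℝ} (g Ψ : ℝ → ℝ) (hb : 0 < b) {t : ℝ}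
    (ht : 0 < t) : bvpSolution σ F b g Ψ (b * Real.exp (-t)) =
      hconv (potential σ F) (bvpSource σ b g Ψ) t := by
  have h : b * Real.exp (-t) < b := mul_lt_of_lt_one_right hb (exp_neg_mem ht).2
  have e : b / (b * Real.exp (-t)) = Real.exp t := by
    rw [Real.exp_neg]; field_simp
  rw [bvpSolution, if_neg h.not_ge, e, Real.log_exp]

lemma exists_eq_mul_exp_neg {b V : ℝ} (hV : V ∈ Ioo 0 b) : ∃ t > 0, V = b * Real.exp (-t) := by
  have hb := hV.1.trans hV.2
  refine ⟨Real.log (b / V), Real.log_pos (by rw [one_lt_div hV.1]; exact hV.2), ?_⟩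
  rw [Real.exp_neg, Real.exp_log (div_pos hb hV.1), inv_div]
  field_simp

section BVP

variable {σ b : ℝ} {F g Ψ : ℝ → ℝ}

lemma causal_bvpSource (hσ₁ : 5 / 3 < σ) (hσ₂ : σ < 2) (hb : 0 < b) (hg : LocLip b g)
    (hM : ∃ M : ℝ, ∀ V ∈ Ioo 0 b, |g V| ≤ M) (hΨ : BddLip b Ψ) :
    Causal (bvpSource σ b g Ψ) := by
  obtain ⟨M, -, hΨM, -⟩ := hΨ.exists_log_bound hb
  exact (causal_logSource hσ₁ hb hg hM).add
    (causal_extSource hσ₁ hσ₂ (hΨ.aestronglyMeasurable_log hb) hΨM)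

/-- The source from the exterior values cancels against their effect on `logOp`, leaving `g`. -/
lemma solvesOn_bvpSolution (hF : IsProfile σ F) (hσ₁ : 5 / 3 < σ) (hσ₂ : σ < 2) (hb : 0 < b)
    (hg : LocLip b g) (hM : ∃ M : ℝ, ∀ V ∈ Ioo 0 b, |g V| ≤ M) (hΨ : BddLip b Ψ) :
    SolvesOn σ b (bvpSolution σ F b g Ψ) g := by
  obtain ⟨M, -, hΨM, -⟩ := hΨ.exists_log_bound hb
  have hH := causal_bvpSource hσ₁ hσ₂ hb hg hM hΨ
  have hU := hF.causal_potential hσ₁ hσ₂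
  set ψ : ℝ → ℝ := fun x => Ψ (b * Real.exp x) with hψ
  set W := hconv (potential σ F) (bvpSource σ b g Ψ) with hW
  set Φ : ℝ → ℝ := fun t => if 0 < t then W t else ψ (-t) with hΦ
  refine (solvesOn_iff_log hb (Φ := Φ) fun x hx => ?_).2 fun t ht => ?_
  · rcases lt_or_ge x b with h | h
    · have : 0 < Real.log (b / x) := Real.log_pos (by rwa [one_lt_div hx])
      rw [bvpSolution, if_neg h.not_ge, hΦ]
      simp only [if_pos this, hW]
    · have : ¬ 0 < Real.log (b / x) :=
        (Real.log_nonpos (by positivity) ((div_le_one hx).2 h)).not_gt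
      rw [bvpSolution, if_pos h, hΦ]
      simp only [if_neg this, hψ]
      rw [Real.exp_neg, Real.exp_log (div_pos hb hx), inv_div]
      congr 1; field_simp
  · obtain ⟨i, e⟩ := logOp_of_exterior (Φ := Φ) hσ₁ hσ₂ (hU.causal_hconv hH)
      (hΨ.aestronglyMeasurable_log hb) hΨM (fun _ => rfl) ht
    refine ⟨i, ?_⟩
    rw [e, hU.logOp_hconv hσ₁ hσ₂ (hF.potential_nonneg hσ₁ hσ₂)
      (fun t ht => hF.hconv_levyTail_potential hσ₁ hσ₂ ht) hH ht, bvpSource,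
      logSource_of_pos σ b g ht, add_sub_cancel_right]

lemma locLip_bvpSolution (hF : IsProfile σ F) (hσ₁ : 5 / 3 < σ) (hσ₂ : σ < 2) (hb : 0 < b)
    (hg : LocLip b g) (hM : ∃ M : ℝ, ∀ V ∈ Ioo 0 b, |g V| ≤ M) (hΨ : BddLip b Ψ) :
    LocLip b (bvpSolution σ F b g Ψ) := by
  intro δ hδ
  have hW := (hF.causal_potential hσ₁ hσ₂).causal_hconv (causal_bvpSource hσ₁ hσ₂ hb hg hM hΨ)
  rcases lt_or_ge (b - δ) δ with h | h
  · exact ⟨0, by simp [Icc_eq_empty h.not_ge]⟩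
  have hd : 0 < b - δ := hδ.trans_le h
  have ha : 0 < Real.log (b / (b - δ)) := Real.log_pos (by rw [one_lt_div hd]; linarith)
  obtain ⟨L, hL0, hL⟩ := hW.lip _ (Real.log (b / δ)) ha
  have hlog : ContDiffOn ℝ 1 (fun x : ℝ => Real.log (b / x)) (Icc δ (b - δ)) := by
    refine ContDiffOn.log (contDiffOn_const.div contDiffOn_id fun x hx => ?_) fun x hx => ?_
    · exact (hδ.trans_le hx.1).ne'
    · exact (div_pos hb (hδ.trans_le hx.1)).ne'
  obtain ⟨K, hK⟩ := hlog.exists_lipschitzOnWith one_ne_zero (convex_Icc _ _) isCompact_Icc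
  have hmem : ∀ x ∈ Icc δ (b - δ), Real.log (b / x) ∈
      Icc (Real.log (b / (b - δ))) (Real.log (b / δ)) := by
    intro x hx
    have hx0 : 0 < x := hδ.trans_le hx.1
    constructor
    · exact Real.log_le_log (by positivity) (by gcongr; exact hx.2)
    · exact Real.log_le_log (by positivity) (by gcongr; exact hx.1)
  refine ⟨L.toNNReal * K, LipschitzOnWith.of_dist_le_mul fun x hx y hy => ?_⟩
  rw [bvpSolution, bvpSolution, if_neg (by linarith [hx.2]), if_neg (by linarith [hy.2])]
  have h1 := hL _ (hmem x hx) _ (hmem y hy)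
  have h2 := hK.dist_le_mul x hx y hy
  rw [Real.dist_eq] at h2 ⊢
  refine h1.trans ((mul_le_mul_of_nonneg_left h2 hL0).trans (le_of_eq ?_))
  rw [NNReal.coe_mul, Real.coe_toNNReal L hL0, mul_assoc]

end BVP

/-! ### Behaviour at the boundary -/

section Boundary

variable {σ b : ℝ} {F g Ψ : ℝ → ℝ}

lemma exp_neg_le_levyTail (hσ₁ : 5 / 3 < σ) {t : ℝ} (ht : 0 < t) :
    Real.exp (-(σ - 5 / 3) * t) ≤ (σ - 5 / 3) * levyTail σ t := by
  have hr := exp_sub_one_pos ht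
  have h1 : (Real.exp t) ^ (5 / 3 - σ) ≤ (Real.exp t - 1) ^ (5 / 3 - σ) :=
    Real.rpow_le_rpow_of_nonpos hr (by linarith) (by linarith)
  rw [← Real.exp_mul, show t * (5 / 3 - σ) = -(σ - 5 / 3) * t by ring] at h1
  have h2 : (Real.exp t - 1) ^ (5 / 3 - σ) / (σ - 5 / 3) ≤ levyTail σ t := by
    have e1 : 0 ≤ (Real.exp t - 1) ^ (1 - σ) / (σ - 1) :=
      div_nonneg (by positivity) (by linarith)
    have e2 : 0 ≤ 2 * (Real.exp t - 1) ^ (4 / 3 - σ) / (σ - 4 / 3) :=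
      div_nonneg (by positivity) (by linarith)
    unfold levyTail
    linarith
  rw [div_le_iff₀ (by linarith)] at h2
  linarith

/-- Exterior values vanishing linearly at the boundary produce a bounded source. -/
lemma exists_extSource_le {M : ℝ} {ψ : ℝ → ℝ} (hσ₁ : 5 / 3 < σ) (hσ₂ : σ < 2)
    (hM : ∀ x > 0, |ψ x| ≤ M * min x 1) : ∃ C, ∀ t > 0, |extSource σ ψ t| ≤ C := by
  have hi : IntegrableOn (fun x => levy σ x * min x 1) (Ioi 0) := by
    rw [← Ioc_union_Ioi_eq_Ioi zero_le_one]
    refine IntegrableOn.union ?_ ?_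
    · refine (integrableOn_mul_levy hσ₁ hσ₂ 1).congr_fun (fun x hx => ?_) measurableSet_Ioc
      simp only [min_eq_left hx.2, mul_comm]
    · refine (integrableOn_levy hσ₁ one_pos).congr_fun (fun x hx => ?_) measurableSet_Ioi
      simp only [min_eq_right (le_of_lt (mem_Ioi.1 hx)), mul_one]
  have hM0 : 0 ≤ M := by
    have := (abs_nonneg _).trans (hM 1 one_pos)
    simpa using this
  refine ⟨∫ x in Ioi (0 : ℝ), M * (levy σ x * min x 1), fun t ht => ?_⟩
  rw [extSource_of_pos σ ψ ht, ← Real.norm_eq_abs]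
  refine norm_integral_le_of_norm_le (hi.const_mul M)
    ((ae_restrict_mem measurableSet_Ioi).mono fun x (hx : 0 < x) => ?_)
  have h1 := levy_anti hσ₁ hx (show x ≤ t + x by linarith)
  have h2 := levy_pos σ (show 0 < t + x by linarith)
  rw [norm_mul, Real.norm_of_nonneg h2.le, Real.norm_eq_abs]
  calc _ ≤ levy σ x * (M * min x 1) := mul_le_mul h1 (hM x hx) (abs_nonneg _) (levy_pos σ hx).le
    _ = _ := by ring

/-- Near `t = 0` the bound comes from integrating the leading power of the potential density; for
large `t` from comparison of the source with the Lévy tail, whose convolution with the potential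
density is `1`. -/
lemma IsProfile.exists_hconv_le (hF : IsProfile σ F) (hσ₁ : 5 / 3 < σ) (hσ₂ : σ < 2) {R : ℝ → ℝ}
    {B C : ℝ} (hB : ∀ t > 0, |R t| ≤ B * levyTail σ t)
    (hC : ∀ t > 0, |R t| ≤ C) :
    ∃ D, ∀ t > 0, |hconv (potential σ F) R t| ≤ D * (1 - Real.exp (-t)) ^ (σ - 1) := by
  have hU0 := hF.potential_nonneg hσ₁ hσ₂
  have hC0 : 0 ≤ C := (abs_nonneg _).trans (hC 1 one_pos)
  have hU := hF.causal_potential hσ₁ hσ₂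
  obtain ⟨K, hK0, hK⟩ := hF.exists_potential_le hσ₁ hσ₂ 1
  -- Useful for `t ≥ 1`; the comparison with the Lévy tail gives no decay as `t → 0`.
  have large : ∀ t > 0, |hconv (potential σ F) R t| ≤ B := by
    intro t ht
    rw [hconv_comm, ← mul_one B, ← hF.hconv_levyTail_potential hσ₁ hσ₂ ht, hconv, hconv,
      ← integral_const_mul, ← Real.norm_eq_abs]
    refine norm_integral_le_of_norm_le ((hU.integrableOn_levyTail_mul hσ₁ hσ₂ ht).const_mul B)
      ((ae_restrict_mem measurableSet_Ioo).mono fun z hz => ?_)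
    rw [norm_mul, Real.norm_of_nonneg (hU0 z), ← mul_assoc]
    exact mul_le_mul_of_nonneg_right (hB _ (by linarith [hz.2])) (hU0 z)
  have small : ∀ t ∈ Ioc (0 : ℝ) 1,
      |hconv (potential σ F) R t| ≤ C * K / (σ - 1) * t ^ (σ - 1) := by
    intro t ht
    have hi : IntegrableOn (fun z : ℝ => z ^ (σ - 2)) (Ioo 0 t) :=
      ((intervalIntegral.intervalIntegrable_rpow' (a := 0) (b := t) (r := σ - 2)
        (by linarith)).1).mono_set Ioo_subset_Ioc_self
    have hv : ∫ z in Ioo 0 t, z ^ (σ - 2) = t ^ (σ - 1) / (σ - 1) := by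
      rw [← integral_Ioc_eq_integral_Ioo, ← intervalIntegral.integral_of_le ht.1.le,
        integral_rpow (Or.inl (by linarith)), show σ - 2 + 1 = σ - 1 by ring,
        Real.zero_rpow (by linarith), sub_zero]
    rw [show C * K / (σ - 1) * t ^ (σ - 1) = C * K * (t ^ (σ - 1) / (σ - 1)) by ring, ← hv,
      hconv_comm, hconv, ← integral_const_mul, ← Real.norm_eq_abs]
    refine norm_integral_le_of_norm_le (hi.const_mul (C * K))
      ((ae_restrict_mem measurableSet_Ioo).mono fun z hz => ?_)
    rw [norm_mul, Real.norm_of_nonneg (hU0 z), mul_assoc]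
    exact mul_le_mul (hC _ (by linarith [hz.2])) (hK z ⟨hz.1, by linarith [hz.2, ht.2]⟩)
      (hU0 z) hC0
  have hB0 : 0 ≤ B := (abs_nonneg _).trans (large 1 one_pos)
  have hD : 0 ≤ C * K / (σ - 1) := div_nonneg (by positivity) (by linarith)
  refine ⟨(C * K / (σ - 1) + B) * Real.exp 1 ^ (σ - 1), fun t ht => ?_⟩
  have hq := one_sub_exp_neg_mem ht
  rw [mul_assoc, ← Real.mul_rpow (Real.exp_pos _).le hq.1.le]
  rcases le_or_gt t 1 with h | h
  · have h1 : t ≤ Real.exp 1 * (1 - Real.exp (-t)) := by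
      have e1 := Real.add_one_le_exp t
      have e2 : Real.exp (-t) * Real.exp t = 1 := by rw [← Real.exp_add]; simp
      have e3 : Real.exp t ≤ Real.exp 1 := Real.exp_le_exp.2 h
      nlinarith [hq.1]
    have h2 : t ^ (σ - 1) ≤ (Real.exp 1 * (1 - Real.exp (-t))) ^ (σ - 1) :=
      Real.rpow_le_rpow ht.le h1 (by linarith)
    have h3 : 0 ≤ t ^ (σ - 1) := by positivity
    calc _ ≤ C * K / (σ - 1) * t ^ (σ - 1) := small t ⟨ht, h⟩
      _ ≤ (C * K / (σ - 1) + B) * (Real.exp 1 * (1 - Real.exp (-t))) ^ (σ - 1) :=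
        mul_le_mul (by linarith) h2 h3 (by positivity)
  · have h1 : 1 ≤ Real.exp 1 * (1 - Real.exp (-t)) := by
      have e1 := Real.add_one_le_exp 1
      have e2 : Real.exp 1 * Real.exp (-1) = 1 := by rw [← Real.exp_add]; simp
      have e3 : Real.exp (-t) ≤ Real.exp (-1) := Real.exp_le_exp.2 (by linarith)
      nlinarith
    have h2 := Real.one_le_rpow h1 (by linarith : 0 ≤ σ - 1)
    calc _ ≤ B := large t ht
      _ ≤ (C * K / (σ - 1) + B) * 1 := by linarith
      _ ≤ _ := by gcongr

lemma extSource_const (hσ₁ : 5 / 3 < σ) (c : ℝ) {t : ℝ} (ht : 0 < t) :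
    extSource σ (fun _ => c) t = c * levyTail σ t := by
  rw [extSource_of_pos σ _ ht, integral_mul_const, (levy_add_integrable hσ₁ ht).2, mul_comm]

/-- Constant exterior values extend to a constant. -/
lemma IsProfile.hconv_potential_extSource_const (hF : IsProfile σ F) (hσ₁ : 5 / 3 < σ)
    (hσ₂ : σ < 2) (c : ℝ) {t : ℝ} (ht : 0 < t) :
    hconv (potential σ F) (extSource σ fun _ => c) t = c := by
  calc hconv (potential σ F) (extSource σ fun _ => c) t
      = ∫ z in Ioo 0 t, c * (levyTail σ (t - z) * potential σ F z) := by
        rw [hconv_comm]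
        exact setIntegral_congr_fun measurableSet_Ioo fun z hz => by
          simp only [extSource_const hσ₁ c (show 0 < t - z by linarith [hz.2]), mul_assoc]
    _ = c * hconv (levyTail σ) (potential σ F) t := integral_const_mul _ _
    _ = c := by rw [hF.hconv_levyTail_potential hσ₁ hσ₂ ht, mul_one]

/-- Subtracting from the solution its boundary value leaves a problem with exterior values vanishing
at the boundary, hence with bounded source. -/
lemma exists_decay_bvpSolution (hF : IsProfile σ F) (hσ₁ : 5 / 3 < σ) (hσ₂ : σ < 2) (hb : 0 < b)
    (hg : LocLip b g) (hM : ∃ M : ℝ, ∀ V ∈ Ioo 0 b, |g V| ≤ M) (hΨ : BddLip b Ψ) :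
    ∃ C : ℝ, ∀ V ∈ Ioo (0 : ℝ) b,
      (b - V) ^ (-(σ - 1)) * |bvpSolution σ F b g Ψ V - Ψ b| ≤ C := by
  obtain ⟨N, hN⟩ := hM
  have hN0 : 0 ≤ N := (abs_nonneg _).trans (hN (b / 2) ⟨by linarith, by linarith⟩)
  obtain ⟨M, hM0, hΨM, hΨb, hΨl⟩ := hΨ.exists_log_bound hb
  have hψm := hΨ.aestronglyMeasurable_log hb
  set ψ : ℝ → ℝ := fun x => Ψ (b * Real.exp x) with hψ
  have hU := hF.causal_potential hσ₁ hσ₂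
  have hdm : AEStronglyMeasurable (fun x => ψ x - Ψ b) (volume.restrict (Ioi 0)) :=
    hψm.sub aestronglyMeasurable_const
  have hdb : ∀ x > 0, |ψ x - Ψ b| ≤ M := fun x hx => (hΨl x hx).trans
    (mul_le_of_le_one_right hM0 (min_le_right _ _))
  have hE := causal_extSource hσ₁ hσ₂ hdm hdb
  have hE' := causal_extSource hσ₁ hσ₂ aestronglyMeasurable_const
    (ψ := fun _ => Ψ b) (fun _ _ => hΨb)
  have hR := (causal_logSource hσ₁ hb hg ⟨N, hN⟩).add hE
  set R : ℝ → ℝ := fun s => logSource σ b g s + extSource σ (fun x => ψ x - Ψ b) s with hRdef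
  -- The source `R` with exterior values `Ψ - Ψ b` carries the whole deviation from `Ψ b`.
  have hsplit : bvpSource σ b g Ψ = fun s => R s + extSource σ (fun _ => Ψ b) s := by
    funext s
    rcases le_or_gt s 0 with hs | hs
    · simp [hRdef, bvpSource, logSource, extSource, hs.not_gt]
    · have h : extSource σ ψ s - extSource σ (fun _ => Ψ b) s =
          extSource σ (fun x => ψ x - Ψ b) s := by
        rw [extSource_of_pos σ _ hs, extSource_of_pos σ _ hs, extSource_of_pos σ _ hs,
          ← integral_sub (extSource_integrable hσ₁ hψm hΨM hs)
            (extSource_integrable hσ₁ aestronglyMeasurable_const (fun _ _ => hΨb) hs)]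
        simp only [mul_sub]
      simp only [hRdef, bvpSource, ← h]
      ring
  obtain ⟨C₀, hC₀⟩ := exists_extSource_le hσ₁ hσ₂ hΨl
  have hc : 0 ≤ b ^ (σ - 5 / 3) * N := by positivity
  obtain ⟨D, hD⟩ := hF.exists_hconv_le hσ₁ hσ₂ (R := R)
    (B := b ^ (σ - 5 / 3) * N * (σ - 5 / 3) + M) (C := b ^ (σ - 5 / 3) * N + C₀)
    (fun t ht => by
      have h1 := abs_logSource_le hb hN ht (σ := σ)
      have h2 := mul_le_mul_of_nonneg_left (exp_neg_le_levyTail hσ₁ ht) hc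
      have h3 := abs_extSource_le hσ₁ hdb ht
      have h4 := abs_add_le (logSource σ b g t) (extSource σ (fun x => ψ x - Ψ b) t)
      rw [add_mul]
      linarith)
    (fun t ht => by
      have h1 := abs_logSource_le hb hN ht (σ := σ)
      have h2 : Real.exp (-(σ - 5 / 3) * t) ≤ 1 := by
        rw [Real.exp_le_one_iff]; nlinarith
      have h3 := mul_le_mul_of_nonneg_left h2 hc
      have h4 := abs_add_le (logSource σ b g t) (extSource σ (fun x => ψ x - Ψ b) t)
      linarith [hC₀ t ht])
  refine ⟨b ^ (-(σ - 1)) * D, fun V hV => ?_⟩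
  obtain ⟨t, ht, rfl⟩ := exists_eq_mul_exp_neg hV
  have hq := one_sub_exp_neg_mem ht
  have e1 : bvpSolution σ F b g Ψ (b * Real.exp (-t)) - Ψ b = hconv (potential σ F) R t := by
    rw [bvpSolution_of_pos σ F g Ψ hb ht, hsplit, hU.hconv_add hR hE',
      hF.hconv_potential_extSource_const hσ₁ hσ₂ _ ht, add_sub_cancel_right]
  rw [e1, show b - b * Real.exp (-t) = b * (1 - Real.exp (-t)) by ring,
    Real.mul_rpow hb.le hq.1.le, mul_assoc]
  refine mul_le_mul_of_nonneg_left ?_ (by positivity)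
  have hp := Real.rpow_pos_of_pos hq.1 (σ - 1)
  rw [Real.rpow_neg hq.1.le, inv_mul_le_iff₀ hp, mul_comm]
  exact hD t ht

lemma isBVPSolution_bvpSolution (hF : IsProfile σ F) (hσ₁ : 5 / 3 < σ) (hσ₂ : σ < 2) (hb : 0 < b)
    (hg : LocLip b g) (hM : ∃ M : ℝ, ∀ V ∈ Ioo 0 b, |g V| ≤ M) (hΨ : BddLip b Ψ) :
    IsBVPSolution σ b g Ψ (bvpSolution σ F b g Ψ) where
  locLip := locLip_bvpSolution hF hσ₁ hσ₂ hb hg hM hΨ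
  equation := solvesOn_bvpSolution hF hσ₁ hσ₂ hb hg hM hΨ
  boundary _ hV := if_pos hV.le
  decay := exists_decay_bvpSolution hF hσ₁ hσ₂ hb hg hM hΨ

/-! ### Uniqueness for the boundary value problem -/

lemma LocLip.continuousOn {f : ℝ → ℝ} (hf : LocLip b f) : ContinuousOn f (Ioo 0 b) := by
  intro V hV
  set δ := min V (b - V) / 2 with hδ
  have h0 : 0 < min V (b - V) := lt_min hV.1 (sub_pos.2 hV.2)
  have h1 : min V (b - V) ≤ V := min_le_left _ _
  have h2 : min V (b - V) ≤ b - V := min_le_right _ _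
  obtain ⟨L, hL⟩ := hf δ (half_pos h0)
  exact (hL.continuousOn.continuousAt
    (Icc_mem_nhds (by linarith) (by linarith))).continuousWithinAt

lemma IsBVPSolution.tendsto {u : ℝ → ℝ} (hσ₁ : 5 / 3 < σ) (hb : 0 < b)
    (hu : IsBVPSolution σ b g Ψ u) : Tendsto u (𝓝[<] b) (𝓝 (Ψ b)) := by
  obtain ⟨C, hC⟩ := hu.decay
  have h : ContinuousAt (fun V : ℝ => C * (b - V) ^ (σ - 1)) b :=
    (ContinuousAt.rpow_const (by fun_prop) (Or.inr (by linarith))).const_mul C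
  have h := h.tendsto
  simp only [sub_self, Real.zero_rpow (by linarith : σ - 1 ≠ 0), mul_zero] at h
  rw [tendsto_iff_dist_tendsto_zero]
  refine squeeze_zero' (Eventually.of_forall fun _ => dist_nonneg) ?_
    (h.mono_left nhdsWithin_le_nhds)
  filter_upwards [Ioo_mem_nhdsLT hb] with V hV
  have h1 := hC V hV
  have hp := Real.rpow_pos_of_pos (sub_pos.2 hV.2) (σ - 1)
  rw [Real.rpow_neg (sub_pos.2 hV.2).le, inv_mul_le_iff₀ hp, mul_comm] at h1
  exact h1

lemma IsBVPSolution.unique {u₁ u₂ : ℝ → ℝ} (hσ₁ : 5 / 3 < σ) (hb : 0 < b)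
    (h₁ : IsBVPSolution σ b g Ψ u₁) (h₂ : IsBVPSolution σ b g Ψ u₂) {V : ℝ} (hV : 0 < V)
    (hVb : V ≠ b) : u₁ V = u₂ V := by
  rcases lt_or_gt_of_ne hVb with h | h
  · have hlim := (h₁.tendsto hσ₁ hb).sub (h₂.tendsto hσ₁ hb)
    rw [sub_self] at hlim
    have heq : SolvesOn σ b (fun V => u₁ V - u₂ V) fun _ => 0 := by
      simpa using h₁.equation.sub h₂.equation
    have hout : ∀ V > b, u₁ V - u₂ V = 0 := fun V hV => by
      rw [h₁.boundary V hV, h₂.boundary V hV, sub_self]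
    exact sub_eq_zero.1 (eq_zero_of_kInf_eq_zero
      (h₁.locLip.continuousOn.sub h₂.locLip.continuousOn) hlim hout heq V ⟨hV, h⟩)
  · rw [h₁.boundary V h, h₂.boundary V h]

end Boundary

/-! ### The representation formula -/

section Representation

variable {σ b : ℝ} {F g Ψ : ℝ → ℝ}

lemma measurable_kern (σ : ℝ) : Measurable (Function.uncurry (kern σ)) := by
  unfold Function.uncurry kern
  fun_prop

lemma kern_nonneg {V η : ℝ} (h : V ≤ η) : 0 ≤ kern σ V η :=
  mul_nonneg (Real.rpow_nonneg (sub_nonneg.2 h) _) (sq_nonneg _)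

lemma integrableOn_kern_mul (hσ₁ : 5 / 3 < σ) (hb : 0 < b) (hΨ : BddLip b Ψ) {V : ℝ}
    (hV : V ∈ Ioo 0 b) : IntegrableOn (fun η => kern σ V η * Ψ η) (Ioi b) := by
  obtain ⟨M, -, hΨM, -⟩ := hΨ.exists_log_bound hb
  obtain ⟨t, ht, rfl⟩ := exists_eq_mul_exp_neg hV
  exact (kern_log hb ht Ψ).1.2
    (extSource_integrable hσ₁ (hΨ.aestronglyMeasurable_log hb) hΨM ht)

lemma bddLip_const (b c : ℝ) : BddLip b fun _ => c :=
  ⟨⟨|c|, fun _ _ => le_rfl⟩, 0, (LipschitzWith.const c).lipschitzOnWith⟩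

/-- Exterior values act as the source obtained by integrating them against the jump rates. -/
lemma logSource_integral_kern (hb : 0 < b) (Ψ : ℝ → ℝ) :
    logSource σ b (fun V => ∫ η in Ioi b, kern σ V η * Ψ η) =
      extSource σ fun x => Ψ (b * Real.exp x) := by
  funext t
  rcases le_or_gt t 0 with ht | ht
  · simp [logSource, extSource, ht.not_gt]
  · rw [logSource_of_pos σ b _ ht, extSource_of_pos σ _ ht, (kern_log hb ht Ψ).2]

lemma integrableOn_green_mul (hF : IsProfile σ F) (hσ₁ : 5 / 3 < σ) (hσ₂ : σ < 2) (hb : 0 < b)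
    {h : ℝ → ℝ} (hh : Causal (logSource σ b h)) {V : ℝ} (hV : V ∈ Ioo 0 b) :
    IntegrableOn (fun V₀ => green σ F V V₀ * h V₀) (Ioo V b) := by
  obtain ⟨t, -, rfl⟩ := exists_eq_mul_exp_neg hV
  exact (green_log F hb h).1.2 (((hF.causal_potential hσ₁ hσ₂).integrableOn_mul hh t).mono_set
    Ioo_subset_Ioc_self)

lemma integrableOn_green (hF : IsProfile σ F) (hσ₁ : 5 / 3 < σ) (hσ₂ : σ < 2) (hb : 0 < b)
    {V : ℝ} (hV : V ∈ Ioo 0 b) : IntegrableOn (fun V₀ => green σ F V V₀) (Ioo V b) := by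
  have hc : LocLip b fun _ => (1 : ℝ) := fun _ _ => ⟨0, (LipschitzWith.const 1).lipschitzOnWith⟩
  simpa using integrableOn_green_mul hF hσ₁ hσ₂ hb
    (causal_logSource hσ₁ hb hc ⟨1, fun _ _ => by simp⟩) hV

lemma IsProfile.green_nonneg (hF : IsProfile σ F) (hσ₁ : 5 / 3 < σ) (hσ₂ : σ < 2) {V V₀ : ℝ}
    (hV : 0 < V) (hV₀ : 0 < V₀) : 0 ≤ green σ F V V₀ := by
  rw [green_eq_potential σ F hV hV₀]
  exact mul_nonneg (by positivity) (hF.potential_nonneg hσ₁ hσ₂ _)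

lemma integrableOn_poissonIntegrand (hF : IsProfile σ F) (hσ₁ : 5 / 3 < σ) (hσ₂ : σ < 2)
    (hb : 0 < b) {V η : ℝ} (hV : V ∈ Ioo 0 b) (hη : b < η) :
    IntegrableOn (poissonIntegrand σ (green σ F) V η) (Ioo 0 b) := by
  have h1 : IntegrableOn (fun V₀ => green σ F V V₀ * kern σ V₀ η) (Ioo V b) := by
    refine Integrable.mul_bdd (c := (η - b) ^ (-σ) * (b ^ (1 / 3 : ℝ) + η ^ (1 / 3 : ℝ)) ^ 2)
      (integrableOn_green hF hσ₁ hσ₂ hb hV)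
      ((measurable_kern σ).comp (measurable_id.prodMk measurable_const)).aestronglyMeasurable ?_
    refine (ae_restrict_mem measurableSet_Ioo).mono fun V₀ hV₀ => ?_
    have h0 : 0 < V₀ := hV.1.trans hV₀.1
    have h2 : 0 < η - b := sub_pos.2 hη
    have h3 : 0 ≤ η - V₀ := by linarith [hV₀.2]
    rw [Real.norm_of_nonneg (kern_nonneg (by linarith)), kern]
    have e1 : (η - V₀) ^ (-σ) ≤ (η - b) ^ (-σ) :=
      Real.rpow_le_rpow_of_nonpos h2 (by linarith [hV₀.2]) (by linarith)
    have e2 : V₀ ^ (1 / 3 : ℝ) ≤ b ^ (1 / 3 : ℝ) :=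
      Real.rpow_le_rpow h0.le hV₀.2.le (by norm_num)
    have e3 : (η - V₀) ^ (1 / 3 : ℝ) ≤ η ^ (1 / 3 : ℝ) :=
      Real.rpow_le_rpow h3 (by linarith) (by norm_num)
    have e4 : 0 ≤ (η - b) ^ (-σ) := by positivity
    gcongr
  refine h1.of_forall_sdiff_eq_zero measurableSet_Ioo fun V₀ hV₀ => ?_
  have h : V₀ ≤ V := not_lt.1 fun h => hV₀.2 ⟨h, hV₀.1.2⟩
  simp only [green_of_ge σ F hV₀.1.1 h, zero_mul]

lemma poissonKernel_green (σ : ℝ) (F : ℝ → ℝ) {V : ℝ} (hV : V ∈ Ioo 0 b) (η : ℝ) :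
    poissonKernel σ (green σ F) b V η = ∫ V₀ in Ioo V b, green σ F V V₀ * kern σ V₀ η := by
  rw [poissonKernel, if_pos hV.2]
  refine setIntegral_eq_of_subset_of_forall_sdiff_eq_zero measurableSet_Ioo
    (Ioo_subset_Ioo_left hV.1.le) fun V₀ hV₀ => ?_
  have h : V₀ ≤ V := not_lt.1 fun h => hV₀.2 ⟨h, hV₀.1.2⟩
  rw [poissonIntegrand, green_of_ge σ F hV₀.1.1 h, zero_mul]

/-- The contribution of the exterior values, by Fubini. -/
lemma integral_poissonKernel_mul (hF : IsProfile σ F) (hσ₁ : 5 / 3 < σ) (hσ₂ : σ < 2)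
    (hb : 0 < b) (hΨ : BddLip b Ψ) {V : ℝ} (hV : V ∈ Ioo 0 b) :
    IntegrableOn (fun η => poissonKernel σ (green σ F) b V η * Ψ η) (Ioi b) ∧
    ∫ η in Ioi b, poissonKernel σ (green σ F) b V η * Ψ η =
      ∫ V₀ in Ioo V b, green σ F V V₀ * ∫ η in Ioi b, kern σ V₀ η * Ψ η := by
  obtain ⟨M, hM⟩ := hΨ.1
  have hcont : ContinuousOn Ψ (Ioi b) :=
    hΨ.2.choose_spec.continuousOn.mono Ioi_subset_Ici_self
  set f : ℝ → ℝ → ℝ := fun V₀ η => green σ F V V₀ * (kern σ V₀ η * Ψ η) with hf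
  have hmeas : AEStronglyMeasurable (Function.uncurry f)
      ((volume.restrict (Ioo V b)).prod (volume.restrict (Ioi b))) :=
    (integrableOn_green hF hσ₁ hσ₂ hb hV).aestronglyMeasurable.comp_fst.mul
      ((measurable_kern σ).aestronglyMeasurable.mul
        (hcont.aestronglyMeasurable measurableSet_Ioi).comp_snd)
  have hsec : ∀ V₀ ∈ Ioo V b, IntegrableOn (f V₀) (Ioi b) := fun V₀ hV₀ =>
    (integrableOn_kern_mul hσ₁ hb hΨ ⟨hV.1.trans hV₀.1, hV₀.2⟩).const_mul _
  -- The constant exterior value `M` provides the majorant for Fubini.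
  have hdom : IntegrableOn (fun V₀ => green σ F V V₀ * ∫ η in Ioi b, kern σ V₀ η * M)
      (Ioo V b) := by
    refine integrableOn_green_mul hF hσ₁ hσ₂ hb ?_ hV
    rw [logSource_integral_kern hb fun _ => M]
    exact causal_extSource hσ₁ hσ₂ aestronglyMeasurable_const fun _ _ => le_rfl
  have hint : Integrable (Function.uncurry f)
      ((volume.restrict (Ioo V b)).prod (volume.restrict (Ioi b))) := by
    rw [integrable_prod_iff hmeas]
    refine ⟨(ae_restrict_mem measurableSet_Ioo).mono fun V₀ hV₀ => hsec V₀ hV₀,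
      hdom.mono' hmeas.norm.integral_prod_right' ?_⟩
    refine (ae_restrict_mem measurableSet_Ioo).mono fun V₀ hV₀ => ?_
    have h0 : V₀ ∈ Ioo 0 b := ⟨hV.1.trans hV₀.1, hV₀.2⟩
    rw [Real.norm_of_nonneg (integral_nonneg fun _ => norm_nonneg _), ← integral_const_mul]
    refine setIntegral_mono_on (hsec V₀ hV₀).norm
      ((integrableOn_kern_mul hσ₁ hb (bddLip_const b M) h0).const_mul _) measurableSet_Ioi
      fun η (hη : b < η) => ?_
    have h1 := kern_nonneg (σ := σ) (show V₀ ≤ η by linarith [hV₀.2])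
    have h2 := hF.green_nonneg hσ₁ hσ₂ hV.1 h0.1
    have h3 := hM η hη.le
    simp only [Function.uncurry, hf, norm_mul, Real.norm_of_nonneg h1, Real.norm_of_nonneg h2,
      Real.norm_eq_abs (Ψ η)]
    gcongr
  have e : ∀ η, ∫ V₀ in Ioo V b, f V₀ η = poissonKernel σ (green σ F) b V η * Ψ η := by
    intro η
    simp only [hf, ← mul_assoc]
    rw [integral_mul_const, poissonKernel_green σ F hV]
  constructor
  · have h := hint.integral_prod_right
    simpa only [IntegrableOn, Function.uncurry, e] using h
  · have h := integral_integral_swap hint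
    simp only [e] at h
    rw [← h]
    simp only [hf, integral_const_mul]

lemma bvpSolution_eq (hF : IsProfile σ F) (hσ₁ : 5 / 3 < σ) (hσ₂ : σ < 2)
    (hb : 0 < b) (hg : LocLip b g) (hM : ∃ M : ℝ, ∀ V ∈ Ioo 0 b, |g V| ≤ M) (hΨ : BddLip b Ψ)
    {V : ℝ} (hV : V ∈ Ioo 0 b) :
    bvpSolution σ F b g Ψ V = (∫ V₀ in Ioo V b, green σ F V V₀ * g V₀) +
      ∫ η in Ioi b, poissonKernel σ (green σ F) b V η * Ψ η := by
  obtain ⟨M, -, hΨM, -⟩ := hΨ.exists_log_bound hb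
  rw [(integral_poissonKernel_mul hF hσ₁ hσ₂ hb hΨ hV).2]
  obtain ⟨t, ht, rfl⟩ := exists_eq_mul_exp_neg hV
  rw [bvpSolution_of_pos σ F g Ψ hb ht, (green_log F hb g).2, (green_log F hb _).2,
    logSource_integral_kern hb Ψ]
  exact (hF.causal_potential hσ₁ hσ₂).hconv_add (causal_logSource hσ₁ hb hg hM)
    (causal_extSource hσ₁ hσ₂ (hΨ.aestronglyMeasurable_log hb) hΨM) t

end Representation

end Coagulation

end

theorem mainTheorem6 (σ : ℝ) (hσ₁ : 5 / 3 < σ) (hσ₂ : σ < 2) :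
    ∃ G : ℝ → ℝ → ℝ,
      Coagulation.IsFundamentalSolution σ G ∧
      (∀ G' : ℝ → ℝ → ℝ, Coagulation.IsFundamentalSolution σ G' →
        ∀ V₀ > 0, ∀ V ∈ Ioo 0 V₀, G' V V₀ = G V V₀) ∧
      ∀ (b : ℝ) (g Ψ : ℝ → ℝ), 0 < b →
        Coagulation.LocLip b g → (∃ M : ℝ, ∀ V ∈ Ioo 0 b, |g V| ≤ M) →
        Coagulation.BddLip b Ψ →
        (∃ u : ℝ → ℝ, Coagulation.IsBVPSolution σ b g Ψ u) ∧
        (∀ u₁ u₂ : ℝ → ℝ, Coagulation.IsBVPSolution σ b g Ψ u₁ →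
          Coagulation.IsBVPSolution σ b g Ψ u₂ → ∀ V > 0, V ≠ b → u₁ V = u₂ V) ∧
        (∀ u : ℝ → ℝ, Coagulation.IsBVPSolution σ b g Ψ u → ∀ V ∈ Ioo 0 b,
          IntegrableOn (fun V₀ => G V V₀ * g V₀) (Ioo V b) ∧
          (∀ η > b, IntegrableOn (Coagulation.poissonIntegrand σ G V η) (Ioo 0 b)) ∧
          IntegrableOn (fun η => Coagulation.poissonKernel σ G b V η * Ψ η) (Ioi b) ∧
          u V = (∫ V₀ in Ioo V b, G V V₀ * g V₀) +
            ∫ η in Ioi b, Coagulation.poissonKernel σ G b V η * Ψ η) := by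
  open Coagulation in
  obtain ⟨F, hF⟩ := exists_isProfile hσ₁ hσ₂
  have hG := hF.isFundamentalSolution hσ₁ hσ₂
  refine ⟨green σ F, hG, fun G' hG' V₀ hV₀ V hV => hG.unique hσ₁ hσ₂ hG' hV₀ hV,
    fun b g Ψ hb hg hM hΨ => ?_⟩
  have hsol := isBVPSolution_bvpSolution hF hσ₁ hσ₂ hb hg hM hΨ
  refine ⟨⟨_, hsol⟩, fun u₁ u₂ h₁ h₂ V hV hVb => h₁.unique hσ₁ hb h₂ hV hVb, fun u hu V hV => ?_⟩
  refine ⟨integrableOn_green_mul hF hσ₁ hσ₂ hb (causal_logSource hσ₁ hb hg hM) hV,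
    fun η hη => integrableOn_poissonIntegrand hF hσ₁ hσ₂ hb hV hη,
    (integral_poissonKernel_mul hF hσ₁ hσ₂ hb hΨ hV).1, ?_⟩
  rw [hu.unique hσ₁ hb hsol hV.1 hV.2.ne]
  exact bvpSolution_eq hF hσ₁ hσ₂ hb hg hM hΨ hV
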